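/- Let $\mathfrak{o}$ be a complete discrete valuation ring with maximal ideal $\mathfrak{m}$ and perfect residue field $k$ of characteristic $p>0$. Fix $\omega\in(0,1)$ and an absolute value $|\cdot|$ on $\mathfrak{o}$ defining its topology. For integers $m,n\ge 0$ and real $r>0$, let $\mathbf{A}\langle T_1,\dots,T_m\rangle\langle\langle U_1,\dots,U_n\rangle\rangle^{\dagger,r}$ be the completion of $\mathfrak{o}[\pi,T_1,\dots,T_m][[U_1,\dots,U_n]][\pi^{-1}]$ for the norm $\left|\sum a_{i,j,l}\,\pi^iT^jU^l\right|_r=\max_{i,j,l}|a_{i,j,l}|\,\omega^{ri}$, and let $\mathbf{A}\langle T_1,\dots,T_m\rangle\langle\langle U_1,\dots,U_n\rangle\rangle^{\dagger}$ be the union of these rings over all $r>0$. A mixed affinoid algebra over $k((\overline{\pi}))$ is a quotient $A$ of a $k((\overline{\pi}))$-algebra of the form $k[[\overline{\pi}]]\langle T_1,\dots,T_m\rangle[[U_1,\dots,U_n]][\overline{\pi}^{-1}]$, with its quotient Banach algebra structure. A dagger lift of $A$ is a flat $\mathfrak{o}$-algebra $S$ with $S/\mathfrak{m}S\cong A$ which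 is a quotient of the $\mathfrak{o}$-algebra $\mathbf{A}\langle T_1,\dots,T_m\rangle\langle\langle U_1,\dots,U_n\rangle\rangle^{\dagger}$ for some $m,n$. Let $A$ be a regular mixed affinoid algebra over $k((\overline{\pi}))$, let $S$ be a dagger lift of $A$, let $q$ be a power of $p$, and let $g:S\to S$ be a ring homomorphism whose reduction $A\to A$ is the $q$-power Frobenius map $x\mapsto x^q$. If $\mathfrak{o}$ has characteristic $p$, assume in addition that $\mathfrak{m}^NS\subseteq g(\mathfrak{m}S)\,S$ for some $N\geq 0$ (as is the case, for instance, if $g$ is $\mathfrak{o}$-linear; if $\mathfrak{o}$ has characteristic $0$, nothing is assumed). Then $g$ is finite and flat. -/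

import Mathlib

namespace DaggerLift

open IsLocalRing

noncomputable section

/-! ### Bilateral series in one variable -/

/-- Formal sums `∑ aᵢ πⁱ` over `i ∈ ℤ`, with coefficients in a local ring `𝔬`, such that `aᵢ → 0`
for the `𝔪`-adic topology as `i → -∞`. -/
@[ext]
structure Bilateral (𝔬 : Type*) [CommRing 𝔬] [IsLocalRing 𝔬] where
  /-- The coefficient of `πⁱ`. -/
  coeff : ℤ → 𝔬
  small : ∀ N : ℕ, ∃ M : ℤ, ∀ i < M, coeff i ∈ maximalIdeal 𝔬 ^ N

namespace Bilateral

section Ring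

variable {𝔬 : Type*} [CommRing 𝔬] [IsLocalRing 𝔬]

/-- The reduction of a bilateral series modulo `𝔪ᴺ`, which is a Laurent series. -/
def mod (N : ℕ) (a : Bilateral 𝔬) : LaurentSeries (𝔬 ⧸ maximalIdeal 𝔬 ^ N) :=
  HahnSeries.ofSuppBddBelow (fun i => Ideal.Quotient.mk (maximalIdeal 𝔬 ^ N) (a.coeff i)) <| by
    obtain ⟨M, hM⟩ := a.small N
    refine ⟨M, fun i hi => ?_⟩
    by_contra h
    exact hi (Ideal.Quotient.eq_zero_iff_mem.2 (hM i (not_le.1 h)))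

@[simp]
theorem coeff_mod (N : ℕ) (a : Bilateral 𝔬) (i : ℤ) :
    (a.mod N).coeff i = Ideal.Quotient.mk (maximalIdeal 𝔬 ^ N) (a.coeff i) := rfl

theorem mod_map {m n : ℕ} (h : m ≤ n) (a : Bilateral 𝔬) :
    (a.mod n).map (Ideal.Quotient.factor (Ideal.pow_le_pow_right (I := maximalIdeal 𝔬) h)) =
      a.mod m := by
  ext i
  simp

instance : Zero (Bilateral 𝔬) := ⟨⟨fun _ => 0, fun _ => ⟨0, fun _ _ => Ideal.zero_mem _⟩⟩⟩

instance : Add (Bilateral 𝔬) :=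
  ⟨fun a b => ⟨fun i => a.coeff i + b.coeff i, fun N => by
    obtain ⟨M, hM⟩ := a.small N
    obtain ⟨M', hM'⟩ := b.small N
    exact ⟨min M M', fun i hi => Ideal.add_mem _ (hM i (lt_of_lt_of_le hi (min_le_left _ _)))
      (hM' i (lt_of_lt_of_le hi (min_le_right _ _)))⟩⟩⟩

instance : Neg (Bilateral 𝔬) :=
  ⟨fun a => ⟨fun i => -a.coeff i, fun N => by
    obtain ⟨M, hM⟩ := a.small N
    exact ⟨M, fun i hi => neg_mem (hM i hi)⟩⟩⟩

/-- The monomial `x πⁿ`. -/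
def single (n : ℤ) (x : 𝔬) : Bilateral 𝔬 :=
  ⟨fun i => if i = n then x else 0, fun N => ⟨n, fun i hi => by
    rw [if_neg hi.ne]
    exact Ideal.zero_mem _⟩⟩

instance : One (Bilateral 𝔬) := ⟨single 0 1⟩

@[simp] theorem coeff_zero (i : ℤ) : (0 : Bilateral 𝔬).coeff i = 0 := rfl

@[simp] theorem coeff_add (a b : Bilateral 𝔬) (i : ℤ) :
    (a + b).coeff i = a.coeff i + b.coeff i := rfl

@[simp] theorem coeff_neg (a : Bilateral 𝔬) (i : ℤ) : (-a).coeff i = -a.coeff i := rfl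

theorem coeff_single (n : ℤ) (x : 𝔬) (i : ℤ) :
    (single n x).coeff i = if i = n then x else 0 := rfl

theorem coeff_one (i : ℤ) : (1 : Bilateral 𝔬).coeff i = if i = 0 then 1 else 0 := rfl

theorem mod_zero (N : ℕ) : (0 : Bilateral 𝔬).mod N = 0 := by
  ext i
  simp

theorem mod_add (N : ℕ) (a b : Bilateral 𝔬) : (a + b).mod N = a.mod N + b.mod N := by
  ext i
  simp

theorem mod_neg (N : ℕ) (a : Bilateral 𝔬) : (-a).mod N = -a.mod N := by
  ext i
  simp

theorem mod_single (N : ℕ) (n : ℤ) (x : 𝔬) :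
    (single n x).mod N = HahnSeries.single n (Ideal.Quotient.mk _ x) := by
  ext i
  rw [coeff_mod, coeff_single, HahnSeries.coeff_single]
  split_ifs <;> simp

theorem mod_one (N : ℕ) : (1 : Bilateral 𝔬).mod N = 1 := by
  rw [show (1 : Bilateral 𝔬) = single 0 1 from rfl, mod_single, map_one]
  rfl

variable [IsAdicComplete (maximalIdeal 𝔬) 𝔬]

theorem mod_injective {a b : Bilateral 𝔬} (h : ∀ N, a.mod N = b.mod N) : a = b := by
  ext i
  refine sub_eq_zero.1 (IsHausdorff.haus (I := maximalIdeal 𝔬) inferInstance _ fun N => ?_)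
  rw [SModEq.zero, smul_eq_mul, Ideal.mul_top, ← Ideal.Quotient.eq]
  exact congrArg (fun c => HahnSeries.coeff c i) (h N)

theorem exists_mul (a b : Bilateral 𝔬) :
    ∃ c : Bilateral 𝔬, ∀ N, c.mod N = a.mod N * b.mod N := by
  have key : ∀ i : ℤ, ∃ L : 𝔬, ∀ N : ℕ,
      Ideal.Quotient.mk (maximalIdeal 𝔬 ^ N) L = (a.mod N * b.mod N).coeff i := by
    intro i
    choose f hf using fun N : ℕ =>
      Ideal.Quotient.mk_surjective (I := maximalIdeal 𝔬 ^ N) ((a.mod N * b.mod N).coeff i)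
    have hc : ∀ {m n : ℕ}, m ≤ n →
        f m ≡ f n [SMOD (maximalIdeal 𝔬 ^ m • ⊤ : Submodule 𝔬 𝔬)] := by
      intro m n hmn
      rw [SModEq.sub_mem, smul_eq_mul, Ideal.mul_top, ← Ideal.Quotient.eq, hf,
        ← mod_map hmn a, ← mod_map hmn b,
        ← Ideal.Quotient.factor_mk (Ideal.pow_le_pow_right hmn) (f n), hf]
      have h1 := HahnSeries.map_mul ((Ideal.Quotient.factor
        (Ideal.pow_le_pow_right (I := maximalIdeal 𝔬) hmn)).toNonUnitalRingHom)
        (x := a.mod n) (y := b.mod n)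
      exact (congrArg (fun c => HahnSeries.coeff c i) h1).symm
    obtain ⟨L, hL⟩ := IsPrecomplete.prec (I := maximalIdeal 𝔬) inferInstance hc
    refine ⟨L, fun N => ?_⟩
    rw [← hf N]
    have := hL N
    rw [SModEq.sub_mem, smul_eq_mul, Ideal.mul_top, ← Ideal.Quotient.eq] at this
    exact this.symm
  choose L hL using key
  refine ⟨⟨L, fun N => ⟨(a.mod N * b.mod N).order, fun i hi => ?_⟩⟩, fun N => ?_⟩
  · rw [← Ideal.Quotient.eq_zero_iff_mem, hL]
    exact HahnSeries.coeff_eq_zero_of_lt_order hi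
  · ext i
    exact hL i N

/-- Bilateral series are multiplied as Laurent series modulo every power of `𝔪`; in other words,
the coefficient of `πⁱ` in `a * b` is the `𝔪`-adically convergent sum of the `a_j b_{i-j}`. -/
instance : Mul (Bilateral 𝔬) := ⟨fun a b => (exists_mul a b).choose⟩

theorem mod_mul (N : ℕ) (a b : Bilateral 𝔬) : (a * b).mod N = a.mod N * b.mod N :=
  (exists_mul a b).choose_spec N

instance : CommRing (Bilateral 𝔬) :=
  CommRing.ofMinimalAxioms
    (fun a b c => mod_injective fun N => by simp only [mod_add, add_assoc])
    (fun a => mod_injective fun N => by simp only [mod_add, mod_zero, zero_add])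
    (fun a => mod_injective fun N => by
      simp only [mod_add, mod_zero, mod_neg, neg_add_cancel])
    (fun a b c => mod_injective fun N => by simp only [mod_mul, mul_assoc])
    (fun a b => mod_injective fun N => by simp only [mod_mul, mul_comm])
    (fun a => mod_injective fun N => by simp only [mod_mul, mod_one, one_mul])
    (fun a b c => mod_injective fun N => by simp only [mod_mul, mod_add, mul_add])

/-- Constant series. -/
def C : 𝔬 →+* Bilateral 𝔬 where
  toFun := single 0
  map_one' := rfl
  map_zero' := by
    ext i
    simp [coeff_single]
  map_add' x y := by
    ext i
    simp only [coeff_single, coeff_add]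
    split_ifs <;> simp
  map_mul' x y := mod_injective fun N => by
    simp [mod_mul, mod_single]

instance : Algebra 𝔬 (Bilateral 𝔬) := C.toAlgebra

theorem algebraMap_eq : algebraMap 𝔬 (Bilateral 𝔬) = C := rfl

/-- Taking the coefficient of `πⁱ` is additive. -/
def coeffHom (i : ℤ) : Bilateral 𝔬 →+ 𝔬 where
  toFun a := a.coeff i
  map_zero' := rfl
  map_add' _ _ := rfl

end Ring

end Bilateral

/-! ### The Gauss norms -/

section Gauss

variable {𝔬 : Type*} [CommRing 𝔬] [IsDomain 𝔬] [IsDiscreteValuationRing 𝔬]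

/-- The absolute value on a discrete valuation ring for which uniformizers have absolute
value `η`. -/
def absVal (η : Set.Ioo (0 : ℝ) 1) (a : 𝔬) : ℝ :=
  open Classical in
  if a = 0 then 0 else (η : ℝ) ^ (IsDiscreteValuationRing.addVal 𝔬 a).toNat

variable (η : Set.Ioo (0 : ℝ) 1)

theorem absVal_zero : absVal η (0 : 𝔬) = 0 := if_pos rfl

theorem absVal_of_ne {a : 𝔬} (ha : a ≠ 0) :
    absVal η a = (η : ℝ) ^ (IsDiscreteValuationRing.addVal 𝔬 a).toNat := if_neg ha

theorem absVal_nonneg (a : 𝔬) : 0 ≤ absVal η a := by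
  by_cases ha : a = 0
  · rw [ha, absVal_zero]
  · rw [absVal_of_ne η ha]
    exact pow_nonneg η.2.1.le _

theorem absVal_le_one (a : 𝔬) : absVal η a ≤ 1 := by
  by_cases ha : a = 0
  · rw [ha, absVal_zero]
    exact zero_le_one
  · rw [absVal_of_ne η ha]
    exact pow_le_one₀ η.2.1.le η.2.2.le

theorem absVal_one : absVal η (1 : 𝔬) = 1 := by
  rw [absVal_of_ne η one_ne_zero, IsDiscreteValuationRing.addVal_one]
  simp

theorem absVal_mul (a b : 𝔬) : absVal η (a * b) = absVal η a * absVal η b := by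
  by_cases ha : a = 0
  · simp [ha, absVal_zero]
  by_cases hb : b = 0
  · simp [hb, absVal_zero]
  rw [absVal_of_ne η ha, absVal_of_ne η hb, absVal_of_ne η (mul_ne_zero ha hb),
    IsDiscreteValuationRing.addVal_mul, ENat.toNat_add, pow_add]
  · rwa [Ne, IsDiscreteValuationRing.addVal_eq_top_iff]
  · rwa [Ne, IsDiscreteValuationRing.addVal_eq_top_iff]

theorem absVal_le_of_addVal_le {a b : 𝔬}
    (h : IsDiscreteValuationRing.addVal 𝔬 a ≤ IsDiscreteValuationRing.addVal 𝔬 b) :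
    absVal η b ≤ absVal η a := by
  by_cases hb : b = 0
  · rw [hb, absVal_zero]
    exact absVal_nonneg η a
  have hb' : IsDiscreteValuationRing.addVal 𝔬 b ≠ ⊤ := by
    rwa [Ne, IsDiscreteValuationRing.addVal_eq_top_iff]
  have ha : a ≠ 0 := by
    rintro rfl
    rw [IsDiscreteValuationRing.addVal_zero, top_le_iff] at h
    exact hb' h
  rw [absVal_of_ne η hb, absVal_of_ne η ha]
  exact pow_le_pow_of_le_one η.2.1.le η.2.2.le (ENat.toNat_le_toNat h hb')

theorem absVal_add (a b : 𝔬) : absVal η (a + b) ≤ max (absVal η a) (absVal η b) := by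
  rcases min_le_iff.1 (IsDiscreteValuationRing.addVal_add (a := a) (b := b)) with h | h
  · exact le_max_of_le_left (absVal_le_of_addVal_le η h)
  · exact le_max_of_le_right (absVal_le_of_addVal_le η h)

theorem absVal_neg (a : 𝔬) : absVal η (-a) = absVal η a := by
  refine le_antisymm ?_ ?_ <;> refine absVal_le_of_addVal_le η ?_ <;>
    rw [IsDiscreteValuationRing.addVal_le_iff_dvd] <;> simp

theorem exists_le_absVal_of_sum {ι : Type*} (s : Finset ι) (f : ι → 𝔬) {ε : ℝ} (hε : 0 < ε)
    (h : ε ≤ absVal η (∑ i ∈ s, f i)) : ∃ i ∈ s, ε ≤ absVal η (f i) := by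
  classical
  induction s using Finset.induction_on with
  | empty =>
    rw [Finset.sum_empty, absVal_zero] at h
    exact absurd h (not_le.2 hε)
  | insert a s ha ih =>
    rw [Finset.sum_insert ha] at h
    rcases le_max_iff.1 (h.trans (absVal_add η _ _)) with h1 | h1
    · exact ⟨a, Finset.mem_insert_self _ _, h1⟩
    · obtain ⟨i, hi, h2⟩ := ih h1
      exact ⟨i, Finset.mem_insert_of_mem hi, h2⟩

theorem mem_maximalIdeal_pow_iff (a : 𝔬) (N : ℕ) :
    a ∈ maximalIdeal 𝔬 ^ N ↔ (N : ℕ∞) ≤ IsDiscreteValuationRing.addVal 𝔬 a := by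
  obtain ⟨ϖ, hϖ⟩ := IsDiscreteValuationRing.exists_irreducible 𝔬
  rw [hϖ.maximalIdeal_eq, Ideal.span_singleton_pow, Ideal.mem_span_singleton,
    ← IsDiscreteValuationRing.addVal_le_iff_dvd, hϖ.addVal_pow]

variable [IsAdicComplete (maximalIdeal 𝔬) 𝔬]

theorem Bilateral.exists_le_absVal_mul (a b : Bilateral 𝔬) (i : ℤ) {ε : ℝ} (hε : 0 < ε)
    (h : ε ≤ absVal η ((a * b).coeff i)) :
    ∃ i₁ i₂ : ℤ, i₁ + i₂ = i ∧ ε ≤ absVal η (a.coeff i₁) * absVal η (b.coeff i₂) := by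
  set c := (a * b).coeff i with hc
  have hc0 : c ≠ 0 := by
    intro h0
    rw [h0, absVal_zero] at h
    exact absurd h (not_le.2 hε)
  have htop : IsDiscreteValuationRing.addVal 𝔬 c ≠ ⊤ := by
    rwa [Ne, IsDiscreteValuationRing.addVal_eq_top_iff]
  set N : ℕ := (IsDiscreteValuationRing.addVal 𝔬 c).toNat + 1 with hN
  have hNc : ((N : ℕ) : ℕ∞) = IsDiscreteValuationRing.addVal 𝔬 c + 1 := by
    rw [hN, Nat.cast_add, ENat.natCast_toNat htop, Nat.cast_one]
  have h1 : (a.mod N * b.mod N).coeff i ≠ 0 := by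
    rw [← mod_mul, coeff_mod, ← hc, Ne, Ideal.Quotient.eq_zero_iff_mem,
      mem_maximalIdeal_pow_iff, hNc, not_le]
    exact (ENat.lt_add_one_iff htop).2 le_rfl
  rw [HahnSeries.coeff_mul] at h1
  obtain ⟨⟨i₁, i₂⟩, hi, h2⟩ := Finset.exists_ne_zero_of_sum_ne_zero h1
  refine ⟨i₁, i₂, (Finset.mem_antidiagonal.1 hi).2.2, h.trans ?_⟩
  rw [← absVal_mul]
  apply absVal_le_of_addVal_le
  rw [coeff_mod, coeff_mod, ← map_mul, Ne, Ideal.Quotient.eq_zero_iff_mem,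
    mem_maximalIdeal_pow_iff, hNc, not_le] at h2
  exact (ENat.lt_add_one_iff htop).1 h2

/-- Formal series `∑ a_{ijk} πⁱ T^j U^k` in `m` variables `T` and `n` variables `U`. -/
abbrev Formal (𝔬 : Type*) [CommRing 𝔬] [IsLocalRing 𝔬] [IsAdicComplete (maximalIdeal 𝔬) 𝔬]
    (m n : ℕ) : Type _ :=
  MvPowerSeries (Fin n) (MvPowerSeries (Fin m) (Bilateral 𝔬))

variable {m n : ℕ}

/-- The coefficient `a_{ijk}` of `πⁱ T^j U^k`. -/
def Formal.coeff (x : Formal 𝔬 m n) (i : ℤ) (j : Fin m →₀ ℕ) (k : Fin n →₀ ℕ) : 𝔬 :=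
  (MvPowerSeries.coeff j (MvPowerSeries.coeff k x)).coeff i

/-- The absolute value `|a_{ijk}| ω^{ri}` of the term of index `(i, j, k)` for the `r`-Gauss
norm. -/
def gaussTerm (ω η : Set.Ioo (0 : ℝ) 1) (r : ℝ) (x : Formal 𝔬 m n)
    (i : ℤ) (j : Fin m →₀ ℕ) (k : Fin n →₀ ℕ) : ℝ :=
  absVal η (x.coeff i j k) * (ω : ℝ) ^ (r * i)

/-- The series lying in the completion of `𝔬[π, T₁, …, Tₘ]⟦U₁, …, Uₙ⟧[π⁻¹]` for the `r`-Gauss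
norm: for every `ε > 0`, the terms of norm at least `ε` have `π`-exponents bounded below, and for
every monomial in `U` there are only finitely many of them (that is, they add up to an element of
`𝔬[π, T₁, …, Tₘ]⟦U₁, …, Uₙ⟧[π⁻¹]`). -/
def IsConvergent (ω η : Set.Ioo (0 : ℝ) 1) (r : ℝ) (x : Formal 𝔬 m n) : Prop :=
  ∀ ε : ℝ, 0 < ε →
    (∃ M : ℤ, ∀ i j k, ε ≤ gaussTerm ω η r x i j k → M ≤ i) ∧
    ∀ k, {p : ℤ × (Fin m →₀ ℕ) | ε ≤ gaussTerm ω η r x p.1 p.2 k}.Finite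

variable (ω : Set.Ioo (0 : ℝ) 1)

theorem gaussTerm_nonneg (r : ℝ) (x : Formal 𝔬 m n) (i : ℤ) (j : Fin m →₀ ℕ) (k : Fin n →₀ ℕ) :
    0 ≤ gaussTerm ω η r x i j k :=
  mul_nonneg (absVal_nonneg η _) (Real.rpow_nonneg ω.2.1.le _)

theorem Formal.coeff_add (x y : Formal 𝔬 m n) (i : ℤ) (j : Fin m →₀ ℕ) (k : Fin n →₀ ℕ) :
    (x + y).coeff i j k = x.coeff i j k + y.coeff i j k := rfl

theorem Formal.coeff_algebraMap (c : 𝔬) (i : ℤ) (j : Fin m →₀ ℕ) (k : Fin n →₀ ℕ) :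
    (algebraMap 𝔬 (Formal 𝔬 m n) c).coeff i j k =
      if i = 0 ∧ j = 0 ∧ k = 0 then c else 0 := by
  classical
  have : algebraMap 𝔬 (Formal 𝔬 m n) c =
      MvPowerSeries.C (MvPowerSeries.C (Bilateral.C c)) := by
    rw [MvPowerSeries.algebraMap_apply, MvPowerSeries.algebraMap_apply, Bilateral.algebraMap_eq]
  rw [this, Formal.coeff, MvPowerSeries.coeff_C]
  by_cases hk : k = 0
  · rw [if_pos hk, MvPowerSeries.coeff_C]
    by_cases hj : j = 0
    · rw [if_pos hj]
      change (if i = 0 then c else 0) = _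
      simp [hk, hj]
    · simp [hj]
  · simp [hk]

theorem Formal.exists_le_mul (x y : Formal 𝔬 m n) (i : ℤ) (j : Fin m →₀ ℕ) (k : Fin n →₀ ℕ)
    {ε : ℝ} (hε : 0 < ε) (h : ε ≤ absVal η ((x * y).coeff i j k)) :
    ∃ i₁ i₂ : ℤ, i₁ + i₂ = i ∧ ∃ p ∈ Finset.HasAntidiagonal.antidiagonal j, ∃ q ∈ Finset.HasAntidiagonal.antidiagonal k,
      ε ≤ absVal η (x.coeff i₁ p.1 q.1) * absVal η (y.coeff i₂ p.2 q.2) := by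
  classical
  have h1 : (x * y).coeff i j k = ∑ q ∈ Finset.HasAntidiagonal.antidiagonal k, ∑ p ∈ Finset.HasAntidiagonal.antidiagonal j,
      (MvPowerSeries.coeff p.1 (MvPowerSeries.coeff q.1 x) *
        MvPowerSeries.coeff p.2 (MvPowerSeries.coeff q.2 y)).coeff i := by
    change Bilateral.coeffHom i _ = _
    rw [MvPowerSeries.coeff_mul, map_sum, map_sum]
    refine Finset.sum_congr rfl fun q _ => ?_
    rw [MvPowerSeries.coeff_mul, map_sum]
    rfl
  rw [h1] at h
  obtain ⟨q, hq, h2⟩ := exists_le_absVal_of_sum η _ _ hε h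
  obtain ⟨p, hp, h3⟩ := exists_le_absVal_of_sum η _ _ hε h2
  obtain ⟨i₁, i₂, hi, h4⟩ := Bilateral.exists_le_absVal_mul η _ _ i hε h3
  exact ⟨i₁, i₂, hi, p, hp, q, hq, h4⟩

theorem exists_le_gaussTerm_mul (r : ℝ) (x y : Formal 𝔬 m n) (i : ℤ) (j : Fin m →₀ ℕ)
    (k : Fin n →₀ ℕ) {ε : ℝ} (hε : 0 < ε) (h : ε ≤ gaussTerm ω η r (x * y) i j k) :
    ∃ i₁ i₂ : ℤ, i₁ + i₂ = i ∧ ∃ p ∈ Finset.HasAntidiagonal.antidiagonal j, ∃ q ∈ Finset.HasAntidiagonal.antidiagonal k,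
      ε ≤ gaussTerm ω η r x i₁ p.1 q.1 * gaussTerm ω η r y i₂ p.2 q.2 := by
  have hω : 0 < (ω : ℝ) ^ (r * i) := Real.rpow_pos_of_pos ω.2.1 _
  obtain ⟨i₁, i₂, hi, p, hp, q, hq, h1⟩ :=
    Formal.exists_le_mul η x y i j k (div_pos hε hω) ((div_le_iff₀ hω).2 h)
  refine ⟨i₁, i₂, hi, p, hp, q, hq, ?_⟩
  rw [div_le_iff₀ hω, ← hi, Int.cast_add, mul_add, Real.rpow_add ω.2.1] at h1
  unfold gaussTerm
  linarith

variable {ω η}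

theorem IsConvergent.bounded {r : ℝ} (hr : 0 < r) {x : Formal 𝔬 m n}
    (hx : IsConvergent ω η r x) : ∃ B : ℝ, 0 < B ∧ ∀ i j k, gaussTerm ω η r x i j k ≤ B := by
  obtain ⟨⟨M, hM⟩, -⟩ := hx 1 one_pos
  have hpos : 0 < (ω : ℝ) ^ (r * M) := Real.rpow_pos_of_pos ω.2.1 _
  refine ⟨1 + (ω : ℝ) ^ (r * M), by linarith, fun i j k => ?_⟩
  by_cases h : 1 ≤ gaussTerm ω η r x i j k
  · have h1 : (ω : ℝ) ^ (r * i) ≤ (ω : ℝ) ^ (r * M) :=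
      Real.rpow_le_rpow_of_exponent_ge ω.2.1 ω.2.2.le
        (mul_le_mul_of_nonneg_left (Int.cast_le.2 (hM i j k h)) hr.le)
    have h2 : gaussTerm ω η r x i j k ≤ 1 * (ω : ℝ) ^ (r * i) :=
      mul_le_mul_of_nonneg_right (absVal_le_one η _) (Real.rpow_nonneg ω.2.1.le _)
    linarith
  · linarith [not_le.1 h]

theorem IsConvergent.add {r : ℝ} {x y : Formal 𝔬 m n}
    (hx : IsConvergent ω η r x) (hy : IsConvergent ω η r y) : IsConvergent ω η r (x + y) := by
  have key : ∀ ε i j k, ε ≤ gaussTerm ω η r (x + y) i j k →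
      ε ≤ gaussTerm ω η r x i j k ∨ ε ≤ gaussTerm ω η r y i j k := by
    intro ε i j k h
    have h1 : gaussTerm ω η r (x + y) i j k ≤
        max (gaussTerm ω η r x i j k) (gaussTerm ω η r y i j k) := by
      unfold gaussTerm
      rw [← max_mul_of_nonneg _ _ (Real.rpow_nonneg ω.2.1.le _), Formal.coeff_add]
      exact mul_le_mul_of_nonneg_right (absVal_add η _ _) (Real.rpow_nonneg ω.2.1.le _)
    exact le_max_iff.1 (h.trans h1)
  intro ε hε
  obtain ⟨⟨M, hM⟩, hf⟩ := hx ε hε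
  obtain ⟨⟨M', hM'⟩, hf'⟩ := hy ε hε
  refine ⟨⟨min M M', fun i j k h => ?_⟩, fun k => ?_⟩
  · rcases key ε i j k h with h | h
    · exact (min_le_left _ _).trans (hM i j k h)
    · exact (min_le_right _ _).trans (hM' i j k h)
  · exact ((hf k).union (hf' k)).subset fun p hp => key ε p.1 p.2 k hp

theorem IsConvergent.mul {r : ℝ} (hr : 0 < r) {x y : Formal 𝔬 m n}
    (hx : IsConvergent ω η r x) (hy : IsConvergent ω η r y) : IsConvergent ω η r (x * y) := by
  obtain ⟨B, hB, hxB⟩ := hx.bounded hr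
  obtain ⟨B', hB', hyB⟩ := hy.bounded hr
  intro ε hε
  have key : ∀ i j k, ε ≤ gaussTerm ω η r (x * y) i j k →
      ∃ i₁ i₂ : ℤ, i₁ + i₂ = i ∧ ∃ p ∈ Finset.HasAntidiagonal.antidiagonal j, ∃ q ∈ Finset.HasAntidiagonal.antidiagonal k,
        ε / B' ≤ gaussTerm ω η r x i₁ p.1 q.1 ∧ ε / B ≤ gaussTerm ω η r y i₂ p.2 q.2 := by
    intro i j k h
    obtain ⟨i₁, i₂, hi, p, hp, q, hq, h1⟩ := exists_le_gaussTerm_mul η ω r x y i j k hε h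
    refine ⟨i₁, i₂, hi, p, hp, q, hq, ?_, ?_⟩
    · rw [div_le_iff₀ hB']
      exact h1.trans (mul_le_mul_of_nonneg_left (hyB _ _ _) (gaussTerm_nonneg _ _ _ _ _ _ _))
    · rw [div_le_iff₀ hB, mul_comm]
      exact h1.trans (mul_le_mul_of_nonneg_right (hxB _ _ _) (gaussTerm_nonneg _ _ _ _ _ _ _))
  obtain ⟨⟨M, hM⟩, hf⟩ := hx (ε / B') (div_pos hε hB')
  obtain ⟨⟨M', hM'⟩, hf'⟩ := hy (ε / B) (div_pos hε hB)
  refine ⟨⟨M + M', fun i j k h => ?_⟩, fun k => ?_⟩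
  · obtain ⟨i₁, i₂, hi, p, -, q, -, h1, h2⟩ := key i j k h
    rw [← hi]
    exact add_le_add (hM _ _ _ h1) (hM' _ _ _ h2)
  · refine ((Finset.HasAntidiagonal.antidiagonal k).finite_toSet.biUnion fun q _ =>
      ((hf q.1).prod (hf' q.2)).image fun s => s.1 + s.2).subset fun s hs => ?_
    obtain ⟨i₁, i₂, hi, p, hp, q, hq, h1, h2⟩ := key s.1 s.2 k hs
    refine Set.mem_biUnion (Finset.mem_coe.2 hq) ⟨((i₁, p.1), (i₂, p.2)), ⟨h1, h2⟩, ?_⟩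
    exact Prod.ext hi (Finset.HasAntidiagonal.mem_antidiagonal.1 hp)

theorem IsConvergent.mono {r s : ℝ} (hs : 0 < s) (hsr : s ≤ r) {x : Formal 𝔬 m n}
    (hx : IsConvergent ω η r x) : IsConvergent ω η s x := by
  have h1 : 1 ≤ r / s := (one_le_div hs).2 hsr
  have key : ∀ ε : ℝ, 0 < ε → ∀ i j k, ε ≤ gaussTerm ω η s x i j k →
      ε ^ (r / s) ≤ gaussTerm ω η r x i j k := by
    intro ε hε i j k h
    have ha := absVal_nonneg η (x.coeff i j k)
    refine (Real.rpow_le_rpow hε.le h (by linarith)).trans ?_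
    unfold gaussTerm
    rw [Real.mul_rpow ha (Real.rpow_nonneg ω.2.1.le _), ← Real.rpow_mul ω.2.1.le]
    have h2 : s * i * (r / s) = r * i := by
      field_simp
    rw [h2]
    refine mul_le_mul_of_nonneg_right ?_ (Real.rpow_nonneg ω.2.1.le _)
    rcases ha.eq_or_lt with h0 | h0
    · rw [← h0, Real.zero_rpow (by linarith)]
    · exact (Real.rpow_le_rpow_of_exponent_ge h0 (absVal_le_one η _) h1).trans_eq
        (Real.rpow_one _)
  intro ε hε
  obtain ⟨⟨M, hM⟩, hf⟩ := hx (ε ^ (r / s)) (Real.rpow_pos_of_pos hε _)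
  exact ⟨⟨M, fun i j k h => hM i j k (key ε hε i j k h)⟩,
    fun k => (hf k).subset fun p hp => key ε hε p.1 p.2 k hp⟩

theorem isConvergent_algebraMap (r : ℝ) (c : 𝔬) :
    IsConvergent ω η r (algebraMap 𝔬 (Formal 𝔬 m n) c) := by
  have key : ∀ ε : ℝ, 0 < ε → ∀ i j k,
      ε ≤ gaussTerm ω η r (algebraMap 𝔬 (Formal 𝔬 m n) c) i j k → i = 0 ∧ j = 0 := by
    intro ε hε i j k h
    by_contra hn
    have h0 : ¬ (i = 0 ∧ j = 0 ∧ k = 0) := fun h => hn ⟨h.1, h.2.1⟩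
    rw [gaussTerm, Formal.coeff_algebraMap, if_neg h0, absVal_zero, zero_mul] at h
    exact absurd h (not_le.2 hε)
  intro ε hε
  refine ⟨⟨0, fun i j k h => (key ε hε i j k h).1.ge⟩, fun k => ?_⟩
  exact (Set.finite_singleton ((0 : ℤ), (0 : Fin m →₀ ℕ))).subset fun p hp =>
    Prod.ext (key ε hε p.1 p.2 k hp).1 (key ε hε p.1 p.2 k hp).2

end Gauss

/-! ### The dagger algebras, mixed affinoid algebras and dagger lifts -/

section Main

variable (𝔬 : Type*) [CommRing 𝔬] [IsDomain 𝔬] [IsDiscreteValuationRing 𝔬]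
  [IsAdicComplete (maximalIdeal 𝔬) 𝔬]

/-- The `𝔬`-algebra `𝐀⟨T₁, …, Tₘ⟩⟨⟨U₁, …, Uₙ⟩⟩^†`, the union over all `r > 0` of the completions
`𝐀⟨T₁, …, Tₘ⟩⟨⟨U₁, …, Uₙ⟩⟩^{†,r}` of `𝔬[π, T₁, …, Tₘ]⟦U₁, …, Uₙ⟧[π⁻¹]` for the `r`-Gauss norms.
Here `ω` is the constant of the Gauss norms, and `η` is the absolute value of a uniformizer
of `𝔬`. -/
def dagger (ω η : Set.Ioo (0 : ℝ) 1) (m n : ℕ) : Subalgebra 𝔬 (Formal 𝔬 m n) where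
  carrier := {x | ∃ r : ℝ, 0 < r ∧ IsConvergent ω η r x}
  mul_mem' := by
    rintro x y ⟨r, hr, hx⟩ ⟨s, hs, hy⟩
    have h := lt_min hr hs
    exact ⟨min r s, h, (hx.mono h (min_le_left _ _)).mul h (hy.mono h (min_le_right _ _))⟩
  add_mem' := by
    rintro x y ⟨r, hr, hx⟩ ⟨s, hs, hy⟩
    have h := lt_min hr hs
    exact ⟨min r s, h, (hx.mono h (min_le_left _ _)).add (hy.mono h (min_le_right _ _))⟩
  algebraMap_mem' c := ⟨1, one_pos, isConvergent_algebraMap 1 c⟩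

/-- The ring `k⟦π⟧⟨T₁, …, Tₘ⟩⟦U₁, …, Uₙ⟧[π⁻¹]`. As `k⟦π⟧⟨T₁, …, Tₘ⟩` is the `π`-adic completion of
`k[T₁, …, Tₘ]⟦π⟧`, that is, `k[T₁, …, Tₘ]⟦π⟧` itself, this ring consists of the Laurent series in
`π` with coefficients in `k[T₁, …, Tₘ]⟦U₁, …, Uₙ⟧`. -/
abbrev MixedTate (k : Type*) [CommRing k] (m n : ℕ) : Type _ :=
  LaurentSeries (MvPowerSeries (Fin n) (MvPolynomial (Fin m) k))

/-- A `k((π))`-algebra is mixed affinoid if it is a quotient, as a `k((π))`-algebra, of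
`k⟦π⟧⟨T₁, …, Tₘ⟩⟦U₁, …, Uₙ⟧[π⁻¹]` for some `m` and `n`. (All ideals of the latter ring are closed
for the `π`-adic norm, so the quotient norm makes such an algebra a Banach algebra
over `k((π))`.) -/
def IsMixedAffinoid (k : Type*) [Field k] (A : Type*) [CommRing A] [Algebra (LaurentSeries k) A] :
    Prop :=
  ∃ (m n : ℕ) (f : MixedTate k m n →+* A), Function.Surjective f ∧
    ∀ x : LaurentSeries k,
      f (x.map ((MvPowerSeries.C (σ := Fin n)).comp (MvPolynomial.C (σ := Fin m) (R := k)))) =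
        algebraMap (LaurentSeries k) A x

variable {𝔬}

/-- `S` is a dagger lift of `A`, where `ρ : S → A` is the reduction map: `S` is flat over `𝔬`, the
map `ρ` induces an isomorphism of `k`-algebras `S / 𝔪 S ≅ A`, and there is a surjection of
`𝔬`-algebras `𝐀⟨T₁, …, Tₘ⟩⟨⟨U₁, …, Uₙ⟩⟩^† → S` for some `m` and `n`. -/
structure IsDaggerLift (ω η : Set.Ioo (0 : ℝ) 1) {A S : Type*}
    [CommRing A] [Algebra (LaurentSeries (ResidueField 𝔬)) A]
    [CommRing S] [Algebra 𝔬 S] (ρ : S →+* A) : Prop where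
  flat : Module.Flat 𝔬 S
  surjective : Function.Surjective ρ
  ker_eq : RingHom.ker ρ = (maximalIdeal 𝔬).map (algebraMap 𝔬 S)
  map_algebraMap : ∀ a : 𝔬, ρ (algebraMap 𝔬 S a) =
    algebraMap (LaurentSeries (ResidueField 𝔬)) A (HahnSeries.C (residue 𝔬 a))
  presentation : ∃ (m n : ℕ) (f : dagger 𝔬 ω η m n →ₐ[𝔬] S), Function.Surjective f

end Main

end

end DaggerLift

/-! Let `D` be the dagger algebra mapping onto `S`, `ϖ` a uniformizer, `F c` the subring of series
bounded by one where `|ϖ| ≤ |π|ᶜ`, and `q` the power of `p`. The analysis is condensed in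
`IsOverconvergent`: `F c` is complete for the powers of `ϖπ⁻ᶜ`, every element of `D` enters `F c`
after multiplication by `πᶜ` for large `c`, and ideals of `F 0` containing `ϖ` are finitely
generated. The last point comes from `F 0 / ϖ ≅ k[T]⟦π⟧⟦U⟧`, which is noetherian, and also finite
over its `q`-th powers because `k` is perfect. It follows that `D` is noetherian, that `ϖ` lies in
its Jacobson radical, and that `S` is `ϖ`-adically separated, because the kernel of `D → S` is
`ϖ`-saturated and hence closed.

Finiteness. Modulo `ϖ` the map is Frobenius, which is finite; the difficulty is to lift generators
without losing convergence. Write `β = ∑ dⱼᵖ εⱼ + ϖ d'` in `F 0`. Since `p`-th powers improve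
congruences, the values of `g` are determined recursively by the finitely many `g(εⱼ)` and by
`g(ϖ)`. Solving the recursion inside `F c` gives `g(β) ∈ β^q + ϖπ⁻ᶜ F c` with one `c` for all `β ∈ F
0` (`exists_map_eq_add_slope`). Hence an element of `F c` is a `g`-combination of finitely many
elements up to `ϖπ⁻ᶜ F c`. After `N` rounds, `g(ϖ) ∣ ϖᴺ` turns the error into `g` of some `ϖπ⁻ᵉ`
times `F c`, and the resulting series of coefficients converges in the source
(`finite_of_dvd_sub_pow`).

The divisibility `g(ϖ) ∣ ϖᴺ` is automatic in characteristic zero, since `p` is a unit times a power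
of `ϖ` and `g` fixes `p`; otherwise it is the extra hypothesis.

Flatness. A maximal ideal `P` of `S` contains `ϖ`, and `g` is a power map modulo `ϖ`, so `P` is its
own contraction and the only prime above it; thus `S_P → S_P` is finite. Regularity of `A` makes `ϖ`
and lifts `xᵢ` of regular parameters generate the maximal ideal. Their images are a unit times a
power of `ϖ`, and `xᵢ^q` modulo `ϖ`, which still form a weakly regular sequence. A finite module on
which generators of the maximal ideal are weakly regular is free (`free_of_isWeaklyRegular`). -/

namespace DaggerLift

open IsLocalRing

noncomputable section

/-! ### Weakly regular sequences and freeness -/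

section RegularSequences

open RingTheory.Sequence Pointwise

variable {R : Type*} [CommRing R]

theorem quotSMulTop_mk_eq_zero_iff {M : Type*} [AddCommGroup M] [Module R M] (r : R) (x : M) :
    (Submodule.Quotient.mk x : QuotSMulTop r M) = 0 ↔ ∃ y : M, r • y = x := by
  rw [Submodule.Quotient.mk_eq_zero, Submodule.mem_smul_pointwise_iff_exists]
  simp

/-- Weak regularity of a sequence is stable under extensions of modules. -/
theorem isWeaklyRegular_of_exact (rs : List R) {M M' M'' : Type*} [AddCommGroup M]
    [AddCommGroup M'] [AddCommGroup M''] [Module R M] [Module R M'] [Module R M'']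
    {f : M' →ₗ[R] M} {g : M →ₗ[R] M''} (hf : Function.Injective f) (hfg : Function.Exact f g)
    (hg : Function.Surjective g) (h' : IsWeaklyRegular M' rs) (h'' : IsWeaklyRegular M'' rs) :
    IsWeaklyRegular M rs := by
  induction rs generalizing M M' M'' with
  | nil => simp
  | cons r rs ih =>
    rw [isWeaklyRegular_cons_iff] at h' h'' ⊢
    refine ⟨isSMulRegular_of_range_eq_ker hf (LinearMap.exact_iff.1 hfg).symm h'.1 h''.1,
      ih (f := QuotSMulTop.map r f) (g := QuotSMulTop.map r g) ?_ (QuotSMulTop.map_exact r hfg hg)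
        (QuotSMulTop.map_surjective r hg) h'.2 h''.2⟩
    -- Snake lemma: regularity of `r` on `M''` keeps `M'/r → M/r` injective.
    rw [injective_iff_map_eq_zero]
    intro x hx
    obtain ⟨x, rfl⟩ := Submodule.Quotient.mk_surjective _ x
    rw [QuotSMulTop.map_apply_mk, quotSMulTop_mk_eq_zero_iff] at hx
    obtain ⟨y, hy⟩ := hx
    have h1 : r • g y = 0 := by rw [← map_smul, hy, hfg.apply_apply_eq_zero]
    have h2 : g y = 0 := h''.1 (by simpa using h1)
    obtain ⟨z, rfl⟩ := (hfg y).1 h2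
    rw [quotSMulTop_mk_eq_zero_iff]
    exact ⟨z, hf (by rw [map_smul, hy])⟩

theorem isWeaklyRegular_of_subsingleton (rs : List R) (M : Type*) [AddCommGroup M] [Module R M]
    [Subsingleton M] : IsWeaklyRegular M rs := by
  refine ⟨fun i hi x y _ => ?_⟩
  obtain ⟨x, rfl⟩ := Submodule.Quotient.mk_surjective _ x
  obtain ⟨y, rfl⟩ := Submodule.Quotient.mk_surjective _ y
  rw [Subsingleton.elim x y]

/-- Multiplication by `r` gives an exact sequence `0 → M/rᵃ → M/rᵃ⁺¹ → M/r → 0`, so one inducts on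
`a`. Weak regularity, which does not ask for nonzero quotients, allows `a = 0`. -/
theorem isWeaklyRegular_quotSMulTop_pow {M : Type*} [AddCommGroup M] [Module R M] {r : R}
    (hr : IsSMulRegular M r) {rs : List R} (h : IsWeaklyRegular (QuotSMulTop r M) rs) (a : ℕ) :
    IsWeaklyRegular (QuotSMulTop (r ^ a) M) rs := by
  induction a with
  | zero =>
    have : Subsingleton (QuotSMulTop (r ^ 0) M) := by
      refine subsingleton_of_forall_eq 0 fun x => ?_
      obtain ⟨x, rfl⟩ := Submodule.Quotient.mk_surjective _ x
      exact (quotSMulTop_mk_eq_zero_iff _ x).2 ⟨x, by simp⟩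
    exact isWeaklyRegular_of_subsingleton _ _
  | succ a ih =>
    have h1 : (r ^ a • ⊤ : Submodule R M) ≤
        (r ^ (a + 1) • ⊤ : Submodule R M).comap (LinearMap.lsmul R M r) := by
      intro x hx
      obtain ⟨y, -, rfl⟩ := Submodule.mem_smul_pointwise_iff_exists _ _ _ |>.1 hx
      exact Submodule.mem_smul_pointwise_iff_exists _ _ _ |>.2
        ⟨y, trivial, by simp [pow_succ, mul_smul]⟩
    have h2 : (r ^ (a + 1) • ⊤ : Submodule R M) ≤
        (r • ⊤ : Submodule R M).comap LinearMap.id := by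
      intro x hx
      obtain ⟨y, -, rfl⟩ := Submodule.mem_smul_pointwise_iff_exists _ _ _ |>.1 hx
      exact Submodule.mem_smul_pointwise_iff_exists _ _ _ |>.2
        ⟨r ^ a • y, trivial, by simp [pow_succ', mul_smul]⟩
    refine isWeaklyRegular_of_exact rs (f := Submodule.mapQ _ _ _ h1)
      (g := Submodule.mapQ _ _ _ h2) ?_ ?_ ?_ ih h
    · rw [injective_iff_map_eq_zero]
      intro x hx
      obtain ⟨x, rfl⟩ := Submodule.Quotient.mk_surjective _ x
      rw [Submodule.mapQ_apply] at hx
      obtain ⟨y, hy⟩ := (quotSMulTop_mk_eq_zero_iff _ _).1 hx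
      refine (quotSMulTop_mk_eq_zero_iff _ _).2 ⟨y, hr ?_⟩
      simpa [pow_succ', mul_smul] using hy
    · intro x
      obtain ⟨x, rfl⟩ := Submodule.Quotient.mk_surjective _ x
      rw [Submodule.mapQ_apply]
      refine (quotSMulTop_mk_eq_zero_iff r _).trans ⟨?_, ?_⟩
      · rintro ⟨y, hy⟩
        exact ⟨Submodule.Quotient.mk y, congrArg Submodule.Quotient.mk hy⟩
      · rintro ⟨y, hy⟩
        obtain ⟨y, rfl⟩ := Submodule.Quotient.mk_surjective _ y
        rw [Submodule.mapQ_apply, ← sub_eq_zero, ← Submodule.Quotient.mk_sub] at hy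
        obtain ⟨z, hz⟩ := (quotSMulTop_mk_eq_zero_iff _ _).1 hy
        refine ⟨y - r ^ a • z, ?_⟩
        rw [smul_sub, smul_smul, ← pow_succ', hz]
        simp
    · intro x
      obtain ⟨x, rfl⟩ := Submodule.Quotient.mk_surjective _ x
      exact ⟨Submodule.Quotient.mk x, rfl⟩

/-- Powers of the terms of a weakly regular sequence form a weakly regular sequence. -/
theorem isWeaklyRegular_map_pow (q : ℕ) (rs : List R) {M : Type*} [AddCommGroup M] [Module R M]
    (h : IsWeaklyRegular M rs) : IsWeaklyRegular M (rs.map (· ^ q)) := by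
  induction rs generalizing M with
  | nil => simp
  | cons r rs ih =>
    rw [isWeaklyRegular_cons_iff] at h
    rw [List.map_cons, isWeaklyRegular_cons_iff]
    exact ⟨h.1.pow q, isWeaklyRegular_quotSMulTop_pow h.1 (ih h.2) q⟩

/-- A finite module over a noetherian local ring for which generators of the maximal ideal form
a weakly regular sequence is free. -/
theorem free_of_isWeaklyRegular (rs : List R) [IsLocalRing R] [IsNoetherianRing R]
    (hrs : Ideal.ofList rs = maximalIdeal R) (M : Type*) [AddCommGroup M] [Module R M]
    [Module.Finite R M] (h : IsWeaklyRegular M rs) : Module.Free R M := by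
  generalize hn : rs.length = n
  induction n generalizing R M with
  | zero =>
    rw [List.length_eq_zero_iff] at hn
    subst hn
    rw [Ideal.ofList_nil] at hrs
    have hF : IsField R := isField_iff_maximalIdeal_eq.2 hrs.symm
    let _ := hF.toField
    exact Module.Free.of_divisionRing R M
  | succ n ih =>
    obtain ⟨r, rs, rfl⟩ : ∃ r rs', rs = r :: rs' := by
      cases rs with
      | nil => simp at hn
      | cons r rs => exact ⟨r, rs, rfl⟩
    have hr : r ∈ maximalIdeal R := by
      rw [← hrs]
      exact Ideal.subset_span (by simp)
    rw [isWeaklyRegular_cons_iff'] at h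
    have hnt : Nontrivial (R ⧸ Ideal.span {r}) := Ideal.Quotient.nontrivial_iff.2 fun h1 => by
      rw [Ideal.span_singleton_eq_top] at h1
      exact (mem_maximalIdeal r).1 hr h1
    have : IsLocalRing (R ⧸ Ideal.span {r}) :=
      IsLocalRing.of_surjective' _ Ideal.Quotient.mk_surjective
    have hm : Ideal.ofList (rs.map (Ideal.Quotient.mk (Ideal.span {r}))) =
        maximalIdeal (R ⧸ Ideal.span {r}) := by
      rw [← Ideal.map_ofList, ← IsLocalRing.map_maximalIdeal_of_surjective
        (Ideal.Quotient.mk (Ideal.span {r})) Ideal.Quotient.mk_surjective, ← hrs, Ideal.ofList_cons,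
        Ideal.map_sup, Ideal.map_quotient_self, bot_sup_eq]
    have : Module.Finite (R ⧸ Ideal.span {r}) (QuotSMulTop r M) :=
      Module.Finite.of_restrictScalars_finite R _ _
    have h3 := ih (rs.map (Ideal.Quotient.mk (Ideal.span {r}))) hm (QuotSMulTop r M) h.2
      (by simpa using hn)
    have : Module.FinitePresentation R M := Module.finitePresentation_of_finite R M
    -- Freeness lifts from the quotient by an element of the Jacobson radical that is regular on the
    -- module.
    exact (Module.free_quotSMulTop_iff_free R M
      (by rw [IsLocalRing.jacobson_eq_maximalIdeal _ bot_ne_top]; exact hr) h.1).1 h3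

end RegularSequences

/-! ### Regular local rings are domains with regular parameters -/

section RegularLocal

open RingTheory.Sequence Pointwise

/-- The bottom of a chain of `n + 1` primes does the job. -/
theorem exists_isPrime_le_ringKrullDim_quotient {R : Type*} [CommRing R] {n : ℕ}
    (h : (n : WithBot ℕ∞) ≤ ringKrullDim R) :
    ∃ 𝔮 : Ideal R, 𝔮.IsPrime ∧ (n : WithBot ℕ∞) ≤ ringKrullDim (R ⧸ 𝔮) := by
  obtain ⟨l, rfl⟩ := Order.le_krullDim_iff.1 h
  refine ⟨l.head.asIdeal, l.head.2, ?_⟩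
  rw [ringKrullDim_quotient]
  refine Order.le_krullDim_iff.2 ⟨LTSeries.mk l.length
    (fun i => ⟨l i, (PrimeSpectrum.mem_zeroLocus _ _).2 (l.head_le i)⟩) fun i j hij => ?_, rfl⟩
  exact l.strictMono hij

theorem isLocalRing_quotient {R : Type*} [CommRing R] [IsLocalRing R] {I : Ideal R}
    (hI : I ≤ maximalIdeal R) : IsLocalRing (R ⧸ I) := by
  have : Nontrivial (R ⧸ I) := Ideal.Quotient.nontrivial_iff.2 fun h =>
    (maximalIdeal.isMaximal R).ne_top (top_le_iff.1 (h ▸ hI))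
  exact IsLocalRing.of_surjective' _ Ideal.Quotient.mk_surjective

variable {R : Type*} [CommRing R] [IsLocalRing R] [IsNoetherianRing R]

theorem ringKrullDim_le_length {rs : List R} (hrs : Ideal.ofList rs = maximalIdeal R) :
    ringKrullDim R ≤ rs.length := by
  classical
  refine (ringKrullDim_le_spanFinrank_maximalIdeal R).trans ?_
  rw [← hrs]
  have h1 := Submodule.spanFinrank_span_le_encard (R := R) {r | r ∈ rs}
  have h2 : ({r | r ∈ rs} : Set R) = (rs.toFinset : Set R) := by
    ext; simp
  rw [h2, Set.encard_coe_eq_coe_finsetCard] at h1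
  have h3 : (Ideal.span {r | r ∈ rs}).spanFinrank ≤ rs.length := by
    refine le_trans ?_ (List.toFinset_card_le rs)
    rw [h2]
    exact_mod_cast h1
  exact_mod_cast h3

theorem ringKrullDim_le_quotient_singleton_add_one {r : R} (hr : r ∈ maximalIdeal R) :
    ringKrullDim R ≤ ringKrullDim (R ⧸ Ideal.span {r}) + 1 := by
  have := ringKrullDim_le_ringKrullDim_quotient_add_card ({r} : Finset R)
    (by simpa [IsLocalRing.ringJacobson_eq_maximalIdeal] using hr)
  rw [Finset.coe_singleton] at this
  simpa using this

theorem natCast_le_of_add_one_le {n : ℕ} {d : WithBot ℕ∞}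
    (h : ((n + 1 : ℕ) : WithBot ℕ∞) ≤ d + 1) : (n : WithBot ℕ∞) ≤ d := by
  induction d with
  | bot => simp at h
  | coe d =>
    have h1 : ((n + 1 : ℕ) : ℕ∞) ≤ d + 1 := by exact_mod_cast h
    have h2 : ((n : ℕ) : ℕ∞) ≤ d := by
      rw [Nat.cast_add, Nat.cast_one] at h1
      exact (ENat.add_le_add_iff_right ENat.one_ne_top).1 h1
    exact_mod_cast h2

/-- If the maximal ideal of a noetherian local ring is generated by at most as many elements as the
dimension of the ring, then the ring is a domain and the generators form a regular sequence. -/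
theorem isDomain_and_isWeaklyRegular (rs : List R) (hrs : Ideal.ofList rs = maximalIdeal R)
    (hd : (rs.length : WithBot ℕ∞) ≤ ringKrullDim R) : IsDomain R ∧ IsWeaklyRegular R rs := by
  generalize hn : rs.length = n at hd
  induction n generalizing R with
  | zero =>
    rw [List.length_eq_zero_iff] at hn
    subst hn
    rw [Ideal.ofList_nil] at hrs
    have hF : IsField R := isField_iff_maximalIdeal_eq.2 hrs.symm
    exact ⟨hF.isDomain, by simp⟩
  | succ n ih =>
    obtain ⟨r, rs, rfl⟩ : ∃ r rs', rs = r :: rs' := by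
      cases rs with
      | nil => simp at hn
      | cons r rs => exact ⟨r, rs, rfl⟩
    have hn' : rs.length = n := by simpa using hn
    have hr : r ∈ maximalIdeal R := by
      rw [← hrs]
      exact Ideal.subset_span (by simp)
    have : IsLocalRing (R ⧸ Ideal.span {r}) := isLocalRing_quotient (by
      rwa [Ideal.span_singleton_le_iff_mem])
    have hm : Ideal.ofList (rs.map (Ideal.Quotient.mk (Ideal.span {r}))) =
        maximalIdeal (R ⧸ Ideal.span {r}) := by
      rw [← Ideal.map_ofList, ← IsLocalRing.map_maximalIdeal_of_surjective
        (Ideal.Quotient.mk (Ideal.span {r})) Ideal.Quotient.mk_surjective, ← hrs, Ideal.ofList_cons,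
        Ideal.map_sup, Ideal.map_quotient_self, bot_sup_eq]
    have hd' : ringKrullDim (R ⧸ Ideal.span {r}) ≤ n := by
      simpa [hn'] using ringKrullDim_le_length hm
    obtain ⟨hdom, hreg⟩ := ih _ hm (by simpa using hn')
      (natCast_le_of_add_one_le (hd.trans (ringKrullDim_le_quotient_singleton_add_one hr)))
    -- The aim is `𝔮 = 0`. If some `y ∈ 𝔮` were outside `(r)`, it would be nonzero in the domain
    -- `R/r`, so killing it would lower the dimension from at most `n`; then `R/𝔮` would have
    -- dimension at most `n`.
    obtain ⟨𝔮, h𝔮, h𝔮d⟩ := exists_isPrime_le_ringKrullDim_quotient hd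
    have : IsLocalRing (R ⧸ 𝔮) := isLocalRing_quotient (le_maximalIdeal h𝔮.ne_top)
    have hlt : ∀ d : WithBot ℕ∞, d ≤ n → ¬ ((n + 1 : ℕ) : WithBot ℕ∞) ≤ d := fun d h1 h2 => by
      have h3 : ((n + 1 : ℕ) : WithBot ℕ∞) ≤ (n : ℕ) := h2.trans h1
      have h4 : n + 1 ≤ n := by exact_mod_cast h3
      omega
    have hle : 𝔮 ≤ Ideal.span {r} := by
      intro y hy
      by_contra hyr
      have h1 : Ideal.Quotient.mk (Ideal.span {r}) y ≠ 0 := by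
        rwa [Ne, Ideal.Quotient.eq_zero_iff_mem]
      let φ : R ⧸ Ideal.span {r} →+*
          (R ⧸ 𝔮) ⧸ Ideal.span {Ideal.Quotient.mk 𝔮 r} :=
        Ideal.Quotient.lift _ ((Ideal.Quotient.mk _).comp (Ideal.Quotient.mk 𝔮)) (by
          intro a ha
          obtain ⟨b, rfl⟩ := Ideal.mem_span_singleton'.1 ha
          rw [RingHom.comp_apply, Ideal.Quotient.eq_zero_iff_mem, map_mul]
          exact Ideal.mul_mem_left _ _ (Ideal.mem_span_singleton_self _))
      have hφ : Function.Surjective φ := Ideal.Quotient.lift_surjective_of_surjective _ _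
        (Ideal.Quotient.mk_surjective.comp Ideal.Quotient.mk_surjective)
      have hφy : φ (Ideal.Quotient.mk (Ideal.span {r}) y) = 0 := by
        simp only [φ, Ideal.Quotient.lift_mk, RingHom.comp_apply]
        rw [Ideal.Quotient.eq_zero_iff_mem.2 hy, map_zero]
      have h2 := ringKrullDim_succ_le_of_surjective φ hφ (mem_nonZeroDivisors_of_ne_zero h1) hφy
      have h3 : Ideal.Quotient.mk 𝔮 r ∈ maximalIdeal (R ⧸ 𝔮) := by
        rw [← IsLocalRing.map_maximalIdeal_of_surjective
          (Ideal.Quotient.mk 𝔮) Ideal.Quotient.mk_surjective]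
        exact Ideal.mem_map_of_mem _ hr
      exact hlt _ hd' (h𝔮d.trans ((ringKrullDim_le_quotient_singleton_add_one h3).trans h2))
    have hr𝔮 : r ∉ 𝔮 := fun h => by
      have h1 : 𝔮 = Ideal.span {r} :=
        le_antisymm hle ((Ideal.span_singleton_le_iff_mem _).2 h)
      rw [h1] at h𝔮d
      exact hlt _ hd' h𝔮d
    -- From `𝔮 ⊆ (r)` and `r ∉ 𝔮` one gets `𝔮 = r𝔮`, and Nakayama applies.
    have hbot : 𝔮 = ⊥ := by
      refine Submodule.eq_bot_of_le_smul_of_le_jacobson_bot (maximalIdeal R) 𝔮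
        (IsNoetherian.noetherian 𝔮) (fun y hy => ?_)
        (by rw [IsLocalRing.jacobson_eq_maximalIdeal _ bot_ne_top])
      obtain ⟨z, rfl⟩ := Ideal.mem_span_singleton'.1 (hle hy)
      rw [mul_comm]
      exact Submodule.smul_mem_smul hr ((h𝔮.mem_or_mem hy).resolve_right hr𝔮)
    have hR : IsDomain R := by
      rw [hbot] at h𝔮
      exact IsDomain.of_bot_isPrime R
    refine ⟨hR, (isWeaklyRegular_cons_iff R r rs).2 ⟨?_, ?_⟩⟩
    · intro x y hxy
      exact mul_left_cancel₀ (fun h => hr𝔮 (by rw [h]; exact 𝔮.zero_mem)) hxy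
    · have h1 : IsWeaklyRegular (R ⧸ Ideal.span {r}) rs :=
        (isWeaklyRegular_map_algebraMap_iff (R ⧸ Ideal.span {r}) (R ⧸ Ideal.span {r}) rs).1 hreg
      have h2 : (r • ⊤ : Submodule R R) = Ideal.span {r} := by
        rw [← Submodule.ideal_span_singleton_smul, smul_eq_mul, Ideal.mul_top]
      exact ((Submodule.quotEquivOfEq _ _ h2).isWeaklyRegular_congr rs).2 h1

/-- The maximal ideal of a regular local ring is generated by a regular sequence. -/
theorem exists_isWeaklyRegular_of_isRegularLocalRing (R : Type*) [CommRing R]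
    [IsRegularLocalRing R] :
    IsDomain R ∧ ∃ rs : List R, Ideal.ofList rs = maximalIdeal R ∧ IsWeaklyRegular R rs := by
  have hfg : (maximalIdeal R).FG := IsNoetherian.noetherian _
  have hfin := Submodule.FG.finite_generators hfg
  have h1 : Ideal.ofList hfin.toFinset.toList = maximalIdeal R := by
    refine Eq.trans ?_ (Submodule.span_generators (maximalIdeal R))
    rw [Ideal.ofList, Ideal.span]
    simp
  have h2 := isDomain_and_isWeaklyRegular hfin.toFinset.toList h1 (by
    rw [Finset.length_toList, ← Set.ncard_eq_toFinset_card _ hfin, Submodule.FG.generators_ncard hfg,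
      IsRegularLocalRing.spanFinrank_maximalIdeal])
  exact ⟨h2.1, _, h1, h2.2⟩

end RegularLocal

/-! ### Flatness of finite Frobenius lifts -/

section FlatLift

open RingTheory.Sequence Pointwise

/-- Generators of the maximal ideal of `R` act on `R'` through `h`, so freeness follows once they
are weakly regular there. As `h t` is a unit times `t'ˢ`, the passage from `R'/t'` to `R'/h t` is
the passage to powers of the first term. -/
theorem flat_of_isWeaklyRegular {R R' : Type*} [CommRing R] [CommRing R'] [IsLocalRing R]
    [IsNoetherianRing R] (h : R →+* R') (hfin : h.Finite) {t : R} {rs : List R}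
    (hm : Ideal.ofList (t :: rs) = maximalIdeal R) {t' u : R'} (ht' : t' ∈ nonZeroDivisors R')
    (hu : IsUnit u) {s : ℕ} (hs : h t = u * t' ^ s)
    (hw : IsWeaklyRegular (R' ⧸ Ideal.span {t'}) (rs.map h)) : h.Flat := by
  algebraize [h]
  have h1 : IsWeaklyRegular R' (t :: rs) := by
    rw [← isWeaklyRegular_map_algebraMap_iff R' R', List.map_cons, isWeaklyRegular_cons_iff]
    have ht : IsSMulRegular R' t' := fun x y hxy => by
      simpa using (mul_cancel_left_mem_nonZeroDivisors ht').1 hxy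
    constructor
    · rw [RingHom.algebraMap_toAlgebra, hs]
      exact (hu.isSMulRegular R').mul (ht.pow s)
    · have h2 : (t' • ⊤ : Submodule R' R') = Ideal.span {t'} := by
        rw [← Submodule.ideal_span_singleton_smul, smul_eq_mul, Ideal.mul_top]
      have h3 := ((Submodule.quotEquivOfEq _ _ h2).isWeaklyRegular_congr (rs.map h)).2 hw
      have h4 := isWeaklyRegular_quotSMulTop_pow ht h3 s
      have h5 : (algebraMap R R' t • ⊤ : Submodule R' R') = (t' ^ s) • ⊤ := by
        rw [RingHom.algebraMap_toAlgebra, hs, ← Submodule.ideal_span_singleton_smul,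
          ← Submodule.ideal_span_singleton_smul, Ideal.span_singleton_mul_left_unit hu]
      exact ((Submodule.quotEquivOfEq _ _ h5).isWeaklyRegular_congr (rs.map h)).2 h4
  have := free_of_isWeaklyRegular (t :: rs) hm R' h1
  change Module.Flat R R'
  infer_instance

theorem exists_eq_unit_mul_pow_of_dvd_pow {R : Type*} [CommRing R] {t : R}
    (ht : t ∈ nonZeroDivisors R) (htp : Prime t) (N : ℕ) :
    ∀ y : R, y ∣ t ^ N → ∃ (u : R) (s : ℕ), IsUnit u ∧ y = u * t ^ s := by
  induction N with
  | zero => exact fun y hy => ⟨y, 0, isUnit_of_dvd_one (by simpa using hy), by simp⟩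
  | succ N ih =>
    rintro y ⟨v, hv⟩
    rw [pow_succ'] at hv
    rcases htp.dvd_or_dvd (Dvd.intro _ hv) with ⟨w, rfl⟩ | ⟨w, rfl⟩
    · obtain ⟨u, s, hu, rfl⟩ := ih w ⟨v, by
        rw [← mul_cancel_left_mem_nonZeroDivisors ht, hv, mul_assoc]⟩
      exact ⟨u, s + 1, hu, by ring⟩
    · exact ih y ⟨w, by
        rw [← mul_cancel_left_mem_nonZeroDivisors ht, hv]; ring⟩

/-- Since `R/t` is a domain, `t` is prime, so the divisor `h t` of `tᴺ` is a unit times a power of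
`t`. Regular parameters of `R/t` are sent to their `q`-th powers modulo `t`, which remain weakly
regular. -/
theorem flat_of_isRegularLocalRing_quotient {R : Type*} [CommRing R] [IsLocalRing R]
    [IsNoetherianRing R] {t : R} (ht : t ∈ nonZeroDivisors R) (htm : t ∈ maximalIdeal R)
    [IsRegularLocalRing (R ⧸ Ideal.span {t})] (h : R →+* R) (hfin : h.Finite) {q N : ℕ}
    (hq : ∀ x, t ∣ h x - x ^ q) (hN : h t ∣ t ^ N) : h.Flat := by
  obtain ⟨hdom, rs', hrs', hw⟩ :=
    exists_isWeaklyRegular_of_isRegularLocalRing (R ⧸ Ideal.span {t})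
  obtain ⟨rs, rfl⟩ := List.map_surjective_iff.2
    (Ideal.Quotient.mk_surjective (I := Ideal.span {t})) rs'
  by_cases ht0 : t = 0
  · have : Subsingleton R := by
      rw [ht0] at ht
      exact subsingleton_of_zero_eq_one (by simpa using ht.1 1 (by simp))
    exact RingHom.Flat.of_bijective ⟨fun _ _ _ => Subsingleton.elim _ _,
      fun _ => ⟨0, Subsingleton.elim _ _⟩⟩
  have htp : Prime t := by
    rw [← Ideal.span_singleton_prime ht0]
    exact (Ideal.Quotient.isDomain_iff_prime _).1 hdom
  obtain ⟨u, s, hu, hs⟩ := exists_eq_unit_mul_pow_of_dvd_pow ht htp N _ hN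
  refine flat_of_isWeaklyRegular h hfin (t := t) (rs := rs) ?_ ht hu hs ?_
  · have hts : Ideal.span {t} ≤ maximalIdeal R := (Ideal.span_singleton_le_iff_mem _).2 htm
    rw [← Ideal.map_ofList, ← IsLocalRing.map_maximalIdeal_of_surjective
      (Ideal.Quotient.mk (Ideal.span {t})) Ideal.Quotient.mk_surjective] at hrs'
    have h1 := congrArg (Ideal.comap (Ideal.Quotient.mk (Ideal.span {t}))) hrs'
    rw [Ideal.comap_map_of_surjective' _ Ideal.Quotient.mk_surjective,
      Ideal.comap_map_of_surjective' _ Ideal.Quotient.mk_surjective, Ideal.mk_ker,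
      sup_eq_left.2 hts] at h1
    rw [Ideal.ofList_cons, sup_comm, h1]
  · rw [← isWeaklyRegular_map_algebraMap_iff (R ⧸ Ideal.span {t})]
    have h1 : (rs.map h).map (algebraMap R (R ⧸ Ideal.span {t})) =
        (rs.map (Ideal.Quotient.mk (Ideal.span {t}))).map (· ^ q) := by
      rw [List.map_map, List.map_map]
      refine List.map_congr_left fun x _ => ?_
      simp only [Function.comp_apply, Ideal.Quotient.algebraMap_eq]
      rw [← map_pow, Ideal.Quotient.eq, Ideal.mem_span_singleton]
      exact hq x
    rw [h1]
    exact isWeaklyRegular_map_pow q _ hw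

/-- If a prime `P` is the only prime over its contraction `Q` along a finite ring homomorphism,
then the homomorphism of the local rings at `Q` and `P` is finite. -/
theorem finite_localRingHom {S S' : Type*} [CommRing S] [CommRing S'] (g : S →+* S')
    (hg : g.Finite) (Q : Ideal S) [Q.IsPrime] (P : Ideal S') [P.IsPrime] (hPQ : Q = P.comap g)
    (huniq : ∀ P' : Ideal S', P'.IsPrime → P'.comap g = Q → P' = P) :
    (Localization.localRingHom Q P g hPQ).Finite := by
  -- Denominators outside `P` can be replaced by images of elements outside `Q`. Otherwise the
  -- contraction of `(s)` would lie in `Q`, and lying over would give a prime above `Q` containing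
  -- `s`; by uniqueness this prime is `P`.
  have key : ∀ s ∉ P, ∃ a ∉ Q, s ∣ g a := by
    intro s hs
    by_contra! hc
    algebraize [g]
    obtain ⟨P', hP', h1, h2⟩ := Ideal.exists_ideal_over_prime_of_isIntegral Q
      (Ideal.span {s}) (fun a ha => by
        by_contra haQ
        exact hc a haQ (Ideal.mem_span_singleton.1 ha))
    exact hs (huniq P' h1 h2 ▸ hP' (Ideal.mem_span_singleton_self s))
  set h := Localization.localRingHom Q P g hPQ
  obtain ⟨e, he⟩ : ∃ e : Finset S', ∀ x : S', ∃ c : S' → S, x = ∑ i ∈ e, g (c i) * i := by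
    algebraize [g]
    obtain ⟨e, he⟩ := (Module.Finite.fg_top : (⊤ : Submodule S S').FG)
    refine ⟨e, fun x => ?_⟩
    have hx : x ∈ Submodule.span S (e : Set S') := he ▸ trivial
    obtain ⟨c, -, hc⟩ := Submodule.mem_span_finset.1 hx
    exact ⟨c, by rw [← hc]; simp [Algebra.smul_def, RingHom.algebraMap_toAlgebra]⟩
  classical
  let _ := h.toAlgebra
  refine ⟨⟨e.image (algebraMap S' (Localization.AtPrime P)), top_le_iff.1 fun y _ => ?_⟩⟩
  obtain ⟨x, s, rfl⟩ := IsLocalization.exists_mk'_eq P.primeCompl y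
  obtain ⟨a, ha, s', hs'⟩ := key s.1 s.2
  have h1 : IsLocalization.mk' (Localization.AtPrime P) x s =
      h (IsLocalization.mk' (Localization.AtPrime Q) 1 (⟨a, ha⟩ : Q.primeCompl)) *
        algebraMap S' _ (x * s') := by
    rw [Localization.localRingHom_mk', ← IsLocalization.mk'_one (M := P.primeCompl)
      (Localization.AtPrime P) (x * s'), ← IsLocalization.mk'_mul, IsLocalization.mk'_eq_iff_eq]
    congr 1
    simp [hs']
    ring
  obtain ⟨c, hc⟩ := he (x * s')
  rw [h1, hc, map_sum, Finset.mul_sum]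
  refine Submodule.sum_mem _ fun i hi => ?_
  have h2 : h (IsLocalization.mk' (Localization.AtPrime Q) 1 (⟨a, ha⟩ : Q.primeCompl)) *
        algebraMap S' _ (g (c i) * i) =
      (IsLocalization.mk' (Localization.AtPrime Q) 1 (⟨a, ha⟩ : Q.primeCompl) *
        algebraMap S _ (c i)) • algebraMap S' (Localization.AtPrime P) i := by
    rw [Algebra.smul_def, RingHom.algebraMap_toAlgebra, map_mul, map_mul,
      Localization.localRingHom_to_map, mul_assoc]
  rw [h2]
  exact Submodule.smul_mem _ _ (Submodule.subset_span (by
    rw [Finset.coe_image]; exact ⟨i, hi, rfl⟩))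

/-- Localization commutes with quotients: the ring is the localization of `A` at the image of `P`.
-/
theorem isRegularLocalRing_localization_quotient {S A : Type*} [CommRing S] [CommRing A]
    [IsRegularRing A] {t : S} (ρ : S →+* A) (hρ : Function.Surjective ρ)
    (hker : RingHom.ker ρ = Ideal.span {t}) (P : Ideal S) [P.IsPrime] (htP : t ∈ P) :
    IsRegularLocalRing (Localization.AtPrime P ⧸
      Ideal.span {algebraMap S (Localization.AtPrime P) t}) := by
  have hle : RingHom.ker ρ ≤ P := by
    rw [hker]; exact (Ideal.span_singleton_le_iff_mem _).2 htP
  have hP' : (P.map ρ).IsPrime := Ideal.map_isPrime_of_surjective hρ hle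
  have hcomap : P = (P.map ρ).comap ρ := by
    rw [Ideal.comap_map_of_surjective' _ hρ, sup_eq_left.2 hle]
  let ψ := Localization.localRingHom P (P.map ρ) ρ hcomap
  have hψ : Function.Surjective ψ := by
    intro y
    obtain ⟨x, s, rfl⟩ := IsLocalization.exists_mk'_eq (P.map ρ).primeCompl y
    obtain ⟨x, rfl⟩ := hρ x
    obtain ⟨s', hs'⟩ := hρ s.1
    have hs : s' ∈ P.primeCompl := fun h => s.2 (by
      rw [← hs']; exact Ideal.mem_map_of_mem _ h)
    refine ⟨IsLocalization.mk' _ x (⟨s', hs⟩ : P.primeCompl), ?_⟩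
    rw [Localization.localRingHom_mk']
    congr 1
    exact Subtype.ext hs'
  have hψk : RingHom.ker ψ = Ideal.span {algebraMap S (Localization.AtPrime P) t} := by
    apply le_antisymm
    · intro y hy
      obtain ⟨x, s, rfl⟩ := IsLocalization.exists_mk'_eq P.primeCompl y
      rw [RingHom.mem_ker, Localization.localRingHom_mk', IsLocalization.mk'_eq_zero_iff] at hy
      obtain ⟨c, hc⟩ := hy
      obtain ⟨c', hc'⟩ := hρ c.1
      have hcP : c' ∈ P.primeCompl := fun h => c.2 (by
        rw [← hc']; exact Ideal.mem_map_of_mem _ h)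
      rw [← hc', ← map_mul, ← RingHom.mem_ker, hker, Ideal.mem_span_singleton] at hc
      obtain ⟨d, hd⟩ := hc
      rw [Ideal.mem_span_singleton]
      refine ⟨IsLocalization.mk' _ d (⟨c', hcP⟩ * s : P.primeCompl), ?_⟩
      rw [← IsLocalization.mk'_one (M := P.primeCompl) (Localization.AtPrime P) t,
        ← IsLocalization.mk'_mul, ← hd, IsLocalization.mk'_eq_iff_eq]
      congr 1
      simp
      ring
    · rw [Ideal.span_singleton_le_iff_mem, RingHom.mem_ker, Localization.localRingHom_to_map,
        (RingHom.mem_ker (f := ρ)).1 (hker ▸ Ideal.mem_span_singleton_self t), map_zero]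
  exact IsRegularLocalRing.of_ringEquiv
    ((Ideal.quotEquivOfEq hψk.symm).trans (RingHom.quotientKerEquivOfSurjective hψ)).symm

theorem flat_of_flat_localRingHom_of_isMaximal {S S' : Type*} [CommRing S] [CommRing S']
    (g : S →+* S') (H : ∀ (P : Ideal S') [P.IsMaximal],
      (Localization.localRingHom (P.comap g) P g rfl).Flat) : g.Flat := by
  algebraize_only [g]
  rw [RingHom.Flat]
  apply Module.flat_of_isLocalized_maximal S' S' (fun P ↦ Localization.AtPrime P)
    (fun P ↦ Algebra.linearMap S' _)
  intro P _
  algebraize_only [Localization.localRingHom (Ideal.comap g P) P g rfl]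
  have : IsScalarTower S (Localization.AtPrime (Ideal.comap g P)) (Localization.AtPrime P) :=
    .of_algebraMap_eq fun x ↦ (Localization.localRingHom_to_map _ _ _ rfl x).symm
  have h : Module.Flat (Localization.AtPrime (Ideal.comap g P)) (Localization.AtPrime P) := H P
  exact Module.Flat.trans S (Localization.AtPrime <| Ideal.comap g P) (Localization.AtPrime P)

/-- A finite lift of a power of Frobenius along the quotient by a nonzerodivisor `t` is flat if the
quotient is regular. -/
theorem flat_of_finite_of_isRegularRing_quotient {S A : Type*} [CommRing S] [CommRing A]
    [IsNoetherianRing S] [IsRegularRing A] {t : S} (ht : t ∈ nonZeroDivisors S)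
    (htj : t ∈ (⊥ : Ideal S).jacobson) (ρ : S →+* A) (hρ : Function.Surjective ρ)
    (hker : RingHom.ker ρ = Ideal.span {t}) (g : S →+* S) (hg : g.Finite) {q N : ℕ} (hq0 : q ≠ 0)
    (hq : ∀ x, t ∣ g x - x ^ q) (hN : g t ∣ t ^ N) : g.Flat := by
  have hq' : ∀ P' : Ideal S, t ∈ P' → ∀ x, g x - x ^ q ∈ P' := fun P' h x =>
    P'.mem_of_dvd (hq x) h
  -- Modulo `t` the map is `x ↦ x^q`, so a prime containing `t` equals its own contraction.
  have hmem : ∀ P' : Ideal S, P'.IsPrime → t ∈ P' → ∀ x, g x ∈ P' ↔ x ∈ P' := by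
    intro P' hP' h x
    refine ⟨fun h1 => hP'.mem_of_pow_mem q ?_, fun h1 => ?_⟩
    · simpa using P'.sub_mem h1 (hq' P' h x)
    · simpa using P'.add_mem (hq' P' h x) (P'.pow_mem_of_mem h1 q (Nat.pos_of_ne_zero hq0))
  refine flat_of_flat_localRingHom_of_isMaximal g fun P hP => ?_
  have htP : t ∈ P :=
    (Ideal.mem_sInf (s := {J : Ideal S | ⊥ ≤ J ∧ J.IsMaximal})).1 htj ⟨bot_le, hP⟩
  have hPg : P = P.comap g := by
    ext x
    exact (hmem P hP.isPrime htP x).symm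
  -- A prime over `P` contains `g t`, hence `tᴺ` and `t`, so it is equal to its contraction `P`.
  have hfin := finite_localRingHom g hg P P hPg fun P' hP' h => by
    have h1 : t ∈ P' := by
      have h2 : t ∈ P'.comap g := h ▸ htP
      exact hP'.mem_of_pow_mem N (P'.mem_of_dvd hN h2)
    rw [← h]
    ext x
    exact (hmem P' hP' h1 x).symm
  have hreg := isRegularLocalRing_localization_quotient ρ hρ hker P htP
  -- Freeing the source prime `Q` permits substituting `P = P.comap g`, so that the local map
  -- becomes an endomorphism of one ring.
  suffices H : ∀ (Q : Ideal S) [Q.IsPrime] (hQ : Q = P.comap g), P = Q →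
      (Localization.localRingHom Q P g hQ).Flat from H _ rfl hPg
  rintro Q _ hQ rfl
  refine flat_of_isRegularLocalRing_quotient (t := algebraMap S _ t) (q := q) (N := N)
    ?_ ?_ _ hfin ?_ ?_
  · exact IsLocalization.map_nonZeroDivisors_le P.primeCompl _ ⟨t, ht, rfl⟩
  · rw [← Localization.AtPrime.map_eq_maximalIdeal]
    exact Ideal.mem_map_of_mem _ htP
  · intro y
    obtain ⟨x, s, rfl⟩ := IsLocalization.exists_mk'_eq P.primeCompl y
    set y := IsLocalization.mk' (Localization.AtPrime P) x s
    have hy : y * algebraMap S _ s.1 = algebraMap S _ x := IsLocalization.mk'_spec _ x s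
    have ha : IsUnit (algebraMap S (Localization.AtPrime P) s.1) := IsLocalization.map_units _ s
    set h := Localization.localRingHom P P g hQ
    -- The congruence `h y ≡ y^q` passes to a fraction `y = x/s` after multiplication by the unit
    -- `h(s) s^q`.
    have h1 : (h y - y ^ q) * (h (algebraMap S _ s.1) * algebraMap S _ s.1 ^ q) =
        algebraMap S _ (g x * s.1 ^ q - x ^ q * g s.1) := by
      rw [map_sub, map_mul, map_mul, map_pow, map_pow, ← hy,
        ← Localization.localRingHom_to_map P P g hQ x,
        ← Localization.localRingHom_to_map P P g hQ s.1, ← hy, map_mul]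
      ring
    rw [← IsUnit.dvd_mul_right (a := algebraMap S _ t) ((ha.map h).mul (ha.pow q)), h1]
    refine map_dvd _ ?_
    have h2 : g x * s.1 ^ q - x ^ q * g s.1 =
        (g x - x ^ q) * s.1 ^ q - x ^ q * (g s.1 - s.1 ^ q) := by ring
    rw [h2]
    exact dvd_sub (dvd_mul_of_dvd_left (hq _) _) (dvd_mul_of_dvd_right (hq _) _)
  · rw [Localization.localRingHom_to_map, ← map_pow]
    exact map_dvd _ hN

end FlatLift

/-! ### Overconvergent rings and successive approximation -/

section Overconvergent

/-- The element `ϖ π⁻ᶜ`. -/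
def slope {D : Type*} [CommRing D] (ϖ : D) (π : Dˣ) (c : ℕ) : D := ϖ * ↑(π⁻¹ ^ c)

/-- An axiomatic description of a ring of overconvergent functions. The element `ϖ` is a
uniformizer, `π` is the variable, and `F c` is the subring of the series converging and bounded by
one where `|ϖ| ≤ |π|ᶜ`. -/
structure IsOverconvergent {D : Type*} [CommRing D] (ϖ : D) (π : Dˣ) (F : ℕ → Subring D) :
    Prop where
  mono : Monotone F
  uniformizer_mem : ϖ ∈ F 0
  param_mem : (π : D) ∈ F 0
  slope_mem : ∀ c, slope ϖ π c ∈ F c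
  -- In the model, `b` collects the terms with nonnegative exponent of `π`.
  exists_eq_add : ∀ c, ∀ x ∈ F c, ∃ b ∈ F 0, ∃ y ∈ F c, x = b + slope ϖ π c * y
  -- Completeness of `F c`, with tails that stay in `F c`.
  exists_sum : ∀ c (b : ℕ → D), (∀ t, b t ∈ F c) → ∃ x ∈ F c, ∀ n, ∃ y ∈ F c,
    x = ∑ t ∈ Finset.range n, slope ϖ π c ^ t * b t + slope ϖ π c ^ n * y
  exists_mem : ∀ x, ∃ c, (π : D) ^ c * x ∈ F c
  separated : ∀ x, (∀ n, ϖ ^ n ∣ x) → x = 0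
  exists_of_dvd : ∀ b ∈ F 0, ϖ ∣ b → ∃ b' ∈ F 0, b = ϖ * b'
  -- A substitute for noetherianity of `F 0 / ϖ`.
  fg_of_mem : ∀ J : Ideal (F 0), ⟨ϖ, uniformizer_mem⟩ ∈ J → J.FG

namespace IsOverconvergent

variable {D : Type*} [CommRing D] {ϖ : D} {π : Dˣ} {F : ℕ → Subring D}

theorem slope_eq_mul_pow (ϖ : D) (π : Dˣ) {c d : ℕ} (h : c ≤ d) :
    slope ϖ π c = slope ϖ π d * (π : D) ^ (d - c) := by
  obtain ⟨e, rfl⟩ := Nat.exists_eq_add_of_le h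
  rw [slope, slope, mul_assoc, ← Units.val_pow_eq_pow_val, ← Units.val_mul]
  congr 2
  rw [Nat.add_sub_cancel_left, pow_add, mul_assoc, inv_pow π e, inv_mul_cancel, mul_one]

theorem slope_mul_pow (ϖ : D) (π : Dˣ) (c : ℕ) : slope ϖ π c * (π : D) ^ c = ϖ := by
  have := slope_eq_mul_pow ϖ π (Nat.zero_le c)
  rw [Nat.sub_zero] at this
  rw [← this, slope, pow_zero, Units.val_one, mul_one]

theorem pow_dvd_slope_pow (ϖ : D) (π : Dˣ) (c n : ℕ) : ϖ ^ n ∣ slope ϖ π c ^ n :=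
  pow_dvd_pow_of_dvd (Dvd.intro _ rfl) n

variable (h : IsOverconvergent ϖ π F)
include h

theorem param_pow_mem (c n : ℕ) : (π : D) ^ n ∈ F c :=
  (F c).pow_mem (h.mono (Nat.zero_le c) h.param_mem) n

theorem exists_forall_mem (x : D) : ∃ c₀, ∀ c ≥ c₀, (π : D) ^ c * x ∈ F c := by
  obtain ⟨c₀, hc₀⟩ := h.exists_mem x
  refine ⟨c₀, fun c hc => ?_⟩
  obtain ⟨e, rfl⟩ := Nat.exists_eq_add_of_le hc
  rw [add_comm, pow_add, mul_assoc, add_comm]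
  exact (F _).mul_mem (h.param_pow_mem _ _) (h.mono hc hc₀)

theorem exists_mul_eq_slope_mul (x : D) : ∃ c₀, ∀ c ≥ c₀, ∃ y ∈ F c, ϖ * x = slope ϖ π c * y := by
  obtain ⟨c₀, hc₀⟩ := h.exists_forall_mem x
  exact ⟨c₀, fun c hc => ⟨_, hc₀ c hc, by rw [← mul_assoc, slope_mul_pow]⟩⟩

/-- Successive approximation. -/
theorem exists_eq_sum {S : Type*} [CommRing S] (φ : D →+* S)
    (hφ : ∀ s, (∀ n, φ ϖ ^ n ∣ s) → s = 0) {ι : Type*} [Fintype ι] (e : ι → S) (c : ℕ) (P : Set S)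
    (hP : ∀ s ∈ P, ∃ β : ι → D, (∀ i, β i ∈ F c) ∧ ∃ s' ∈ P,
      s = ∑ i, φ (β i) * e i + φ (slope ϖ π c) * s') :
    ∀ s ∈ P, ∃ a : ι → D, s = ∑ i, φ (a i) * e i := by
  choose! β hβ next hnext heq using hP
  intro s hs
  have hmem : ∀ t, next^[t] s ∈ P := fun t => by
    induction t with
    | zero => exact hs
    | succ t ih => rw [Function.iterate_succ_apply']; exact hnext _ ih
  choose a _ y _ hy using fun i =>
    h.exists_sum c (fun t => β (next^[t] s) i) (fun t => hβ _ (hmem t) i)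
  refine ⟨a, sub_eq_zero.1 (hφ _ fun n => ?_)⟩
  have h1 : s = ∑ t ∈ Finset.range n, φ (slope ϖ π c) ^ t *
      ∑ i, φ (β (next^[t] s) i) * e i + φ (slope ϖ π c) ^ n * next^[n] s := by
    induction n with
    | zero => simp
    | succ n ih =>
      rw [Finset.sum_range_succ, Function.iterate_succ_apply', add_assoc, pow_succ, mul_assoc,
        ← mul_add, ← heq _ (hmem n)]
      exact ih
  have h2 : ∑ i, φ (a i) * e i = ∑ t ∈ Finset.range n, φ (slope ϖ π c) ^ t *
      ∑ i, φ (β (next^[t] s) i) * e i + φ (slope ϖ π c) ^ n * ∑ i, φ (y i n) * e i := by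
    simp_rw [Finset.mul_sum]
    rw [Finset.sum_comm, ← Finset.sum_add_distrib]
    refine Finset.sum_congr rfl fun i _ => ?_
    rw [hy i n, map_add, map_sum, add_mul, Finset.sum_mul]
    simp only [map_mul, map_pow, mul_assoc]
  have h3 : s - ∑ i, φ (a i) * e i =
      φ (slope ϖ π c) ^ n * (next^[n] s - ∑ i, φ (y i n) * e i) := by
    rw [h2, mul_sub]
    nth_rw 1 [h1]
    ring
  rw [h3]
  refine dvd_mul_of_dvd_left ?_ _
  rw [← map_pow, ← map_pow]
  exact map_dvd φ (pow_dvd_slope_pow ϖ π c n)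

/-- A saturated ideal is finitely generated and closed for the `ϖ`-adic topology. -/
theorem exists_finset_of_saturated (J : Ideal D) (hJ : ∀ x, ϖ * x ∈ J → x ∈ J) :
    ∃ s : Finset D, (∀ x ∈ s, x ∈ J) ∧
      ∀ x, (∀ n, ∃ j ∈ J, ϖ ^ n ∣ x - j) → x ∈ Ideal.span (s : Set D) := by
  classical
  -- Take generators of `(J + ϖD) ∩ F 0` and correct them by multiples of `ϖ` to elements `η` of
  -- `J`; these will generate the closure of `J`. The constant `c` is later taken large enough for
  -- the finitely many corrections to lie in `ϖπ⁻ᶜ F c`.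
  obtain ⟨s, hs⟩ := h.fg_of_mem ((J ⊔ Ideal.span {ϖ}).comap (F 0).subtype)
    ((le_sup_right : _ ≤ J ⊔ Ideal.span {ϖ}) (Ideal.mem_span_singleton_self ϖ))
  have hsJ : ∀ b : s, ∃ η ∈ J, ∃ d, (b : D) = η + ϖ * d := by
    rintro ⟨b, hb⟩
    have h1 : b ∈ (J ⊔ Ideal.span {ϖ}).comap (F 0).subtype := hs ▸ Ideal.subset_span hb
    obtain ⟨η, hη, y, hy, h2⟩ := Submodule.mem_sup.1 h1
    obtain ⟨d, rfl⟩ := Ideal.mem_span_singleton.1 hy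
    exact ⟨η, hη, d, h2.symm⟩
  choose η hη d hd using hsJ
  choose c₀ hc₀ using fun b => h.exists_mul_eq_slope_mul (d b)
  refine ⟨Finset.univ.image η, fun x hx => ?_, fun x hx => ?_⟩
  · obtain ⟨b, -, rfl⟩ := Finset.mem_image.1 hx
    exact hη b
  obtain ⟨c₁, hc₁⟩ := h.exists_forall_mem x
  set c := max c₁ (Finset.univ.sup c₀)
  choose y hy hyd using fun b => hc₀ b c
    ((Finset.le_sup (Finset.mem_univ b)).trans (le_max_right _ _))
  have key := h.exists_eq_sum (RingHom.id D) h.separated η c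
    {x | x ∈ F c ∧ ∀ n, ∃ j ∈ J, ϖ ^ n ∣ x - j} (by
      rintro ξ ⟨hξ, hξJ⟩
      obtain ⟨b, hb, w, hw, rfl⟩ := h.exists_eq_add c ξ hξ
      have h1 : (⟨b, hb⟩ : F 0) ∈ (J ⊔ Ideal.span {ϖ}).comap (F 0).subtype := by
        obtain ⟨j, hj, e, he⟩ := hξJ 1
        refine Submodule.mem_sup.2 ⟨j, hj, ϖ * (e - ↑(π⁻¹ ^ c) * w),
          Ideal.mem_span_singleton.2 (Dvd.intro _ rfl), ?_⟩
        change _ = b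
        rw [pow_one, slope] at he
        linear_combination -he
      rw [← hs] at h1
      obtain ⟨β, -, hβ⟩ := Submodule.mem_span_finset.1 h1
      have hβ' : b = ∑ i : s, (β i : D) * i := by
        have := congrArg (F 0).subtype hβ
        rw [map_sum, ← Finset.sum_coe_sort] at this
        exact this.symm
      have h3 : b = ∑ i : s, (β i : D) * η i + slope ϖ π c * ∑ i : s, (β i : D) * y i := by
        rw [hβ', Finset.mul_sum, ← Finset.sum_add_distrib]
        refine Finset.sum_congr rfl fun i _ => ?_
        rw [hd i, hyd i]
        ring
      refine ⟨fun i => β i, fun i => h.mono (Nat.zero_le c) (β i).2,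
        w + ∑ i : s, (β i : D) * y i, ⟨(F c).add_mem hw (Subring.sum_mem _ fun i _ =>
          (F c).mul_mem (h.mono (Nat.zero_le c) (β i).2) (hy i)), fun n => ?_⟩, ?_⟩
      -- The remainder stays in the closure of `J`: approximate `ξ` one power of `ϖ` further and
      -- divide by `ϖ`, which saturation permits.
      · obtain ⟨j, hj, e, he⟩ := hξJ (n + 1)
        have h2 : ϖ * (w + ∑ i : s, (β i : D) * y i) =
            (π : D) ^ c * ((j - ∑ i : s, (β i : D) * η i) + ϖ ^ (n + 1) * e) := by
          rw [← he]
          linear_combination (-(w + ∑ i : s, (β i : D) * y i)) * slope_mul_pow ϖ π c -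
            (π : D) ^ c * h3
        have h4 : (π : D) ^ c * (j - ∑ i : s, (β i : D) * η i) ∈ J :=
          J.mul_mem_left _ (J.sub_mem hj (J.sum_mem fun i _ => J.mul_mem_left _ (hη i)))
        refine ⟨w + ∑ i : s, (β i : D) * y i - ϖ ^ n * ((π : D) ^ c * e), hJ _ ?_,
          ⟨(π : D) ^ c * e, by ring⟩⟩
        convert h4 using 1
        rw [mul_sub, h2]
        ring
      · simp only [RingHom.id_apply]
        linear_combination h3)
  obtain ⟨a, ha⟩ := key ((π : D) ^ c * x) ⟨hc₁ c (le_max_left _ _), fun n => by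
    obtain ⟨j, hj, e, he⟩ := hx n
    exact ⟨π ^ c * j, J.mul_mem_left _ hj, π ^ c * e, by rw [← mul_sub, he]; ring⟩⟩
  have h5 : x = ↑(π⁻¹ ^ c) * ((π : D) ^ c * x) := by
    rw [← mul_assoc, ← Units.val_pow_eq_pow_val, ← Units.val_mul]
    simp
  rw [h5, ha]
  refine Ideal.mul_mem_left _ _ (Ideal.sum_mem _ fun i _ => Ideal.mul_mem_left _ _
    (Ideal.subset_span ?_))
  simp

end IsOverconvergent

end Overconvergent

/-! ### Congruences between powers and a Frobenius recursion -/

section FrobeniusCongruences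

variable {R : Type*} [CommRing R]

/-- Expand `(y + zⁿw)ᵖ`: the middle terms contain `p zⁿ`, and the last one has exponent `np ≥ n + 1`
because `n ≥ 1`. -/
theorem pow_succ_dvd_pow_sub_pow {p : ℕ} (hp : p.Prime) {z x y : R} (hz : z ∣ (p : R)) {n : ℕ}
    (hn : n ≠ 0) (h : z ^ n ∣ x - y) : z ^ (n + 1) ∣ x ^ p - y ^ p := by
  obtain ⟨w, hw⟩ := h
  obtain ⟨v, hv⟩ := hz
  obtain ⟨r, hr⟩ := exists_add_pow_prime_eq hp y (z ^ n * w)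
  have h1 : x = y + z ^ n * w := by rw [← hw]; ring
  rw [h1, hr, hv, add_assoc, add_sub_cancel_left]
  refine dvd_add ?_ ⟨v * y * w * r, by ring⟩
  rw [mul_pow, ← pow_mul]
  refine dvd_mul_of_dvd_left (pow_dvd_pow z ?_) _
  have := hp.two_le
  nlinarith [Nat.pos_of_ne_zero hn]

theorem dvd_pow_sub_pow {z x y : R} (h : z ∣ x - y) (n : ℕ) : z ∣ x ^ n - y ^ n :=
  h.trans (sub_dvd_pow_sub_pow x y n)

theorem dvd_sum_pow_char_pow {p : ℕ} (hp : p.Prime) {z : R} (hz : z ∣ (p : R)) (a : ℕ)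
    {ι : Type*} (s : Finset ι) (f : ι → R) : z ∣ (∑ i ∈ s, f i) ^ p ^ a - ∑ i ∈ s, f i ^ p ^ a := by
  rw [← Ideal.mem_span_singleton, ← Ideal.Quotient.eq]
  rcases subsingleton_or_nontrivial (R ⧸ Ideal.span {z}) with h | h
  · exact Subsingleton.elim _ _
  have hpz : (p : R ⧸ Ideal.span {z}) = 0 := by
    rw [← map_natCast (Ideal.Quotient.mk (Ideal.span {z})), Ideal.Quotient.eq_zero_iff_mem,
      Ideal.mem_span_singleton]
    exact hz
  have : Fact p.Prime := ⟨hp⟩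
  have : CharP (R ⧸ Ideal.span {z}) p := (CharP.charP_iff_prime_eq_zero hp).2 hpz
  simp only [map_pow, map_sum]
  exact sum_pow_char_pow p _ _ _

/-- Frobenius lifts transfer: if `G` satisfies a recursion which lifts to a complete ring `R`, then
`G` factors through `R`. -/
theorem exists_lift_of_recursion {B S ι : Type*} [CommRing B] [CommRing S] [Fintype ι] {p : ℕ}
    (hp : p.Prime) (a : ℕ) {z : R} (hz : z ∣ (p : R))
    (hR : ∀ w : ℕ → R, ∃ x, ∀ n, z ^ n ∣ x - ∑ t ∈ Finset.range n, z ^ t * w t)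
    (i : B →+* R) {ϖ : B} (hϖ : z ∣ i ϖ) (ε : ι → B) (d : B → ι → B) (d' : B → B)
    (hd : ∀ β, β = ∑ j, d β j ^ p * ε j + ϖ * d' β)
    (l : ι → R) (hl : ∀ j, z ∣ l j - i (ε j) ^ p ^ a) (l₀ : R) (hl₀ : z ∣ l₀)
    (f : R →+* S) (hS : ∀ s, (∀ n, f z ^ n ∣ s) → s = 0) (G : B →+* S)
    (hG : ∀ β, f z ∣ G β - f (i β) ^ p ^ a)
    (hGl : ∀ j, G (ε j) = f (l j)) (hGl₀ : G ϖ = f l₀) :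
    ∀ β, ∃ x, z ∣ x - i β ^ p ^ a ∧ G β = f x := by
  -- `T` is the recursion satisfied by `G`, transported to `R`. It preserves lifts of `β ↦ β^{pᵃ}`
  -- modulo `z` and contracts: a congruence modulo `zⁿ⁺¹` improves to `zⁿ⁺²`, in the sum through the
  -- `p`-th powers and in the last term through `z ∣ l₀`. Iterating it from `β ↦ β^{pᵃ}` converges
  -- to the required lift.
  let T : (B → R) → B → R := fun ξ β => ∑ j, ξ (d β j) ^ p * l j + l₀ * ξ (d' β)
  have hTdef : ∀ ξ β, T ξ β = ∑ j, ξ (d β j) ^ p * l j + l₀ * ξ (d' β) := fun _ _ => rfl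
  let ξ : ℕ → B → R := fun n => T^[n] fun β => i β ^ p ^ a
  have hξ : ∀ n, ξ (n + 1) = T (ξ n) := fun n => Function.iterate_succ_apply' _ _ _
  have hT : ∀ ξ : B → R, (∀ β, z ∣ ξ β - i β ^ p ^ a) → ∀ β, z ∣ T ξ β - i β ^ p ^ a := by
    intro ξ hξ β
    have h1 : z ∣ i β ^ p ^ a - (∑ j, i (d β j ^ p * ε j)) ^ p ^ a := by
      refine dvd_pow_sub_pow ?_ _
      nth_rw 1 [hd β]
      rw [map_add, map_sum, add_sub_cancel_left, map_mul]
      exact dvd_mul_of_dvd_left hϖ _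
    have h2 := dvd_sum_pow_char_pow hp hz a Finset.univ fun j => i (d β j ^ p * ε j)
    have h3 : z ∣ ∑ j, (ξ (d β j) ^ p * l j - i (d β j ^ p * ε j) ^ p ^ a) := by
      refine Finset.dvd_sum fun j _ => ?_
      have h4 : z ∣ ξ (d β j) ^ p - (i (d β j) ^ p ^ a) ^ p := dvd_pow_sub_pow (hξ _) p
      have h5 : ξ (d β j) ^ p * l j - i (d β j ^ p * ε j) ^ p ^ a =
          (ξ (d β j) ^ p - (i (d β j) ^ p ^ a) ^ p) * l j +
            (i (d β j) ^ p ^ a) ^ p * (l j - i (ε j) ^ p ^ a) := by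
        rw [map_mul, map_pow]
        ring
      rw [h5]
      exact dvd_add (dvd_mul_of_dvd_left h4 _) (dvd_mul_of_dvd_right (hl j) _)
    rw [Finset.sum_sub_distrib] at h3
    have h6 := dvd_add (dvd_sub (dvd_sub h3 h1) h2) (dvd_mul_of_dvd_left hl₀ (ξ (d' β)))
    rw [hTdef]
    convert h6 using 1
    ring
  have hξ0 : ∀ n β, z ∣ ξ n β - i β ^ p ^ a := by
    intro n
    induction n with
    | zero => intro β; simp [ξ]
    | succ n ih => rw [hξ]; exact hT _ ih
  have hξs : ∀ n β, z ^ (n + 1) ∣ ξ (n + 1) β - ξ n β := by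
    intro n
    induction n with
    | zero =>
      intro β
      rw [zero_add, pow_one]
      convert dvd_sub (hξ0 1 β) (hξ0 0 β) using 1
      ring
    | succ n ih =>
      intro β
      have hβ : ∀ n, ξ (n + 1) β = ∑ j, ξ n (d β j) ^ p * l j + l₀ * ξ n (d' β) := fun n => by
        rw [hξ, hTdef]
      rw [hβ (n + 1), hβ n]
      have h1 : ∑ j, ξ (n + 1) (d β j) ^ p * l j + l₀ * ξ (n + 1) (d' β) -
          (∑ j, ξ n (d β j) ^ p * l j + l₀ * ξ n (d' β)) =
          ∑ j, (ξ (n + 1) (d β j) ^ p - ξ n (d β j) ^ p) * l j +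
            l₀ * (ξ (n + 1) (d' β) - ξ n (d' β)) := by
        simp only [sub_mul, Finset.sum_sub_distrib]
        ring
      rw [h1]
      refine dvd_add (Finset.dvd_sum fun j _ => dvd_mul_of_dvd_left
        (pow_succ_dvd_pow_sub_pow hp hz (Nat.succ_ne_zero n) (ih _)) _) ?_
      rw [pow_succ' z (n + 1)]
      exact mul_dvd_mul hl₀ (ih _)
  -- The same contraction compares `G` with the iterates; separatedness of `S` then identifies `G`
  -- with the image of the limit.
  have hGξ : ∀ n β, f z ^ (n + 1) ∣ G β - f (ξ n β) := by
    have hzp : f z ∣ (p : S) := by simpa using map_dvd f hz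
    intro n
    induction n with
    | zero => intro β; simpa [ξ] using hG β
    | succ n ih =>
      intro β
      have h1 : G β - f (ξ (n + 1) β) =
          ∑ j, (G (d β j) ^ p - f (ξ n (d β j)) ^ p) * f (l j) +
            f l₀ * (G (d' β) - f (ξ n (d' β))) := by
        rw [hξ, hTdef]
        nth_rw 1 [hd β]
        simp only [map_add, map_sum, map_mul, map_pow, hGl, hGl₀, sub_mul, Finset.sum_sub_distrib]
        ring
      rw [h1]
      refine dvd_add (Finset.dvd_sum fun j _ => dvd_mul_of_dvd_left
        (pow_succ_dvd_pow_sub_pow hp hzp (Nat.succ_ne_zero n) (ih _)) _) ?_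
      rw [pow_succ' (f z) (n + 1)]
      exact mul_dvd_mul (map_dvd f hl₀) (ih _)
  intro β
  choose w hw using fun n => hξs n β
  obtain ⟨x, hx⟩ := hR fun t => z * w t
  have hx' : ∀ n, z ^ n ∣ (x + ξ 0 β) - ξ n β := by
    intro n
    have h1 : ξ n β = ξ 0 β + ∑ t ∈ Finset.range n, z ^ t * (z * w t) := by
      rw [Finset.sum_congr rfl fun t _ => show z ^ t * (z * w t) = ξ (t + 1) β - ξ t β by
        rw [hw]; ring, Finset.sum_range_sub (fun t => ξ t β)]
      ring
    convert hx n using 1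
    rw [h1]
    ring
  refine ⟨x + ξ 0 β, ?_, sub_eq_zero.1 (hS _ fun n => ?_)⟩
  · convert dvd_add (by simpa using hx' 1) (hξ0 1 β) using 1
    ring
  · have h1 : f z ^ n ∣ G β - f (ξ n β) := (pow_dvd_pow _ n.le_succ).trans (hGξ n β)
    have h2 := map_dvd f (hx' n)
    rw [map_pow, map_sub] at h2
    convert dvd_sub h1 h2 using 1
    ring

end FrobeniusCongruences

/-! ### Noetherianity, the Jacobson radical and separation -/

namespace IsOverconvergent

variable {D : Type*} [CommRing D] {ϖ : D} {π : Dˣ} {F : ℕ → Subring D}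

section

variable (h : IsOverconvergent ϖ π F)
include h

/-- By Cohen's theorem only primes matter. One containing `ϖ` is generated by its trace on `F 0`,
because `πᶜx` lies in `F 0 + ϖD`; one not containing `ϖ` is saturated. -/
theorem isNoetherianRing : IsNoetherianRing D := by
  refine IsNoetherianRing.of_prime fun P hP => ?_
  by_cases hϖ : ϖ ∈ P
  · have h1 := h.fg_of_mem (P.comap (F 0).subtype) hϖ
    have h2 : (P.comap (F 0).subtype).map (F 0).subtype = P := by
      refine le_antisymm Ideal.map_comap_le fun x hx => ?_
      obtain ⟨c, hc⟩ := h.exists_mem x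
      obtain ⟨b, hb, y, hy, hby⟩ := h.exists_eq_add c _ hc
      have h3 : ϖ ∈ (P.comap (F 0).subtype).map (F 0).subtype :=
        Ideal.mem_map_of_mem (F 0).subtype
          (show (⟨ϖ, h.uniformizer_mem⟩ : F 0) ∈ P.comap (F 0).subtype from hϖ)
      have hs : ∀ I : Ideal D, ϖ ∈ I → slope ϖ π c * y ∈ I := fun I hI =>
        I.mul_mem_right _ (I.mul_mem_right _ hI)
      have hbP : b ∈ P := by
        have h4 := P.sub_mem (P.mul_mem_left ((π : D) ^ c) hx) (hs P hϖ)
        rwa [hby, add_sub_cancel_right] at h4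
      have h5 : b ∈ (P.comap (F 0).subtype).map (F 0).subtype :=
        Ideal.mem_map_of_mem (F 0).subtype
          (show (⟨b, hb⟩ : F 0) ∈ P.comap (F 0).subtype from hbP)
      have h6 := Ideal.add_mem _ h5 (hs _ h3)
      rw [← hby] at h6
      exact (Ideal.unit_mul_mem_iff_mem _ (π.isUnit.pow c)).1 h6
    exact h2 ▸ h1.map _
  · obtain ⟨s, hs, hs'⟩ := h.exists_finset_of_saturated P
      fun x hx => (hP.mem_or_mem hx).resolve_left hϖ
    exact ⟨s, le_antisymm (Ideal.span_le.2 hs) fun x hx => hs' x fun n => ⟨x, hx, by simp⟩⟩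

/-- The geometric series converges in `F c`. -/
theorem exists_mul_one_add_eq_one {c : ℕ} {w : D} (hw : w ∈ F c) :
    ∃ u ∈ F c, (1 + slope ϖ π c * w) * u = 1 := by
  obtain ⟨u, hu, hus⟩ := h.exists_sum c (fun t => (-w) ^ t)
    fun t => (F c).pow_mem ((F c).neg_mem hw) t
  refine ⟨u, hu, sub_eq_zero.1 (h.separated _ fun n => ?_)⟩
  obtain ⟨y, -, hy⟩ := hus n
  have h1 := mul_geom_sum (-(slope ϖ π c * w)) n
  have h2 : ∑ t ∈ Finset.range n, slope ϖ π c ^ t * (-w) ^ t =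
      ∑ t ∈ Finset.range n, (-(slope ϖ π c * w)) ^ t :=
    Finset.sum_congr rfl fun t _ => by rw [← mul_pow]; ring
  rw [h2] at hy
  have h3 : (1 + slope ϖ π c * w) * u - 1 =
      slope ϖ π c ^ n * ((1 + slope ϖ π c * w) * y - (-w) ^ n) := by
    rw [hy]
    have h4 : slope ϖ π c ^ n * (-w) ^ n = (-(slope ϖ π c * w)) ^ n := by
      rw [← mul_pow]; ring
    linear_combination -h1 + h4
  rw [h3]
  exact dvd_mul_of_dvd_left (pow_dvd_slope_pow ϖ π c n) _

theorem mem_jacobson : ϖ ∈ (⊥ : Ideal D).jacobson := by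
  rw [Ideal.mem_jacobson_bot]
  intro y
  obtain ⟨c, hc⟩ := h.exists_mul_eq_slope_mul y
  obtain ⟨w, hw, hwy⟩ := hc c le_rfl
  obtain ⟨u, -, hu⟩ := h.exists_mul_one_add_eq_one hw
  rw [hwy, add_comm]
  exact IsUnit.of_mul_eq_one _ hu

/-- As `ϖ` is a nonzerodivisor in `S`, the kernel of `f` is saturated, hence closed. -/
theorem eq_zero_of_forall_dvd {S : Type*} [CommRing S] (f : D →+* S)
    (hf : Function.Surjective f) (hϖ : f ϖ ∈ nonZeroDivisors S) (s : S)
    (hs : ∀ n, f ϖ ^ n ∣ s) : s = 0 := by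
  obtain ⟨t, ht, ht'⟩ := h.exists_finset_of_saturated (RingHom.ker f) fun x hx => by
    rw [RingHom.mem_ker, map_mul] at hx
    exact (mul_left_mem_nonZeroDivisors_eq_zero_iff hϖ).1 hx
  obtain ⟨x, rfl⟩ := hf s
  have h1 := ht' x fun n => by
    obtain ⟨y, hy⟩ := hs n
    obtain ⟨y, rfl⟩ := hf y
    exact ⟨x - ϖ ^ n * y, by rw [RingHom.mem_ker, map_sub, map_mul, map_pow, hy, sub_self],
      y, by ring⟩
  exact Ideal.span_le.2 ht h1

end

end IsOverconvergent

theorem finite_of_forall_exists_eq_sum {S S' ι : Type*} [CommRing S] [CommRing S'] [Fintype ι]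
    (g : S →+* S') (e : ι → S') (H : ∀ x, ∃ a : ι → S, x = ∑ i, g (a i) * e i) : g.Finite := by
  classical
  let _ := g.toAlgebra
  refine ⟨⟨Finset.univ.image e, top_le_iff.1 fun x _ => ?_⟩⟩
  obtain ⟨a, rfl⟩ := H x
  refine Submodule.sum_mem _ fun i _ => ?_
  exact Submodule.smul_mem _ (a i) (Submodule.subset_span (by simp))

/-! ### Finiteness of Frobenius lifts -/

namespace IsOverconvergent

variable {D : Type*} [CommRing D] {ϖ : D} {π : Dˣ} {F : ℕ → Subring D}

theorem slope_dvd (ϖ : D) (π : Dˣ) (c : ℕ) : slope ϖ π c ∣ ϖ := ⟨_, (slope_mul_pow ϖ π c).symm⟩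

section

variable (h : IsOverconvergent ϖ π F)
include h

/-- The point is that `c₀` does not depend on `β`: the recursion determines `g ∘ f` on `F 0` from
its values at the finitely many `ε j` and at `ϖ`, and `c₀` only has to accommodate these. -/
theorem exists_map_eq_add_slope {p : ℕ} (hp : p.Prime) (hpϖ : ϖ ∣ (p : D))
    {ι : Type*} [Fintype ι] {ε : ι → F 0} (hs : ∀ β : F 0, ∃ (d : ι → F 0) (d' : F 0),
      β = ∑ j, d j ^ p * ε j + ⟨ϖ, h.uniformizer_mem⟩ * d')
    {S : Type*} [CommRing S] (f : D →+* S) (hf : Function.Surjective f)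
    (hϖ : f ϖ ∈ nonZeroDivisors S) (g : S →+* S) (a : ℕ)
    (hg : ∀ x, f ϖ ∣ g x - x ^ p ^ a) :
    ∃ c₀, ∀ c ≥ c₀, ∀ β ∈ F 0, ∃ y ∈ F c, g (f β) = f (β ^ p ^ a + slope ϖ π c * y) := by
  choose d d' hd using hs
  have hg' : ∀ x : D, ∃ y, g (f x) = f (x ^ p ^ a + ϖ * y) := by
    intro x
    obtain ⟨y, hy⟩ := hg (f x)
    obtain ⟨y, rfl⟩ := hf y
    exact ⟨y, by rw [map_add, map_mul, ← hy, map_pow]; ring⟩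
  choose w hw using hg'
  -- This is `g(ϖ)` lifted to `D` and divided by `ϖ`, since the lift is `ϖ^q + ϖ w`.
  obtain ⟨c₁, hc₁⟩ := h.exists_mul_eq_slope_mul (ϖ ^ (p ^ a - 1) + w ϖ)
  choose c₂ hc₂ using fun j : ι => h.exists_mul_eq_slope_mul (w (ε j))
  refine ⟨max c₁ (Finset.univ.sup c₂), fun c hc => ?_⟩
  obtain ⟨y₀, hy₀, hy₀'⟩ := hc₁ c ((le_max_left _ _).trans hc)
  choose y hy hy' using fun j => hc₂ j c
    ((Finset.le_sup (Finset.mem_univ j)).trans ((le_max_right _ _).trans hc))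
  let z : F c := ⟨slope ϖ π c, h.slope_mem c⟩
  have hzdvd : ∀ x ∈ F 0, ∀ hx' : x ∈ F c, ϖ ∣ x → z ∣ (⟨x, hx'⟩ : F c) := by
    intro x hx hx' hdvd
    obtain ⟨b, hb, hb'⟩ := h.exists_of_dvd x hx hdvd
    refine ⟨⟨(π : D) ^ c * b, (F c).mul_mem (h.param_pow_mem c c) (h.mono (Nat.zero_le c) hb)⟩,
      Subtype.ext ?_⟩
    change x = slope ϖ π c * (π ^ c * b)
    rw [← mul_assoc, slope_mul_pow, hb']
  have hfz : f (slope ϖ π c) ∣ f ϖ := map_dvd f (slope_dvd ϖ π c)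
  have key := exists_lift_of_recursion (R := F c) (B := F 0) (S := S) hp a (z := z)
    (hzdvd (p : D) (natCast_mem _ p) (natCast_mem _ p) hpϖ)
    (fun w => by
      obtain ⟨x, hx, hxs⟩ := h.exists_sum c (fun t => (w t : D)) fun t => (w t).2
      refine ⟨⟨x, hx⟩, fun n => ?_⟩
      obtain ⟨y, hy, hxy⟩ := hxs n
      refine ⟨⟨y, hy⟩, Subtype.ext ?_⟩
      change x - (F c).subtype (∑ t ∈ Finset.range n, z ^ t * w t) = slope ϖ π c ^ n * y
      rw [map_sum, sub_eq_iff_eq_add']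
      exact hxy)
    (Subring.inclusion (h.mono (Nat.zero_le c))) (ϖ := ⟨ϖ, h.uniformizer_mem⟩)
    (hzdvd ϖ h.uniformizer_mem (h.mono (Nat.zero_le c) h.uniformizer_mem) dvd_rfl)
    ε d d' hd
    (fun j => ⟨(ε j : D) ^ p ^ a + slope ϖ π c * y j,
      (F c).add_mem ((F c).pow_mem (h.mono (Nat.zero_le c) (ε j).2) _)
        ((F c).mul_mem (h.slope_mem c) (hy j))⟩)
    (fun j => ⟨⟨y j, hy j⟩, Subtype.ext (by
      change (ε j : D) ^ p ^ a + slope ϖ π c * y j - (ε j : D) ^ p ^ a = slope ϖ π c * y j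
      ring)⟩)
    (z * ⟨y₀, hy₀⟩) (Dvd.intro _ rfl) (f.comp (F c).subtype)
    (fun x hx => h.eq_zero_of_forall_dvd f hf hϖ x fun n => (by
      rw [← map_pow, ← map_pow]
      exact map_dvd f (pow_dvd_slope_pow ϖ π c n) : f ϖ ^ n ∣ f (slope ϖ π c) ^ n).trans (hx n))
    ((g.comp f).comp (F 0).subtype)
    (fun β => hfz.trans (hg (f β)))
    (fun j => by
      change g (f (ε j)) = f (_ + _)
      rw [← hy', hw])
    (by
      change g (f ϖ) = f (slope ϖ π c * y₀)
      rw [← hy₀', hw, mul_add, ← pow_succ', Nat.sub_add_cancel (Nat.pow_pos hp.pos)])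
  intro β hβ
  obtain ⟨x, ⟨v, hv⟩, hx⟩ := key ⟨β, hβ⟩
  refine ⟨v, v.2, ?_⟩
  have hv' := congrArg (F c).subtype hv
  change (x : D) - β ^ p ^ a = slope ϖ π c * v at hv'
  rw [← hv', add_sub_cancel]
  exact hx

/-- A lift of a power of Frobenius is finite. -/
theorem finite_of_dvd_sub_pow {p : ℕ} (hp : p.Prime) (hpϖ : ϖ ∣ (p : D))
    (hfrob : ∀ a : ℕ, ∃ (r : ℕ) (ε : Fin r → F 0), ∀ β : F 0, ∃ (d : Fin r → F 0) (d' : F 0),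
      β = ∑ j, d j ^ p ^ a * ε j + ⟨ϖ, h.uniformizer_mem⟩ * d')
    {S : Type*} [CommRing S] (f : D →+* S) (hf : Function.Surjective f)
    (hϖ : f ϖ ∈ nonZeroDivisors S) (g : S →+* S) (a : ℕ)
    (hg : ∀ x, f ϖ ∣ g x - x ^ p ^ a) (N : ℕ) (hN : g (f ϖ) ∣ f ϖ ^ N) : g.Finite := by
  -- Exponent `1` feeds the recursion, which needs `p`-th powers even when `a = 0`; exponent `a`
  -- gives the expansion into generators.
  obtain ⟨_, ε₁, hs₁⟩ := hfrob 1
  rw [pow_one] at hs₁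
  obtain ⟨s, ε, hs⟩ := hfrob a
  obtain ⟨c₀, hc₀⟩ := h.exists_map_eq_add_slope hp hpϖ hs₁ f hf hϖ g a hg
  obtain ⟨v, hv⟩ := hN
  obtain ⟨ν, rfl⟩ := hf v
  obtain ⟨c₁, hc₁⟩ := h.exists_forall_mem ν
  set q := p ^ a with hq
  have hq0 : 0 < q := Nat.pow_pos hp.pos
  refine finite_of_forall_exists_eq_sum g (ι := Fin N × Fin s) (fun i => f ϖ ^ (i.1 : ℕ) * f (ε i.2))
    fun x => ?_
  obtain ⟨x, rfl⟩ := hf x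
  obtain ⟨c₂, hc₂⟩ := h.exists_forall_mem x
  set k := max (c₀ + q) (max c₁ c₂)
  set c := q * k with hc
  have hkc : k ≤ c := Nat.le_mul_of_pos_left k hq0
  -- The uniform estimate gives `g(π) = π^q U` with `U ∈ 1 + ϖπ⁻ᶜ F c`, so `π^{-q} = g(π⁻¹) U`.
  -- Raising to the power `k` is why `c = qk`, and `k ≥ c₀ + q` leaves room for factoring out `π^q`.
  have hu : ∃ u ∈ F c, f ↑(π⁻¹ ^ c) = g (f ↑(π⁻¹ ^ k)) * f u := by
    obtain ⟨y, hy, hy'⟩ := hc₀ c₀ le_rfl π h.param_mem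
    have hle : c₀ + q ≤ c := (le_max_left _ _).trans hkc
    refine ⟨(1 + slope ϖ π c * (π ^ (c - c₀ - q) * y)) ^ k, (F c).pow_mem ((F c).add_mem
      (F c).one_mem ((F c).mul_mem (h.slope_mem c) ((F c).mul_mem (h.param_pow_mem _ _)
        (h.mono (by omega) hy)))) k, ?_⟩
    have h1 : (π : D) ^ q + slope ϖ π c₀ * y =
        π ^ q * (1 + slope ϖ π c * (π ^ (c - c₀ - q) * y)) := by
      rw [slope_eq_mul_pow ϖ π (show c₀ ≤ c by omega)]
      have h2 : (π : D) ^ (c - c₀) = π ^ q * π ^ (c - c₀ - q) := by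
        rw [← pow_add]; congr 1; omega
      rw [h2]
      ring
    rw [h1] at hy'
    set U := 1 + slope ϖ π c * (π ^ (c - c₀ - q) * y)
    have h3 : (π : D) ^ q * ↑(π⁻¹ ^ q) = 1 := by
      rw [← Units.val_pow_eq_pow_val, ← Units.val_mul, inv_pow, mul_inv_cancel, Units.val_one]
    have h4 : (π : D) * ↑π⁻¹ = 1 := π.mul_inv
    have h5 : f ↑(π⁻¹ ^ q) = g (f ↑π⁻¹) * f U := by
      have h6 := congrArg (g.comp f) h4
      rw [map_mul, map_one, RingHom.comp_apply, RingHom.comp_apply, hy', map_mul] at h6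
      have h7 := congrArg f h3
      rw [map_mul, map_one] at h7
      linear_combination (-f ↑(π⁻¹ ^ q)) * h6 + g (f ↑π⁻¹) * f U * h7
    rw [hc, pow_mul, Units.val_pow_eq_pow_val _ k, Units.val_pow_eq_pow_val _ k, map_pow, map_pow,
      map_pow, map_pow, h5, mul_pow]
  obtain ⟨u, hu, huk⟩ := hu
  -- Split `x = b + ϖπ⁻ᶜ y₁`, expand `b` along `q`-th powers modulo `ϖ`, and replace each `dⱼ^q` by
  -- `g(dⱼ)`. All errors lie in `ϖπ⁻ᶜ F c`, and `π⁻ᶜ` is traded for `g(π⁻ᵏ) u`.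
  have step : ∀ x ∈ F c, ∃ β : Fin s → D, (∀ j, β j ∈ F 0) ∧ ∃ y ∈ F c,
      f x = ∑ j, g (f (β j)) * f (ε j) + f ϖ * g (f ↑(π⁻¹ ^ k)) * f y := by
    intro x hx
    obtain ⟨b, hb, y₁, hy₁, rfl⟩ := h.exists_eq_add c x hx
    obtain ⟨d, d', hd⟩ := hs ⟨b, hb⟩
    have hd' := congrArg (F 0).subtype hd
    simp only [map_add, map_sum, map_mul, map_pow, Subring.coe_subtype] at hd'
    choose y hy hy' using fun j => hc₀ c (by
      have := le_max_left (c₀ + q) (max c₁ c₂); omega) (d j : D) (d j).2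
    refine ⟨fun j => d j, fun j => (d j).2, u * (y₁ + π ^ c * d' - ∑ j, y j * ε j),
      (F c).mul_mem hu ((F c).sub_mem ((F c).add_mem hy₁ ((F c).mul_mem (h.param_pow_mem _ _)
        (h.mono (Nat.zero_le c) d'.2))) (Subring.sum_mem _ fun j _ =>
          (F c).mul_mem (hy j) (h.mono (Nat.zero_le c) (ε j).2))), ?_⟩
    have h1 : f ϖ * g (f ↑(π⁻¹ ^ k)) * f (u * (y₁ + π ^ c * d' - ∑ j, y j * ε j)) =
        f (slope ϖ π c * (y₁ + π ^ c * d' - ∑ j, y j * ε j)) := by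
      rw [map_mul f u, slope, map_mul f (ϖ * _), map_mul f ϖ, huk]
      ring
    have h2 : slope ϖ π c * (y₁ + π ^ c * d' - ∑ j, y j * ε j) = slope ϖ π c * y₁ + ϖ * d' -
        ∑ j, slope ϖ π c * y j * ε j := by
      rw [mul_sub, mul_add, ← mul_assoc _ (_ ^ c), slope_mul_pow, Finset.mul_sum]
      simp only [mul_assoc]
    rw [h1, h2, hd']
    simp only [hy', map_add, map_sub, map_sum, map_mul, map_pow, add_mul, Finset.sum_add_distrib]
    ring
  choose! β hβ y hy hxy using step
  have hmem : ∀ x ∈ F c, ∀ t, y^[t] x ∈ F c := fun x hx t => by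
    induction t with
    | zero => exact hx
    | succ t ih => rw [Function.iterate_succ_apply']; exact hy _ ih
  have hiter : ∀ x ∈ F c, ∀ r, f x = ∑ t ∈ Finset.range r, ∑ j, g (f (β (y^[t] x) j)) *
      (g (f ↑(π⁻¹ ^ k)) ^ t * (f ϖ ^ t * f (ε j))) + f ϖ ^ r * g (f ↑(π⁻¹ ^ k)) ^ r * f (y^[r] x) := by
    intro x hx r
    induction r with
    | zero => simp
    | succ r ih =>
      rw [Finset.sum_range_succ, Function.iterate_succ_apply', add_assoc]
      refine ih.trans ?_
      congr 1
      rw [hxy _ (hmem x hx r), mul_add, Finset.mul_sum]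
      congr 1
      · exact Finset.sum_congr rfl fun j _ => by ring
      · ring
  -- Approximation now runs in powers of `g(ϖ)`; `S` is separated for these because `ϖ ∣ g(ϖ)`.
  have key := h.exists_eq_sum (g.comp f) (fun x hx => h.eq_zero_of_forall_dvd f hf hϖ x fun n =>
      (pow_dvd_pow_of_dvd (by
        have h1 := hg (f ϖ)
        rwa [dvd_sub_left (dvd_pow_self _ hq0.ne')] at h1) n).trans (hx n))
    (ι := Fin N × Fin s) (fun i => g (f ↑(π⁻¹ ^ k)) ^ (i.1 : ℕ) * (f ϖ ^ (i.1 : ℕ) * f (ε i.2)))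
    ((N + 1) * k) (f '' F c) (by
      rintro _ ⟨x, hx, rfl⟩
      -- After `N` rounds the error contains `ϖᴺ = g(ϖ)ν`. Writing `ν = π⁻ᶜ(πᶜν) = g(π⁻ᵏ)u(πᶜν)`
      -- makes it `g(ϖπ^{-(N+1)k})` times an element of `F c`, whence the exponent `(N + 1) * k`.
      refine ⟨fun i => β (y^[i.1] x) i.2, fun i => h.mono (Nat.zero_le _) (hβ _ (hmem x hx _) _),
        f (u * (π ^ c * ν * y^[N] x)), ⟨_, (F c).mul_mem hu ((F c).mul_mem
          (hc₁ c ((le_max_left _ _).trans ((le_max_right _ _).trans hkc))) (hmem x hx N)), rfl⟩, ?_⟩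
      refine (hiter x hx N).trans ?_
      rw [Fintype.sum_prod_type, Finset.sum_range]
      congr 1
      have h1 : f ↑(π⁻¹ ^ c) * f (π ^ c) = 1 := by
        rw [← map_mul, ← Units.val_pow_eq_pow_val, ← Units.val_mul]
        simp
      have h2 : g (f ↑(π⁻¹ ^ ((N + 1) * k))) = g (f ↑(π⁻¹ ^ k)) ^ N * g (f ↑(π⁻¹ ^ k)) := by
        rw [← pow_succ, ← map_pow, ← map_pow, ← Units.val_pow_eq_pow_val, ← pow_mul, mul_comm k]
      rw [hv, RingHom.comp_apply, slope, map_mul f ϖ, map_mul g (f ϖ), h2, map_mul f u,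
        map_mul f (_ * _), map_mul f (_ ^ c)]
      linear_combination g (f ϖ) * f ν * g (f ↑(π⁻¹ ^ k)) ^ N * f (y^[N] x) * (f (π ^ c) * huk - h1))
  obtain ⟨α, hα⟩ := key (f (u * (π ^ c * x))) ⟨_, (F c).mul_mem hu
    (hc₂ c ((le_max_right _ _).trans ((le_max_right _ _).trans hkc))), rfl⟩
  -- The integer `k` depends on `x`, so the powers of `g(π⁻ᵏ)` must move into the scalars; this
  -- leaves generators `ϖⁱ εⱼ` independent of `x`.
  refine ⟨fun i => f (↑(π⁻¹ ^ k) * ↑(π⁻¹ ^ k) ^ (i.1 : ℕ) * α i), ?_⟩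
  have h1 : f ↑(π⁻¹ ^ c) * f (π ^ c) = 1 := by
    rw [← map_mul, ← Units.val_pow_eq_pow_val, ← Units.val_mul]
    simp
  have h2 : f x = g (f ↑(π⁻¹ ^ k)) * f (u * (π ^ c * x)) := by
    rw [map_mul f u, map_mul f (_ ^ c)]
    linear_combination f x * (f (π ^ c) * huk - h1)
  rw [h2, hα, Finset.mul_sum]
  refine Finset.sum_congr rfl fun i _ => ?_
  simp only [map_mul, map_pow, RingHom.comp_apply]
  ring

end

end IsOverconvergent

/-! ### Overconvergence in terms of coefficients -/

section Coefficients

variable {𝔬 : Type*} [CommRing 𝔬] [IsDomain 𝔬] [IsDiscreteValuationRing 𝔬]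

theorem mem_maximalIdeal_pow_iff_dvd {ϖ : 𝔬} (hϖ : Irreducible ϖ) (a : 𝔬) (N : ℕ) :
    a ∈ maximalIdeal 𝔬 ^ N ↔ ϖ ^ N ∣ a := by
  rw [hϖ.maximalIdeal_eq, Ideal.span_singleton_pow, Ideal.mem_span_singleton]

theorem absVal_le_pow_iff {ϖ : 𝔬} (hϖ : Irreducible ϖ) (η : Set.Ioo (0 : ℝ) 1) (a : 𝔬) (N : ℕ) :
    absVal η a ≤ (η : ℝ) ^ N ↔ ϖ ^ N ∣ a := by
  by_cases ha : a = 0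
  · simp [ha, absVal_zero, pow_nonneg η.2.1.le N]
  have htop : IsDiscreteValuationRing.addVal 𝔬 a ≠ ⊤ := by
    rwa [Ne, IsDiscreteValuationRing.addVal_eq_top_iff]
  rw [absVal_of_ne η ha, pow_le_pow_iff_right_of_lt_one₀ η.2.1 η.2.2,
    ← mem_maximalIdeal_pow_iff_dvd hϖ, mem_maximalIdeal_pow_iff]
  conv_rhs => rw [← ENat.natCast_toNat htop]
  exact_mod_cast Iff.rfl

theorem eq_zero_of_forall_pow_dvd [IsAdicComplete (maximalIdeal 𝔬) 𝔬] {ϖ : 𝔬}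
    (hϖ : Irreducible ϖ) {a : 𝔬} (ha : ∀ N, ϖ ^ N ∣ a) : a = 0 := by
  refine IsHausdorff.haus (I := maximalIdeal 𝔬) inferInstance _ fun N => ?_
  rw [SModEq.zero, smul_eq_mul, Ideal.mul_top, mem_maximalIdeal_pow_iff_dvd hϖ]
  exact ha N

variable [IsAdicComplete (maximalIdeal 𝔬) 𝔬] {m n : ℕ}

theorem Bilateral.coeff_single_mul (d : ℤ) (a : 𝔬) (b : Bilateral 𝔬) (i : ℤ) :
    (Bilateral.single d a * b).coeff i = a * b.coeff (i - d) := by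
  refine sub_eq_zero.1 (IsHausdorff.haus (I := maximalIdeal 𝔬) inferInstance _ fun N => ?_)
  rw [SModEq.zero, smul_eq_mul, Ideal.mul_top, ← Ideal.Quotient.eq, ← Bilateral.coeff_mod,
    Bilateral.mod_mul, Bilateral.mod_single, HahnSeries.coeff_single_mul, map_mul]
  rfl

theorem Formal.ext_coeff {x y : Formal 𝔬 m n} (h : ∀ i j k, x.coeff i j k = y.coeff i j k) :
    x = y := by
  ext k j : 2
  exact Bilateral.ext (funext fun i => h i j k)

/-- The monomial `a πᵈ`. -/
def Formal.monomial (m n : ℕ) (d : ℤ) (a : 𝔬) : Formal 𝔬 m n :=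
  MvPowerSeries.C (MvPowerSeries.C (Bilateral.single d a))

theorem Formal.coeff_monomial_mul (d : ℤ) (a : 𝔬) (x : Formal 𝔬 m n) (i : ℤ) (j : Fin m →₀ ℕ)
    (k : Fin n →₀ ℕ) : (Formal.monomial m n d a * x).coeff i j k = a * x.coeff (i - d) j k := by
  rw [Formal.coeff, Formal.monomial, MvPowerSeries.coeff_C_mul, MvPowerSeries.coeff_C_mul,
    Bilateral.coeff_single_mul]
  rfl

theorem Formal.monomial_mul (d e : ℤ) (a b : 𝔬) :
    Formal.monomial m n d a * Formal.monomial m n e b = Formal.monomial m n (d + e) (a * b) := by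
  rw [Formal.monomial, Formal.monomial, Formal.monomial, ← map_mul, ← map_mul]
  congr 2
  ext i
  rw [Bilateral.coeff_single_mul, Bilateral.coeff_single, Bilateral.coeff_single]
  by_cases h : i = d + e
  · rw [if_pos h, if_pos (by omega)]
  · rw [if_neg h, if_neg (by omega), mul_zero]

theorem Formal.monomial_one : Formal.monomial m n 0 (1 : 𝔬) = 1 := by
  rw [Formal.monomial, show Bilateral.single 0 (1 : 𝔬) = 1 from rfl, map_one, map_one]

theorem Formal.algebraMap_eq_monomial (a : 𝔬) :
    algebraMap 𝔬 (Formal 𝔬 m n) a = Formal.monomial m n 0 a := by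
  rw [MvPowerSeries.algebraMap_apply, MvPowerSeries.algebraMap_apply, Bilateral.algebraMap_eq]
  rfl

/-- The coefficients `a` are bounded by one where `|ϖ| ≤ |π|ᶜ`, up to a factor `π⁻ᴶ`. -/
def HasSlope (ϖ : 𝔬) (c J : ℕ) (a : ℤ → (Fin m →₀ ℕ) → (Fin n →₀ ℕ) → 𝔬) : Prop :=
  ∀ (i : ℤ) j k (N : ℕ), i + c * N + J < 0 → ϖ ^ (N + 1) ∣ a i j k

/-- Modulo each power of `ϖ`, the coefficient of each `πⁱ Uᵏ` is polynomial in `T`. -/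
def IsTConvergent (ϖ : 𝔬) (a : ℤ → (Fin m →₀ ℕ) → (Fin n →₀ ℕ) → 𝔬) : Prop :=
  ∀ (N : ℕ) i k, {j | ¬ ϖ ^ N ∣ a i j k}.Finite

omit [IsDomain 𝔬] [IsDiscreteValuationRing 𝔬] [IsAdicComplete (maximalIdeal 𝔬) 𝔬] in
theorem HasSlope.mono {ϖ : 𝔬} {c c' J J' : ℕ} (hc : c ≤ c') (hJ : J ≤ J')
    {a : ℤ → (Fin m →₀ ℕ) → (Fin n →₀ ℕ) → 𝔬} (h : HasSlope ϖ c J a) : HasSlope ϖ c' J' a := by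
  intro i j k N hi
  refine h i j k N (lt_of_le_of_lt ?_ hi)
  have : (c : ℤ) * N ≤ c' * N := mul_le_mul_of_nonneg_right (by exact_mod_cast hc) (by positivity)
  omega

variable {ω η : Set.Ioo (0 : ℝ) 1} {ϖ : 𝔬}

theorem IsConvergent.isTConvergent (hϖ : Irreducible ϖ) {r : ℝ} {x : Formal 𝔬 m n}
    (hx : IsConvergent ω η r x) : IsTConvergent ϖ x.coeff := by
  intro N i k
  have hω := Real.rpow_pos_of_pos ω.2.1 (r * i)
  have h1 := (hx (η ^ N * (ω : ℝ) ^ (r * i)) (mul_pos (pow_pos η.2.1 N) hω)).2 k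
  refine (h1.image Prod.snd).subset fun j hj => ⟨(i, j), ?_, rfl⟩
  rw [Set.mem_ofPred_eq, ← absVal_le_pow_iff hϖ η, not_le] at hj
  exact mul_le_mul_of_nonneg_right hj.le hω.le

theorem IsConvergent.exists_hasSlope (hϖ : Irreducible ϖ) {r : ℝ} (hr : 0 < r)
    {x : Formal 𝔬 m n} (hx : IsConvergent ω η r x) : ∃ c J, HasSlope ϖ c J x.coeff := by
  obtain ⟨B, hB, hxB⟩ := hx.bounded hr
  have hω1 : (ω : ℝ) ^ r < 1 := Real.rpow_lt_one ω.2.1.le ω.2.2 hr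
  have hω0 : 0 < (ω : ℝ) ^ r := Real.rpow_pos_of_pos ω.2.1 r
  -- A coefficient not divisible by `ϖᴺ⁺¹` has `ηᴺ⁺¹ ω^{ri} < B`. With `ω^{rc} < η` and `ω^{rJ} <
  -- η/B` this forces `i + cN + J ≥ 0`.
  obtain ⟨c, hc⟩ := exists_pow_lt_of_lt_one η.2.1 hω1
  obtain ⟨J, hJ⟩ := exists_pow_lt_of_lt_one (div_pos η.2.1 hB) hω1
  refine ⟨c, J, fun i j k N hi => ?_⟩
  rw [← absVal_le_pow_iff hϖ η]
  by_contra! hlt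
  set e := c * N + J with he
  have h1 : (ω : ℝ) ^ (r * i) * ((ω : ℝ) ^ r) ^ e ≥ 1 := by
    rw [← Real.rpow_natCast, ← Real.rpow_mul ω.2.1.le, ← Real.rpow_add ω.2.1, ← mul_add]
    refine Real.one_le_rpow_of_pos_of_le_one_of_nonpos ω.2.1 ω.2.2.le
      (mul_nonpos_of_nonneg_of_nonpos hr.le ?_)
    have h2 : i + (e : ℤ) ≤ 0 := by rw [he]; push_cast; omega
    exact_mod_cast h2
  have h3 : ((ω : ℝ) ^ r) ^ e ≤ η ^ N * (η / B) := by
    rw [he, pow_add, pow_mul]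
    exact mul_le_mul (pow_le_pow_left₀ (pow_pos hω0 c).le hc.le N) hJ.le (pow_pos hω0 J).le
      (pow_nonneg η.2.1.le N)
  have h4 := hxB i j k
  unfold gaussTerm at h4
  have hωi := Real.rpow_pos_of_pos ω.2.1 (r * i)
  have h5 : (η : ℝ) ^ (N + 1) * (ω : ℝ) ^ (r * i) < B :=
    lt_of_lt_of_le (mul_lt_mul_of_pos_right hlt hωi) h4
  have h6 : 1 ≤ (ω : ℝ) ^ (r * i) * (η ^ N * (η / B)) :=
    h1.le.trans (mul_le_mul_of_nonneg_left h3 hωi.le)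
  have h7 : (ω : ℝ) ^ (r * i) * (η ^ N * (η / B)) = η ^ (N + 1) * (ω : ℝ) ^ (r * i) / B := by
    rw [pow_succ]; ring
  rw [h7, le_div_iff₀ hB] at h6
  linarith

theorem exists_isConvergent (hϖ : Irreducible ϖ) {x : Formal 𝔬 m n} {c J : ℕ}
    (hs : HasSlope ϖ c J x.coeff) (hT : IsTConvergent ϖ x.coeff) :
    ∃ r : ℝ, 0 < r ∧ IsConvergent ω η r x := by
  obtain ⟨M, hM⟩ := exists_pow_lt_of_lt_one ω.2.1 η.2.2
  have hM0 : M ≠ 0 := by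
    rintro rfl
    rw [pow_zero] at hM
    exact absurd ω.2.2 (not_lt.2 hM.le)
  have hd : (0 : ℝ) < 2 * M * (c + 1) := by positivity
  -- Since `η^M < ω`, this `r` makes `η < ω^{rc}`. A term of valuation `V` has `i ≥ -(cV + J)`, so
  -- its norm is at most `κ^V ω^{-rJ}` with `κ = η/ω^{rc} < 1`: large norm bounds `V`, then `i` from
  -- below; `i` is bounded above because the coefficients have absolute value at most one.
  refine ⟨1 / (2 * M * (c + 1)), one_div_pos.2 hd, ?_⟩
  set r : ℝ := 1 / (2 * M * (c + 1)) with hr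
  have hr0 : 0 < r := one_div_pos.2 hd
  set W : ℝ := (ω : ℝ) ^ r with hW
  have hW0 : 0 < W := Real.rpow_pos_of_pos ω.2.1 r
  have hW1 : W < 1 := Real.rpow_lt_one ω.2.1.le ω.2.2 hr0
  have hpow : ∀ e : ℕ, (ω : ℝ) ^ (r * e) = W ^ e := fun e => by
    rw [hW, ← Real.rpow_natCast, ← Real.rpow_mul ω.2.1.le]
  have hWc : (η : ℝ) < W ^ c := by
    have h1 : ((η : ℝ) ^ M) ^ (r * c) < (ω : ℝ) ^ (r * c) ∨ c = 0 := by
      rcases Nat.eq_zero_or_pos c with h0 | h0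
      · exact Or.inr h0
      · exact Or.inl (Real.rpow_lt_rpow (pow_nonneg η.2.1.le M) hM (by positivity))
    rcases h1 with h1 | rfl
    · rw [← hpow]
      refine lt_of_le_of_lt ?_ h1
      rw [← Real.rpow_natCast, ← Real.rpow_mul η.2.1.le]
      conv_lhs => rw [← Real.rpow_one (η : ℝ)]
      refine Real.rpow_le_rpow_of_exponent_ge η.2.1 η.2.2.le ?_
      have h2 : (M : ℝ) * (r * c) = c / (2 * (c + 1)) := by
        rw [hr]; field_simp
      rw [h2, div_le_one (by positivity)]
      linarith [(Nat.cast_nonneg c : (0 : ℝ) ≤ c)]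
    · simpa using η.2.2
  set κ : ℝ := η / W ^ c with hκ
  have hκ0 : 0 < κ := div_pos η.2.1 (pow_pos hW0 c)
  have hκ1 : κ < 1 := (div_lt_one (pow_pos hW0 c)).2 hWc
  intro ε hε
  obtain ⟨V₀, hV₀⟩ := exists_pow_lt_of_lt_one (mul_pos hε (pow_pos hW0 J)) hκ1
  obtain ⟨e, he⟩ := exists_pow_lt_of_lt_one hε hW1
  have key : ∀ i j k, ε ≤ gaussTerm ω η r x i j k →
      -(c * V₀ + J : ℤ) ≤ i ∧ i ≤ e ∧ ¬ ϖ ^ V₀ ∣ x.coeff i j k := by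
    intro i j k h
    unfold gaussTerm at h
    have hωi := Real.rpow_pos_of_pos ω.2.1 (r * i)
    have hV : ∀ V : ℕ, ϖ ^ V ∣ x.coeff i j k → V < V₀ := by
      intro V hdvd
      by_contra! hle
      have hex : ∃ V' ≥ V₀, ϖ ^ V' ∣ x.coeff i j k ∧ ¬ ϖ ^ (V' + 1) ∣ x.coeff i j k := by
        by_contra! hn
        have hall : ∀ N, ϖ ^ (V₀ + N) ∣ x.coeff i j k := fun N => by
          induction N with
          | zero => exact (pow_dvd_pow ϖ hle).trans hdvd
          | succ N ih => exact hn _ (Nat.le_add_right _ _) ih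
        have h0 : x.coeff i j k = 0 :=
          eq_zero_of_forall_pow_dvd hϖ fun N => (pow_dvd_pow ϖ (Nat.le_add_left N V₀)).trans (hall N)
        rw [h0, absVal_zero, zero_mul] at h
        exact absurd h (not_le.2 hε)
      obtain ⟨V', hV', hd1, hd2⟩ := hex
      have hi : 0 ≤ i + c * V' + J := by
        by_contra! hlt
        exact hd2 (hs i j k V' hlt)
      have h1 : (ω : ℝ) ^ (r * i) * W ^ (c * V' + J) ≤ 1 := by
        rw [← hpow, ← Real.rpow_add ω.2.1, ← mul_add]
        refine Real.rpow_le_one ω.2.1.le ω.2.2.le (mul_nonneg hr0.le ?_)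
        have : (0 : ℤ) ≤ i + ((c * V' + J : ℕ) : ℤ) := by push_cast; omega
        exact_mod_cast this
      have h2 : absVal η (x.coeff i j k) ≤ η ^ V' := (absVal_le_pow_iff hϖ η _ _).2 hd1
      have h3 : ε * W ^ J ≤ κ ^ V' := by
        rw [hκ, div_pow, le_div_iff₀ (pow_pos (pow_pos hW0 c) V')]
        calc ε * W ^ J * (W ^ c) ^ V' = ε * W ^ (c * V' + J) := by rw [pow_add, pow_mul]; ring
          _ ≤ η ^ V' * (ω : ℝ) ^ (r * i) * W ^ (c * V' + J) :=
            mul_le_mul_of_nonneg_right (h.trans (mul_le_mul_of_nonneg_right h2 hωi.le))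
              (pow_pos hW0 _).le
          _ = η ^ V' * ((ω : ℝ) ^ (r * i) * W ^ (c * V' + J)) := by ring
          _ ≤ η ^ V' * 1 := mul_le_mul_of_nonneg_left h1 (pow_nonneg η.2.1.le _)
          _ = η ^ V' := mul_one _
      exact absurd (h3.trans (pow_le_pow_of_le_one hκ0.le hκ1.le hV')) (not_le.2 hV₀)
    have hnd : ¬ ϖ ^ V₀ ∣ x.coeff i j k := fun hd => lt_irrefl _ (hV V₀ hd)
    refine ⟨?_, ?_, hnd⟩
    · by_contra! hlt
      exact hnd ((pow_dvd_pow ϖ (Nat.le_succ V₀)).trans (hs i j k V₀ (by omega)))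
    · by_contra! hlt
      have h1 : (ω : ℝ) ^ (r * i) ≤ W ^ e := by
        rw [← hpow]
        refine Real.rpow_le_rpow_of_exponent_ge ω.2.1 ω.2.2.le (mul_le_mul_of_nonneg_left ?_ hr0.le)
        exact_mod_cast hlt.le
      have h2 := mul_le_mul_of_nonneg_right (absVal_le_one η (x.coeff i j k)) hωi.le
      linarith
  refine ⟨⟨_, fun i j k h => (key i j k h).1⟩, fun k => ?_⟩
  refine ((Set.finite_Icc (-(c * V₀ + J : ℤ)) e).biUnion fun i _ =>
    (Set.finite_singleton i).prod (hT V₀ i k)).subset fun s hs => ?_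
  obtain ⟨h1, h2, h3⟩ := key s.1 s.2 k hs
  exact Set.mem_biUnion ⟨h1, h2⟩ ⟨rfl, h3⟩

end Coefficients

/-! ### The dagger algebra and its subrings of bounded elements -/

section Dagger

variable {𝔬 : Type*} [CommRing 𝔬] [IsDomain 𝔬] [IsDiscreteValuationRing 𝔬] {ϖ : 𝔬}

theorem exists_pow_dvd_and_not_pow_succ_dvd (hϖ : Irreducible ϖ) {a : 𝔬} (ha : a ≠ 0) :
    ∃ N, ϖ ^ N ∣ a ∧ ¬ ϖ ^ (N + 1) ∣ a :=
  (FiniteMultiplicity.of_not_isUnit hϖ.not_isUnit ha).exists_eq_pow_mul_and_not_dvd.elim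
    fun c hc => ⟨_, ⟨c, hc.1⟩, (FiniteMultiplicity.of_not_isUnit
      hϖ.not_isUnit ha).not_pow_dvd_of_multiplicity_lt (Nat.lt_succ_self _)⟩

variable [IsAdicComplete (maximalIdeal 𝔬) 𝔬]

theorem exists_adicSum (hϖ : Irreducible ϖ) (a : ℕ → 𝔬) :
    ∃ s, ∀ n, ϖ ^ n ∣ s - ∑ t ∈ Finset.range n, ϖ ^ t * a t := by
  have hc : ∀ {M N : ℕ}, M ≤ N → ∑ t ∈ Finset.range M, ϖ ^ t * a t ≡
      ∑ t ∈ Finset.range N, ϖ ^ t * a t [SMOD (maximalIdeal 𝔬 ^ M • ⊤ : Submodule 𝔬 𝔬)] := by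
    intro M N h
    rw [SModEq.comm, SModEq.sub_mem, smul_eq_mul, Ideal.mul_top, mem_maximalIdeal_pow_iff_dvd hϖ,
      ← Finset.sum_range_add_sum_Ico _ h, add_sub_cancel_left]
    exact Finset.dvd_sum fun t ht =>
      Dvd.dvd.mul_right (pow_dvd_pow ϖ (Finset.mem_Ico.1 ht).1) _
  obtain ⟨s, hs⟩ := IsPrecomplete.prec (I := maximalIdeal 𝔬) inferInstance hc
  refine ⟨s, fun n => ?_⟩
  have := hs n
  rwa [SModEq.comm, SModEq.sub_mem, smul_eq_mul, Ideal.mul_top,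
    mem_maximalIdeal_pow_iff_dvd hϖ] at this

/-- The sum of the series with terms `ϖᵗ aₜ`. -/
def adicSum (hϖ : Irreducible ϖ) (a : ℕ → 𝔬) : 𝔬 := (exists_adicSum hϖ a).choose

theorem pow_dvd_adicSum_sub (hϖ : Irreducible ϖ) (a : ℕ → 𝔬) (n : ℕ) :
    ϖ ^ n ∣ adicSum hϖ a - ∑ t ∈ Finset.range n, ϖ ^ t * a t :=
  (exists_adicSum hϖ a).choose_spec n

theorem adicSum_eq (hϖ : Irreducible ϖ) (a : ℕ → 𝔬) :
    adicSum hϖ a = a 0 + ϖ * adicSum hϖ fun t => a (t + 1) := by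
  refine sub_eq_zero.1 (eq_zero_of_forall_pow_dvd hϖ fun N => ?_)
  have h1 := pow_dvd_adicSum_sub hϖ a (N + 1)
  have h2 := mul_dvd_mul_left ϖ (pow_dvd_adicSum_sub hϖ (fun t => a (t + 1)) N)
  rw [← pow_succ'] at h2
  have h3 := (pow_dvd_pow ϖ (Nat.le_succ N)).trans (dvd_sub h1 h2)
  refine h3.trans (dvd_of_eq ?_)
  rw [Finset.sum_range_succ', mul_sub, Finset.mul_sum]
  simp only [pow_succ', mul_assoc, pow_zero, one_mul]
  ring

variable {m n : ℕ} (ω η : Set.Ioo (0 : ℝ) 1)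

variable {ω η} in
theorem dagger.isTConvergent (hϖ : Irreducible ϖ) (x : dagger 𝔬 ω η m n) :
    IsTConvergent ϖ x.1.coeff := by
  obtain ⟨r, -, hx⟩ := x.2
  exact hx.isTConvergent hϖ

variable {ω η} in
theorem dagger.exists_hasSlope (hϖ : Irreducible ϖ) (x : dagger 𝔬 ω η m n) :
    ∃ c J, HasSlope ϖ c J x.1.coeff := by
  obtain ⟨r, hr, hx⟩ := x.2
  exact hx.exists_hasSlope hϖ hr

/-- With the two preceding results this describes the dagger algebra by divisibility conditions on
coefficients; later elements are built this way, without Gauss norms. -/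
theorem dagger.exists_coeff_eq (hϖ : Irreducible ϖ) {c J : ℕ}
    {a : ℤ → (Fin m →₀ ℕ) → (Fin n →₀ ℕ) → 𝔬}
    (hs : HasSlope ϖ c J a) (hT : IsTConvergent ϖ a) :
    ∃ x : dagger 𝔬 ω η m n, x.1.coeff = a := by
  have hsm : ∀ j k, ∀ N : ℕ, ∃ M : ℤ, ∀ i < M, a i j k ∈ maximalIdeal 𝔬 ^ N := by
    intro j k N
    refine ⟨-(c * N + J : ℤ), fun i hi => ?_⟩
    rw [mem_maximalIdeal_pow_iff_dvd hϖ]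
    exact (pow_dvd_pow ϖ (Nat.le_succ N)).trans (hs i j k N (by omega))
  let x : Formal 𝔬 m n := fun k j => ⟨fun i => a i j k, hsm j k⟩
  have hx : x.coeff = a := rfl
  exact ⟨⟨x, exists_isConvergent hϖ (c := c) (J := J) (hx ▸ hs) (hx ▸ hT)⟩, hx⟩

variable {ω η} in
theorem dagger.ext_coeff {x y : dagger 𝔬 ω η m n}
    (h : ∀ i j k, x.1.coeff i j k = y.1.coeff i j k) : x = y :=
  Subtype.ext (Formal.ext_coeff h)

theorem monomial_mem_dagger (d : ℤ) (a : 𝔬) : Formal.monomial m n d a ∈ dagger 𝔬 ω η m n := by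
  classical
  obtain ⟨ϖ, hϖ⟩ := IsDiscreteValuationRing.exists_irreducible 𝔬
  have hcoeff : ∀ i j k, (Formal.monomial m n d a).coeff i j k =
      if i = d ∧ j = 0 ∧ k = 0 then a else 0 := by
    intro i j k
    rw [← mul_one (Formal.monomial m n d a), Formal.coeff_monomial_mul,
      ← map_one (algebraMap 𝔬 (Formal 𝔬 m n)), Formal.coeff_algebraMap]
    simp [sub_eq_zero]
  refine exists_isConvergent hϖ (c := 0) (J := d.natAbs) (fun i j k N hi => ?_) fun N i k => ?_
  · rw [hcoeff, if_neg (by omega)]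
    exact dvd_zero _
  · refine (Set.finite_singleton (0 : Fin m →₀ ℕ)).subset fun j hj => ?_
    by_contra hne
    refine hj ?_
    rw [hcoeff, if_neg fun h => hne h.2.1]
    exact dvd_zero _

/-- The unit `π` of the dagger algebra. -/
def daggerParam (𝔬 : Type*) [CommRing 𝔬] [IsDomain 𝔬] [IsDiscreteValuationRing 𝔬]
    [IsAdicComplete (maximalIdeal 𝔬) 𝔬] (ω η : Set.Ioo (0 : ℝ) 1) (m n : ℕ) :
    (dagger 𝔬 ω η m n)ˣ where
  val := ⟨Formal.monomial m n 1 1, monomial_mem_dagger ω η 1 1⟩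
  inv := ⟨Formal.monomial m n (-1) 1, monomial_mem_dagger ω η (-1) 1⟩
  val_inv := Subtype.ext (by
    change Formal.monomial m n 1 1 * Formal.monomial m n (-1) 1 = 1
    rw [Formal.monomial_mul, mul_one, add_neg_cancel, Formal.monomial_one])
  inv_val := Subtype.ext (by
    change Formal.monomial m n (-1) 1 * Formal.monomial m n 1 1 = 1
    rw [Formal.monomial_mul, mul_one, neg_add_cancel, Formal.monomial_one])

variable {ω η}

theorem coeff_param_pow_mul (c : ℕ) (x : dagger 𝔬 ω η m n) (i j k) :
    ((daggerParam 𝔬 ω η m n : dagger 𝔬 ω η m n) ^ c * x).1.coeff i j k =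
      x.1.coeff (i - c) j k := by
  induction c generalizing i with
  | zero => simp
  | succ c ih =>
    rw [pow_succ', mul_assoc]
    refine (Formal.coeff_monomial_mul 1 1 _ i j k).trans ?_
    rw [one_mul, ih, sub_sub, add_comm, Nat.cast_succ]

theorem coeff_algebraMap_mul (a : 𝔬) (x : dagger 𝔬 ω η m n) (i j k) :
    (algebraMap 𝔬 (dagger 𝔬 ω η m n) a * x).1.coeff i j k = a * x.1.coeff i j k := by
  change (algebraMap 𝔬 (Formal 𝔬 m n) a * x.1).coeff i j k = _
  rw [Formal.algebraMap_eq_monomial, Formal.coeff_monomial_mul, sub_zero]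

theorem coeff_slope_mul (a : 𝔬) (c : ℕ) (x : dagger 𝔬 ω η m n) (i j k) :
    (slope (algebraMap 𝔬 (dagger 𝔬 ω η m n) a) (daggerParam 𝔬 ω η m n) c * x).1.coeff i j k =
      a * x.1.coeff (i + c) j k := by
  have h : x = (daggerParam 𝔬 ω η m n : dagger 𝔬 ω η m n) ^ c *
      (↑((daggerParam 𝔬 ω η m n)⁻¹ ^ c) * x) := by
    rw [← mul_assoc, ← Units.val_pow_eq_pow_val, ← Units.val_mul, inv_pow, mul_inv_cancel,
      Units.val_one, one_mul]
  conv_rhs => rw [h, coeff_param_pow_mul, add_sub_cancel_right]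
  rw [slope, mul_assoc, coeff_algebraMap_mul]

theorem hasSlope_mul (hϖ : Irreducible ϖ) {c : ℕ} {x y : Formal 𝔬 m n}
    (hx : HasSlope ϖ c 0 x.coeff) (hy : HasSlope ϖ c 0 y.coeff) :
    HasSlope ϖ c 0 (x * y).coeff := by
  intro i j k N hi
  -- Any absolute value serves: it only extracts, from the convergent sum, one product of valuation
  -- at most `N`. Adding `i₁ + cN₁ ≥ 0` and `i₂ + cN₂ ≥ 0` gives the contradiction.
  let η : Set.Ioo (0 : ℝ) 1 := ⟨1 / 2, by norm_num, by norm_num⟩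
  by_contra hn
  rw [← absVal_le_pow_iff hϖ η, not_le] at hn
  have hpos : 0 < absVal η ((x * y).coeff i j k) := (pow_pos η.2.1 _).trans hn
  obtain ⟨i₁, i₂, hii, p, hp, q, hq, hle⟩ := Formal.exists_le_mul η x y i j k hpos le_rfl
  rw [← absVal_mul] at hle
  replace hn := hn.trans_le hle
  rw [← not_le, absVal_le_pow_iff hϖ] at hn
  have h0 : x.coeff i₁ p.1 q.1 * y.coeff i₂ p.2 q.2 ≠ 0 := fun h => hn (h ▸ dvd_zero _)
  obtain ⟨N₁, h1, h1'⟩ := exists_pow_dvd_and_not_pow_succ_dvd hϖ (left_ne_zero_of_mul h0)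
  obtain ⟨N₂, h2, h2'⟩ := exists_pow_dvd_and_not_pow_succ_dvd hϖ (right_ne_zero_of_mul h0)
  have h3 : N₁ + N₂ < N + 1 := by
    by_contra! h
    exact hn ((pow_dvd_pow ϖ h).trans (pow_add ϖ N₁ N₂ ▸ mul_dvd_mul h1 h2))
  have h4 : 0 ≤ i₁ + c * N₁ := by
    by_contra! h
    exact h1' (hx _ _ _ _ (by push_cast; omega))
  have h5 : 0 ≤ i₂ + c * N₂ := by
    by_contra! h
    exact h2' (hy _ _ _ _ (by push_cast; omega))
  have h6 : (c : ℤ) * (N₁ + N₂) ≤ c * N :=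
    mul_le_mul_of_nonneg_left (by omega) (by positivity)
  rw [mul_add] at h6
  push_cast at hi
  omega

theorem hasSlope_monomial {d : ℤ} (hd : 0 ≤ d) (a : 𝔬) (c : ℕ) :
    HasSlope ϖ c 0 (Formal.monomial m n d a).coeff := by
  classical
  intro i j k N hi
  rw [← mul_one (Formal.monomial m n d a), Formal.coeff_monomial_mul,
      ← map_one (algebraMap 𝔬 (Formal 𝔬 m n)), Formal.coeff_algebraMap, if_neg, mul_zero]
  · exact dvd_zero _
  · have : (0 : ℤ) ≤ c * N := by positivity
    push_cast at hi
    omega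

variable (ω η m n) in
/-- The elements of the dagger algebra bounded by one where `|ϖ| ≤ |π|ᶜ`. -/
def slopeSubring (hϖ : Irreducible ϖ) (c : ℕ) : Subring (dagger 𝔬 ω η m n) where
  carrier := {x | HasSlope ϖ c 0 x.1.coeff}
  mul_mem' hx hy := hasSlope_mul hϖ hx hy
  one_mem' := by
    change HasSlope ϖ c 0 (1 : Formal 𝔬 m n).coeff
    rw [← Formal.monomial_one]
    exact hasSlope_monomial le_rfl 1 c
  add_mem' hx hy := fun i j k N hi => dvd_add (hx i j k N hi) (hy i j k N hi)
  zero_mem' := fun i j k N hi => dvd_zero _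
  neg_mem' hx := fun i j k N hi => (dvd_neg (α := 𝔬)).2 (hx i j k N hi)

theorem mem_slopeSubring {hϖ : Irreducible ϖ} {c : ℕ} {x : dagger 𝔬 ω η m n} :
    x ∈ slopeSubring m n ω η hϖ c ↔ HasSlope ϖ c 0 x.1.coeff := Iff.rfl

theorem hasSlope_zero_iff (hϖ : Irreducible ϖ) {a : ℤ → (Fin m →₀ ℕ) → (Fin n →₀ ℕ) → 𝔬} :
    HasSlope ϖ 0 0 a ↔ ∀ i < 0, ∀ j k, a i j k = 0 := by
  refine ⟨fun h i hi j k => eq_zero_of_forall_pow_dvd hϖ fun N => ?_, fun h i j k N hi => ?_⟩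
  · exact (pow_dvd_pow ϖ (Nat.le_succ N)).trans (h i j k N (by simpa using hi))
  · rw [h i (by simpa using hi)]
    exact dvd_zero _

theorem dagger.exists_eq_algebraMap_mul (hϖ : Irreducible ϖ) {x : dagger 𝔬 ω η m n}
    (hx : ∀ i j k, ϖ ∣ x.1.coeff i j k) :
    ∃ y, x = algebraMap 𝔬 (dagger 𝔬 ω η m n) ϖ * y := by
  choose a ha using hx
  obtain ⟨c, J, hs⟩ := dagger.exists_hasSlope hϖ x
  -- Dividing by `ϖ` lowers valuations by one, which costs `c` in the constant `J`.
  obtain ⟨y, hy⟩ := dagger.exists_coeff_eq ω η hϖ (c := c) (J := J + c) (a := a)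
    (fun i j k N hi => by
      have h1 := hs i j k (N + 1) (by push_cast at hi ⊢; linarith)
      rw [ha, pow_succ'] at h1
      exact (mul_dvd_mul_iff_left hϖ.ne_zero).1 h1)
    (fun N i k => (dagger.isTConvergent hϖ x (N + 1) i k).subset fun j hj h1 => hj (by
      rw [ha, pow_succ'] at h1
      exact (mul_dvd_mul_iff_left hϖ.ne_zero).1 h1))
  refine ⟨y, dagger.ext_coeff fun i j k => ?_⟩
  rw [coeff_algebraMap_mul, hy, ha]

theorem dvd_coeff_of_dvd {a : 𝔬} {x : dagger 𝔬 ω η m n}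
    (hx : algebraMap 𝔬 (dagger 𝔬 ω η m n) a ∣ x) (i j k) : a ∣ x.1.coeff i j k := by
  obtain ⟨y, rfl⟩ := hx
  rw [coeff_algebraMap_mul]
  exact dvd_mul_right _ _

end Dagger

/-! ### Verification of the overconvergence axioms -/

section Fields

variable {𝔬 : Type*} [CommRing 𝔬] [IsDomain 𝔬] [IsDiscreteValuationRing 𝔬] {ϖ : 𝔬}
  [IsAdicComplete (maximalIdeal 𝔬) 𝔬] {m n : ℕ} {ω η : Set.Ioo (0 : ℝ) 1}

theorem slopeSubring_mono (hϖ : Irreducible ϖ) : Monotone (slopeSubring m n ω η hϖ) :=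
  fun _ _ hc _ hx => HasSlope.mono hc le_rfl hx

theorem algebraMap_mem_slopeSubring (hϖ : Irreducible ϖ) (a : 𝔬) (c : ℕ) :
    algebraMap 𝔬 (dagger 𝔬 ω η m n) a ∈ slopeSubring m n ω η hϖ c := by
  rw [mem_slopeSubring]
  change HasSlope ϖ c 0 (algebraMap 𝔬 (Formal 𝔬 m n) a).coeff
  rw [Formal.algebraMap_eq_monomial]
  exact hasSlope_monomial le_rfl a c

theorem param_mem_slopeSubring (hϖ : Irreducible ϖ) (c : ℕ) :
    (daggerParam 𝔬 ω η m n : dagger 𝔬 ω η m n) ∈ slopeSubring m n ω η hϖ c :=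
  mem_slopeSubring.2 (hasSlope_monomial zero_le_one 1 c)

theorem hasSlope_slope_mul {c : ℕ} {x : dagger 𝔬 ω η m n}
    (hx : HasSlope ϖ c 0 x.1.coeff) : HasSlope ϖ c 0
      (slope (algebraMap 𝔬 (dagger 𝔬 ω η m n) ϖ) (daggerParam 𝔬 ω η m n) c * x).1.coeff := by
  intro i j k N hi
  rw [coeff_slope_mul, pow_succ']
  refine mul_dvd_mul_left ϖ ?_
  rcases N with _ | N
  · rw [pow_zero]
    exact one_dvd _
  · exact hx _ _ _ _ (by push_cast at hi ⊢; linarith)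

/-- Terms with `i < 0` have coefficients divisible by `ϖ` (the case `N = 0` of the slope condition).
Dividing them by `ϖπ⁻ᶜ` lowers the valuation by one and raises the exponent by `c`, which preserves
the slope condition. -/
theorem exists_eq_add_slope_mul (hϖ : Irreducible ϖ) {c : ℕ} {x : dagger 𝔬 ω η m n}
    (hx : x ∈ slopeSubring m n ω η hϖ c) :
    ∃ b ∈ slopeSubring m n ω η hϖ 0, ∃ y ∈ slopeSubring m n ω η hϖ c,
      x = b + slope (algebraMap 𝔬 (dagger 𝔬 ω η m n) ϖ) (daggerParam 𝔬 ω η m n) c * y := by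
  have hT := dagger.isTConvergent hϖ x
  have hdvd : ∀ a : 𝔬, ∃ b, ϖ ∣ a → a = ϖ * b := fun a => by
    by_cases h : ϖ ∣ a
    · obtain ⟨b, hb⟩ := h
      exact ⟨b, fun _ => hb⟩
    · exact ⟨0, fun h' => absurd h' h⟩
  choose δ hδ using hdvd
  have hx0 : ∀ i < 0, ∀ j k, ϖ ∣ x.1.coeff i j k := fun i hi j k => by
    simpa using hx i j k 0 (by simpa using hi)
  have hs1 : HasSlope ϖ 0 0 fun i j k => if 0 ≤ i then x.1.coeff i j k else 0 := by
    rw [hasSlope_zero_iff hϖ]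
    intro i hi j k
    exact if_neg (not_le.2 hi)
  have hT1 : IsTConvergent ϖ fun i j k => if 0 ≤ i then x.1.coeff i j k else 0 := by
    refine fun N i k => (hT N i k).subset fun j hj h => hj ?_
    dsimp only
    split_ifs
    exacts [h, dvd_zero _]
  have hs2 : HasSlope ϖ c 0 fun i j k =>
      if i - c < 0 then δ (x.1.coeff (i - c) j k) else 0 := by
    intro i j k N hi
    dsimp only
    split_ifs with h
    · have h1 := hx (i - c) j k (N + 1) (by push_cast at hi ⊢; linarith)
      rw [hδ _ (hx0 _ h j k), pow_succ'] at h1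
      exact (mul_dvd_mul_iff_left hϖ.ne_zero).1 h1
    · exact dvd_zero _
  have hT2 : IsTConvergent ϖ fun i j k =>
      if i - c < 0 then δ (x.1.coeff (i - c) j k) else 0 := by
    refine fun N i k => (hT (N + 1) (i - c) k).subset fun j hj h => hj ?_
    dsimp only
    split_ifs with hi
    · rw [hδ _ (hx0 _ hi j k), pow_succ'] at h
      exact (mul_dvd_mul_iff_left hϖ.ne_zero).1 h
    · exact dvd_zero _
  obtain ⟨b, hb⟩ := dagger.exists_coeff_eq ω η hϖ hs1 hT1
  obtain ⟨y, hy⟩ := dagger.exists_coeff_eq ω η hϖ hs2 hT2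
  refine ⟨b, mem_slopeSubring.2 (hb ▸ hs1), y, mem_slopeSubring.2 (hy ▸ hs2),
    dagger.ext_coeff fun i j k => ?_⟩
  refine Eq.trans ?_ (Formal.coeff_add _ _ _ _ _).symm
  rw [coeff_slope_mul, hb, hy]
  dsimp only
  rw [add_sub_cancel_right]
  by_cases h : 0 ≤ i
  · rw [if_pos h, if_neg (not_lt.2 h), mul_zero, add_zero]
  · rw [if_neg h, if_pos (not_le.1 h), zero_add]
    exact hδ _ (hx0 i (not_le.1 h) j k)

/-- The `y s` are the successive tails. In `(ϖπ⁻ᶜ)ᵗ b` the coefficient of `πⁱ` is `ϖᵗ` times that of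
`π^{i+ct}` in `b`, so each slope bound persists, and modulo `ϖᴺ` only `t < N` matter. -/
theorem exists_slope_adicSum (hϖ : Irreducible ϖ) {c : ℕ} (b : ℕ → dagger 𝔬 ω η m n)
    (hb : ∀ t, b t ∈ slopeSubring m n ω η hϖ c) :
    ∃ y : ℕ → dagger 𝔬 ω η m n, (∀ s, y s ∈ slopeSubring m n ω η hϖ c) ∧ ∀ s, y s = b s +
      slope (algebraMap 𝔬 (dagger 𝔬 ω η m n) ϖ) (daggerParam 𝔬 ω η m n) c * y (s + 1) := by
  have hsum : ∀ (N : ℕ) (a : ℕ → 𝔬), (∀ t < N, ϖ ^ N ∣ ϖ ^ t * a t) → ϖ ^ N ∣ adicSum hϖ a := by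
    intro N a ha
    refine (dvd_sub_left ?_).1 (pow_dvd_adicSum_sub hϖ a N)
    exact Finset.dvd_sum fun t ht => ha t (Finset.mem_range.1 ht)
  have hs : ∀ s, HasSlope ϖ c 0 fun i j k =>
      adicSum hϖ fun t => (b (s + t)).1.coeff (i + c * t) j k := by
    intro s i j k N hi
    refine hsum _ _ fun t ht => ?_
    have h1 : N + 1 = t + (N - t + 1) := by omega
    rw [h1, pow_add]
    refine mul_dvd_mul_left _ (hb _ _ _ _ _ ?_)
    rw [Nat.cast_sub (by omega)]
    linarith
  have hT : ∀ s, IsTConvergent ϖ fun i j k =>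
      adicSum hϖ fun t => (b (s + t)).1.coeff (i + c * t) j k := by
    intro s N i k
    refine ((Set.finite_lt_nat N).biUnion fun t _ =>
      dagger.isTConvergent hϖ (b (s + t)) N (i + c * t) k).subset fun j hj => ?_
    by_contra hn
    refine hj (hsum _ _ fun t ht => Dvd.dvd.mul_left ?_ _)
    by_contra hn'
    exact hn (Set.mem_biUnion ht hn')
  choose y hy using fun s => dagger.exists_coeff_eq ω η hϖ (hs s) (hT s)
  refine ⟨y, fun s => mem_slopeSubring.2 ((hy s).symm ▸ hs s),
    fun s => dagger.ext_coeff fun i j k => ?_⟩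
  refine Eq.trans ?_ (Formal.coeff_add _ _ _ _ _).symm
  rw [coeff_slope_mul, hy, hy]
  dsimp only
  rw [adicSum_eq]
  simp only [Nat.cast_zero, mul_zero, add_zero, Nat.cast_add, Nat.cast_one, mul_add, mul_one,
    add_assoc, add_comm, add_left_comm]

theorem isOverconvergent_dagger (hϖ : Irreducible ϖ)
    (hfg : ∀ J : Ideal (slopeSubring m n ω η hϖ 0),
      ⟨algebraMap 𝔬 _ ϖ, algebraMap_mem_slopeSubring hϖ ϖ 0⟩ ∈ J → J.FG) :
    IsOverconvergent (algebraMap 𝔬 (dagger 𝔬 ω η m n) ϖ) (daggerParam 𝔬 ω η m n)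
      (slopeSubring m n ω η hϖ) where
  mono := slopeSubring_mono hϖ
  uniformizer_mem := algebraMap_mem_slopeSubring hϖ ϖ 0
  param_mem := param_mem_slopeSubring hϖ 0
  slope_mem c := by
    rw [← mul_one (slope _ _ c)]
    exact mem_slopeSubring.2 (hasSlope_slope_mul (slopeSubring m n ω η hϖ c).one_mem)
  exists_eq_add c x hx := exists_eq_add_slope_mul hϖ hx
  exists_sum c b hb := by
    obtain ⟨y, hy, hyb⟩ := exists_slope_adicSum hϖ b hb
    refine ⟨y 0, hy 0, fun N => ⟨y N, hy N, ?_⟩⟩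
    induction N with
    | zero => simp
    | succ N ih =>
      rw [Finset.sum_range_succ]
      conv_lhs => rw [ih, hyb N]
      ring
  exists_mem x := by
    obtain ⟨c, J, hx⟩ := dagger.exists_hasSlope hϖ x
    refine ⟨max c J, fun i j k N hi => ?_⟩
    rw [coeff_param_pow_mul]
    refine hx.mono (le_max_left c J) (le_max_right c J) _ _ _ _ ?_
    push_cast at hi ⊢
    linarith
  separated x hx := dagger.ext_coeff fun i j k => eq_zero_of_forall_pow_dvd hϖ fun N =>
    dvd_coeff_of_dvd (by rw [map_pow]; exact hx N) i j k
  exists_of_dvd b hb := by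
    rintro ⟨y, rfl⟩
    refine ⟨y, ?_, rfl⟩
    rw [mem_slopeSubring, hasSlope_zero_iff hϖ] at hb ⊢
    intro i hi j k
    have h := hb i hi j k
    rw [coeff_algebraMap_mul] at h
    exact (mul_eq_zero.1 h).resolve_left hϖ.ne_zero
  fg_of_mem := hfg

end Fields

/-! ### Finiteness over `q`-th powers -/

section Frobenius

/-- The ring `R` is spanned by finitely many elements over its `q`-th powers. -/
def FrobeniusSpans (q : ℕ) (R : Type*) [CommRing R] : Prop :=
  ∃ (r : ℕ) (ε : Fin r → R), ∀ x, ∃ d : Fin r → R, x = ∑ i, d i ^ q * ε i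

theorem FrobeniusSpans.of_fintype {q : ℕ} {R ι : Type*} [CommRing R] [Fintype ι] (ε : ι → R)
    (h : ∀ x, ∃ d : ι → R, x = ∑ i, d i ^ q * ε i) : FrobeniusSpans q R := by
  refine ⟨_, ε ∘ (Fintype.equivFin ι).symm, fun x => ?_⟩
  obtain ⟨d, rfl⟩ := h x
  exact ⟨d ∘ (Fintype.equivFin ι).symm,
    ((Fintype.equivFin ι).symm.sum_comp fun i => d i ^ q * ε i).symm⟩

theorem FrobeniusSpans.of_surjective_pow {q : ℕ} {R : Type*} [CommRing R]
    (h : Function.Surjective fun x : R => x ^ q) : FrobeniusSpans q R :=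
  .of_fintype (fun _ : Unit => 1) fun x => by
    obtain ⟨y, rfl⟩ := h x
    exact ⟨fun _ => y, by simp⟩

theorem FrobeniusSpans.of_surjective {q : ℕ} {R R' : Type*} [CommRing R] [CommRing R']
    (hR : FrobeniusSpans q R) (f : R →+* R') (hf : Function.Surjective f) :
    FrobeniusSpans q R' := by
  obtain ⟨r, ε, h⟩ := hR
  refine ⟨r, f ∘ ε, fun x => ?_⟩
  obtain ⟨x, rfl⟩ := hf x
  obtain ⟨d, hd⟩ := h x
  exact ⟨f ∘ d, by
    conv_lhs => rw [hd]
    simp⟩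

/-- Lifting generators and coefficients leaves an error in the kernel, hence in `(t)`. -/
theorem FrobeniusSpans.exists_eq_add_mul {q : ℕ} {R R' : Type*} [CommRing R] [CommRing R']
    (hR' : FrobeniusSpans q R') (f : R →+* R') (hf : Function.Surjective f) {t : R}
    (ht : ∀ x, f x = 0 → t ∣ x) :
    ∃ (r : ℕ) (ε : Fin r → R), ∀ x, ∃ (d : Fin r → R) (d' : R),
      x = ∑ i, d i ^ q * ε i + t * d' := by
  obtain ⟨r, ε, h⟩ := hR'
  choose ε' hε' using fun i => hf (ε i)
  refine ⟨r, ε', fun x => ?_⟩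
  obtain ⟨d, hd⟩ := h (f x)
  choose d' hd' using fun i => hf (d i)
  obtain ⟨y, hy⟩ := ht (x - ∑ i, d' i ^ q * ε' i) (by simp [hd, hd', hε'])
  exact ⟨d', y, sub_eq_iff_eq_add'.1 hy⟩

theorem eq_of_smul_add_eq {σ : Type*} {q : ℕ} {u u' t t' : σ →₀ ℕ}
    (ht : ∀ l, t l < q) (ht' : ∀ l, t' l < q) (h : q • u + t = q • u' + t') : t = t' := by
  ext l
  have h1 := DFunLike.congr_fun h l
  simp only [Finsupp.add_apply, Finsupp.smul_apply, smul_eq_mul] at h1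
  have h2 := congrArg (· % q) h1
  simpa [Nat.mul_add_mod, Nat.mod_eq_of_lt, ht l, ht' l] using h2

variable {σ R : Type*} [CommRing R] {p : ℕ} [Fact p.Prime] [CharP R p]

/-- The multi-exponents with entries smaller than `q`. -/
def digit [Finite σ] {q : ℕ} (t : σ → Fin q) : σ →₀ ℕ :=
  Finsupp.equivFunOnFinite.symm fun l => (t l : ℕ)

theorem exists_eq_smul_add_digit [Finite σ] {q : ℕ} (hq : 0 < q) (e : σ →₀ ℕ) :
    ∃ (u : σ →₀ ℕ) (t : σ → Fin q), e = q • u + digit t := by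
  refine ⟨Finsupp.equivFunOnFinite.symm fun l => e l / q, fun l => ⟨e l % q, Nat.mod_lt _ hq⟩, ?_⟩
  ext l
  simp [digit, Nat.div_add_mod]

theorem digit_injective [Finite σ] {q : ℕ} :
    Function.Injective (digit : (σ → Fin q) → σ →₀ ℕ) :=
  fun _ _ h => funext fun l => Fin.ext (DFunLike.congr_fun h l)

theorem FrobeniusSpans.mvPolynomial [Fintype σ] {a : ℕ} (h : FrobeniusSpans (p ^ a) R) :
    FrobeniusSpans (p ^ a) (MvPolynomial σ R) := by
  classical
  obtain ⟨r, ε, h⟩ := h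
  refine .of_fintype (ι := Fin r × (σ → Fin (p ^ a)))
    (fun i => MvPolynomial.monomial (digit i.2) (ε i.1)) fun f => ?_
  induction f using MvPolynomial.induction_on' with
  | monomial e c =>
    obtain ⟨u, t, rfl⟩ := exists_eq_smul_add_digit
      (Nat.pow_pos (n := a) (Fact.out : p.Prime).pos) e
    obtain ⟨d, rfl⟩ := h c
    refine ⟨fun i => if i.2 = t then MvPolynomial.monomial u (d i.1) else 0, ?_⟩
    rw [Fintype.sum_prod_type, map_sum]
    refine Finset.sum_congr rfl fun i _ => ?_
    rw [Finset.sum_eq_single t]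
    · simp only [if_true]
      rw [MvPolynomial.monomial_pow, MvPolynomial.monomial_mul]
    · intro t' _ ht'
      simp [ht', (Fact.out : p.Prime).ne_zero]
    · simp
  | add f g hf hg =>
    obtain ⟨d, hd⟩ := hf
    obtain ⟨d', hd'⟩ := hg
    refine ⟨d + d', ?_⟩
    conv_lhs => rw [hd, hd', ← Finset.sum_add_distrib]
    refine Finset.sum_congr rfl fun i _ => ?_
    rw [Pi.add_apply, add_pow_char_pow, add_mul]

open scoped Classical in
-- In characteristic `p` the `pᵃ`-th power raises coefficients to that power and multiplies
-- exponents by `pᵃ`; distinct digits thus contribute to distinct residue classes of exponents.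
theorem coeff_pow_mul_monomial [Finite σ] {a : ℕ} (f : MvPowerSeries σ R) (c : R) (u : σ →₀ ℕ)
    (t t' : σ → Fin (p ^ a)) :
    MvPowerSeries.coeff (p ^ a • u + digit t) (f ^ p ^ a * MvPowerSeries.monomial (digit t') c) =
      if t' = t then MvPowerSeries.coeff u f ^ p ^ a * c else 0 := by
  have hp : p ≠ 0 := (Fact.out : p.Prime).ne_zero
  rw [MvPowerSeries.coeff_mul_monomial,
    ← MvPowerSeries.map_iterateFrobenius_expand (p := p) (hp := hp), MvPowerSeries.coeff_map]
  by_cases ht : t' = t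
  · rw [if_pos ht, ht, if_pos le_add_self, add_tsub_cancel_right,
      MvPowerSeries.coeff_expand_smul, iterateFrobenius_def]
  · rw [if_neg ht]
    split_ifs with hle
    · have hex : ∃ l, ¬ p ^ a ∣ (p ^ a • u + digit t - digit t') l := by
        by_contra! hall
        choose v hv using hall
        refine ht (digit_injective ?_)
        refine eq_of_smul_add_eq (q := p ^ a) (u := Finsupp.equivFunOnFinite.symm v) (u' := u)
          (fun l => (t' l).2) (fun l => (t l).2) ?_
        rw [← tsub_add_cancel_of_le hle]
        congr 1
        ext l
        exact (hv l).symm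
      obtain ⟨l, hl⟩ := hex
      rw [MvPowerSeries.coeff_expand_of_not_dvd _ _ _ hl, map_zero, zero_mul]
    · rfl

/-- Sort the exponents by their residue modulo `pᵃ` and decompose each coefficient separately; no
compatibility between the choices is needed. -/
theorem FrobeniusSpans.mvPowerSeries [Fintype σ] {a : ℕ} (h : FrobeniusSpans (p ^ a) R) :
    FrobeniusSpans (p ^ a) (MvPowerSeries σ R) := by
  classical
  obtain ⟨r, ε, h⟩ := h
  choose d hd using h
  refine .of_fintype (ι := Fin r × (σ → Fin (p ^ a)))
    (fun i => MvPowerSeries.monomial (digit i.2) (ε i.1)) fun f => ?_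
  let g : Fin r × (σ → Fin (p ^ a)) → MvPowerSeries σ R :=
    fun i u => d (MvPowerSeries.coeff (p ^ a • u + digit i.2) f) i.1
  have hg : ∀ i u, MvPowerSeries.coeff u (g i) =
    d (MvPowerSeries.coeff (p ^ a • u + digit i.2) f) i.1 := fun _ _ => rfl
  refine ⟨g, ?_⟩
  ext e
  obtain ⟨u, t, rfl⟩ := exists_eq_smul_add_digit
      (Nat.pow_pos (n := a) (Fact.out : p.Prime).pos) e
  rw [map_sum, Fintype.sum_prod_type]
  simp only [coeff_pow_mul_monomial, hg]
  conv_lhs => rw [hd (MvPowerSeries.coeff _ f)]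
  refine Finset.sum_congr rfl fun i _ => ?_
  rw [Finset.sum_ite_eq' Finset.univ t, if_pos (Finset.mem_univ t)]

end Frobenius

/-! ### Exchanging two sets of variables -/

section Swap

variable {σ τ R : Type*} [CommRing R]

/-- Exchanging the order of two sets of variables. -/
def swapFun (f : MvPowerSeries σ (MvPowerSeries τ R)) : MvPowerSeries τ (MvPowerSeries σ R) :=
  fun t s => MvPowerSeries.coeff t (MvPowerSeries.coeff s f)

theorem coeff_coeff_swapFun (f : MvPowerSeries σ (MvPowerSeries τ R)) (s t) :
    MvPowerSeries.coeff s (MvPowerSeries.coeff t (swapFun f)) =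
      MvPowerSeries.coeff t (MvPowerSeries.coeff s f) := rfl

/-- Exchanging the order of two sets of variables, as a ring homomorphism. -/
def swapSeries : MvPowerSeries σ (MvPowerSeries τ R) →+* MvPowerSeries τ (MvPowerSeries σ R) where
  toFun := swapFun
  map_zero' := rfl
  map_add' _ _ := rfl
  map_one' := by
    classical
    ext t s
    rw [coeff_coeff_swapFun, MvPowerSeries.coeff_one, MvPowerSeries.coeff_one]
    split_ifs <;> simp_all [MvPowerSeries.coeff_one]
  map_mul' f g := by
    classical
    ext t s
    rw [coeff_coeff_swapFun, MvPowerSeries.coeff_mul, MvPowerSeries.coeff_mul, map_sum, map_sum]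
    simp only [MvPowerSeries.coeff_mul, coeff_coeff_swapFun]
    exact Finset.sum_comm

end Swap

/-! ### Reduction of `F 0` modulo the uniformizer -/

section Reduction

/-- The ring `k[T₁, …, Tₘ]⟦π⟧⟦U₁, …, Uₙ⟧`. -/
abbrev ReducedSeries (k : Type*) [CommRing k] (m n : ℕ) : Type _ :=
  MvPowerSeries (Fin n) (PowerSeries (MvPolynomial (Fin m) k))

variable {k : Type*} [CommRing k] {m n : ℕ}

/-- The embedding of `k[T₁, …, Tₘ]⟦π⟧` into the formal power series in `T` over `k((π))`. -/
def ReducedSeries.toLaurentAux (k : Type*) [CommRing k] (m : ℕ) :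
    PowerSeries (MvPolynomial (Fin m) k) →+* MvPowerSeries (Fin m) (LaurentSeries k) :=
  (MvPowerSeries.map (HahnSeries.ofPowerSeries ℤ k)).comp
    ((swapSeries (σ := Unit) (τ := Fin m)).comp
      (MvPowerSeries.map MvPolynomial.coeToMvPowerSeries.ringHom))

/-- The embedding of `k[T₁, …, Tₘ]⟦π⟧⟦U₁, …, Uₙ⟧` into the formal power series in `T` and `U`
over `k((π))`. -/
def ReducedSeries.toLaurent (k : Type*) [CommRing k] (m n : ℕ) : ReducedSeries k m n →+*
    MvPowerSeries (Fin n) (MvPowerSeries (Fin m) (LaurentSeries k)) :=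
  MvPowerSeries.map (toLaurentAux k m)

theorem ReducedSeries.coeff_toLaurent (f : ReducedSeries k m n) (i : ℤ) (j : Fin m →₀ ℕ)
    (l : Fin n →₀ ℕ) : HahnSeries.coeff
      (MvPowerSeries.coeff j (MvPowerSeries.coeff l (toLaurent k m n f))) i =
      if i < 0 then 0 else
        MvPolynomial.coeff j (PowerSeries.coeff i.natAbs (MvPowerSeries.coeff l f)) := by
  rw [toLaurent, MvPowerSeries.coeff_map, toLaurentAux, RingHom.comp_apply,
    MvPowerSeries.coeff_map]
  refine (PowerSeries.coeff_coe _ i).trans ?_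
  congr 1

variable {𝔬 : Type*} [CommRing 𝔬] [IsDomain 𝔬] [IsDiscreteValuationRing 𝔬] {ϖ : 𝔬}
  [IsAdicComplete (maximalIdeal 𝔬) 𝔬] {ω η : Set.Ioo (0 : ℝ) 1}

/-- Reduction of bilateral series. -/
def Bilateral.modHom (N : ℕ) : Bilateral 𝔬 →+* LaurentSeries (𝔬 ⧸ maximalIdeal 𝔬 ^ N) where
  toFun := Bilateral.mod N
  map_zero' := Bilateral.mod_zero N
  map_one' := Bilateral.mod_one N
  map_add' := Bilateral.mod_add N
  map_mul' := Bilateral.mod_mul N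

variable (m n ω η) in
/-- Reduction modulo `ϖ` of the integral elements of the dagger algebra. -/
def reduction (hϖ : Irreducible ϖ) : slopeSubring m n ω η hϖ 0 →+*
    MvPowerSeries (Fin n) (MvPowerSeries (Fin m) (LaurentSeries (𝔬 ⧸ maximalIdeal 𝔬 ^ 1))) :=
  (MvPowerSeries.map (MvPowerSeries.map (Bilateral.modHom 1))).comp
    ((dagger 𝔬 ω η m n).val.toRingHom.comp (slopeSubring m n ω η hϖ 0).subtype)

theorem coeff_reduction (hϖ : Irreducible ϖ) (x : slopeSubring m n ω η hϖ 0) (i : ℤ)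
    (j : Fin m →₀ ℕ) (l : Fin n →₀ ℕ) : HahnSeries.coeff
      (MvPowerSeries.coeff j (MvPowerSeries.coeff l (reduction m n ω η hϖ x))) i =
      Ideal.Quotient.mk _ (x.1.1.coeff i j l) := rfl

omit [IsAdicComplete (maximalIdeal 𝔬) 𝔬] in
theorem mk_eq_zero_iff_dvd (hϖ : Irreducible ϖ) (a : 𝔬) :
    Ideal.Quotient.mk (maximalIdeal 𝔬 ^ 1) a = 0 ↔ ϖ ∣ a := by
  rw [Ideal.Quotient.eq_zero_iff_mem, mem_maximalIdeal_pow_iff_dvd hϖ, pow_one]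

theorem dvd_of_reduction_eq_zero (hϖ : Irreducible ϖ) {x : slopeSubring m n ω η hϖ 0}
    (hx : reduction m n ω η hϖ x = 0) :
    (⟨algebraMap 𝔬 _ ϖ, algebraMap_mem_slopeSubring hϖ ϖ 0⟩ : slopeSubring m n ω η hϖ 0) ∣ x := by
  have h : ∀ i j l, ϖ ∣ x.1.1.coeff i j l := fun i j l => by
    rw [← mk_eq_zero_iff_dvd hϖ, ← coeff_reduction, hx]
    rfl
  obtain ⟨y, hy⟩ := dagger.exists_eq_algebraMap_mul hϖ h
  have hy0 : y ∈ slopeSubring m n ω η hϖ 0 := by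
    have hx0 := x.2
    rw [mem_slopeSubring, hasSlope_zero_iff hϖ] at hx0 ⊢
    intro i hi j l
    have h := hx0 i hi j l
    rw [hy, coeff_algebraMap_mul] at h
    exact (mul_eq_zero.1 h).resolve_left hϖ.ne_zero
  exact ⟨⟨y, hy0⟩, Subtype.ext hy⟩

/-- Both rings embed in formal series over `k((π))`. Convergence in `T` makes each coefficient of
`πⁱUˡ` a polynomial modulo `ϖ`, and `F 0` has no negative exponents. Noetherianity and Frobenius
spanning then descend to the range from the series ring. -/
theorem range_reduction (hϖ : Irreducible ϖ) :
    (reduction m n ω η hϖ).range = (ReducedSeries.toLaurent _ m n).range := by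
  classical
  ext f
  constructor
  · rintro ⟨x, rfl⟩
    have hfin : ∀ (i : ℕ) l, {j | Ideal.Quotient.mk (maximalIdeal 𝔬 ^ 1)
        (x.1.1.coeff i j l) ≠ 0}.Finite := fun i l =>
      (dagger.isTConvergent hϖ x.1 1 i l).subset fun j hj hd => hj
        ((mk_eq_zero_iff_dvd hϖ _).2 ((pow_one ϖ).symm.dvd.trans hd))
    let P : ℕ → (Fin n →₀ ℕ) → MvPolynomial (Fin m) (𝔬 ⧸ maximalIdeal 𝔬 ^ 1) := fun i l =>
      ∑ j ∈ (hfin i l).toFinset, MvPolynomial.monomial j (Ideal.Quotient.mk _ (x.1.1.coeff i j l))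
    have hP : ∀ i l j, MvPolynomial.coeff j (P i l) = Ideal.Quotient.mk _ (x.1.1.coeff i j l) := by
      intro i l j
      rw [MvPolynomial.coeff_sum]
      simp only [MvPolynomial.coeff_monomial]
      rw [Finset.sum_ite_eq']
      refine ite_eq_left_iff.2 fun h => ?_
      rw [Set.Finite.mem_toFinset] at h
      exact (not_not.1 h).symm
    let r : ReducedSeries (𝔬 ⧸ maximalIdeal 𝔬 ^ 1) m n := fun l => PowerSeries.mk fun i => P i l
    have hr : ∀ i l, PowerSeries.coeff i (MvPowerSeries.coeff l r) = P i l :=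
      fun i l => PowerSeries.coeff_mk i fun i => P i l
    refine ⟨r, ?_⟩
    ext l j i
    rw [ReducedSeries.coeff_toLaurent, coeff_reduction]
    split_ifs with hi
    · rw [(hasSlope_zero_iff hϖ).1 x.2 i hi, map_zero]
    · rw [hr, hP, Int.natAbs_of_nonneg (not_lt.1 hi)]
  · rintro ⟨r, rfl⟩
    -- The section must send `0` to `0`, so that lifts of polynomials in `T` keep finite support.
    have hσ : ∃ σ : 𝔬 ⧸ maximalIdeal 𝔬 ^ 1 → 𝔬, σ 0 = 0 ∧ ∀ a, Ideal.Quotient.mk _ (σ a) = a := by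
      choose σ hσ using Ideal.Quotient.mk_surjective (I := maximalIdeal 𝔬 ^ 1)
      refine ⟨fun a => if a = 0 then 0 else σ a, if_pos rfl, fun a => ?_⟩
      dsimp only
      split_ifs with h
      · rw [h, map_zero]
      · exact hσ a
    obtain ⟨σ, hσ0, hσ⟩ := hσ
    let a : ℤ → (Fin m →₀ ℕ) → (Fin n →₀ ℕ) → 𝔬 := fun i j l => if i < 0 then 0 else
      σ (MvPolynomial.coeff j (PowerSeries.coeff i.natAbs (MvPowerSeries.coeff l r)))
    have hs : HasSlope ϖ 0 0 a := (hasSlope_zero_iff hϖ).2 fun i hi j l => if_pos hi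
    have hT : IsTConvergent ϖ a := fun N i l => by
      refine (MvPolynomial.support
        (PowerSeries.coeff i.natAbs (MvPowerSeries.coeff l r))).finite_toSet.subset fun j hj => ?_
      by_contra hn
      refine hj ?_
      rw [Finset.mem_coe, MvPolynomial.notMem_support_iff] at hn
      simp only [a, hn, hσ0, ite_self, dvd_zero]
    obtain ⟨x, hx⟩ := dagger.exists_coeff_eq ω η hϖ hs hT
    refine ⟨⟨x, mem_slopeSubring.2 (hx ▸ hs)⟩, ?_⟩
    ext l j i
    rw [ReducedSeries.coeff_toLaurent, coeff_reduction, hx]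
    simp only [a]
    split_ifs
    · exact map_zero _
    · exact hσ _

end Reduction

/-- Lift generators of the image of `J` and add `t`, which generates the kernel up to multiples. -/
theorem fg_of_surjective_of_mem {R R' : Type*} [CommRing R] [CommRing R'] [IsNoetherianRing R']
    (f : R →+* R') (hf : Function.Surjective f) {t : R} (ht : ∀ x, f x = 0 → t ∣ x)
    {J : Ideal R} (htJ : t ∈ J) : J.FG := by
  classical
  obtain ⟨s, hs⟩ := (IsNoetherian.noetherian (J.map f) : (J.map f).FG)
  have h1 : ∀ b : s, ∃ c ∈ J, f c = b := fun b =>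
    (Ideal.mem_map_iff_of_surjective f hf).1 (hs ▸ Ideal.subset_span b.2)
  choose c hcJ hc using h1
  refine ⟨insert t (Finset.univ.image c), le_antisymm (Ideal.span_le.2 ?_) fun x hx => ?_⟩
  · intro x hx
    rcases Finset.mem_insert.1 hx with rfl | hx
    · exact htJ
    · obtain ⟨b, -, rfl⟩ := Finset.mem_image.1 hx
      exact hcJ b
  · have h2 : f x ∈ (Ideal.span (Set.range c)).map f := by
      have h3 : (Ideal.span (s : Set R')) ≤ (Ideal.span (Set.range c)).map f :=
        Ideal.span_le.2 fun b hb => by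
          have h4 := Ideal.mem_map_of_mem f (Ideal.subset_span ⟨⟨b, hb⟩, rfl⟩ :
            c ⟨b, hb⟩ ∈ Ideal.span (Set.range c))
          rwa [hc] at h4
      exact h3 (hs ▸ Ideal.mem_map_of_mem f hx : f x ∈ Submodule.span R' (s : Set R'))
    obtain ⟨y, hy, hyx⟩ := (Ideal.mem_map_iff_of_surjective f hf).1 h2
    obtain ⟨z, hz⟩ := ht (x - y) (by rw [map_sub, hyx, sub_self])
    rw [sub_eq_iff_eq_add'.1 hz]
    refine Ideal.add_mem _ (Ideal.span_mono ?_ hy)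
      (Ideal.mul_mem_right _ _ (Ideal.subset_span (by simp)))
    rintro _ ⟨b, rfl⟩
    simp

/-! ### The dagger algebra is overconvergent -/

section Main

variable {𝔬 : Type*} [CommRing 𝔬] [IsDomain 𝔬] [IsDiscreteValuationRing 𝔬] {ϖ : 𝔬}
  [IsAdicComplete (maximalIdeal 𝔬) 𝔬] {m n : ℕ} {ω η : Set.Ioo (0 : ℝ) 1}

theorem isNoetherianRing_range_reduction (hϖ : Irreducible ϖ) :
    IsNoetherianRing (reduction m n ω η hϖ).range := by
  rw [range_reduction]
  let e : 𝔬 ⧸ maximalIdeal 𝔬 ^ 1 ≃+* ResidueField 𝔬 := Ideal.quotEquivOfEq (pow_one _)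
  have : IsNoetherianRing (𝔬 ⧸ maximalIdeal 𝔬 ^ 1) := isNoetherianRing_of_ringEquiv _ e.symm
  exact isNoetherianRing_of_surjective _ _ _
    (ReducedSeries.toLaurent (𝔬 ⧸ maximalIdeal 𝔬 ^ 1) m n).rangeRestrict_surjective

theorem frobeniusSpans_range_reduction (hϖ : Irreducible ϖ) (p : ℕ) [Fact p.Prime]
    [CharP (ResidueField 𝔬) p] [PerfectField (ResidueField 𝔬)] (a : ℕ) :
    FrobeniusSpans (p ^ a) (reduction m n ω η hϖ).range := by
  rw [range_reduction]
  let e : 𝔬 ⧸ maximalIdeal 𝔬 ^ 1 ≃+* ResidueField 𝔬 := Ideal.quotEquivOfEq (pow_one _)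
  have : CharP (𝔬 ⧸ maximalIdeal 𝔬 ^ 1) p :=
    charP_of_injective_ringHom (f := e.symm.toRingHom) e.symm.injective p
  have : CharP (PowerSeries (MvPolynomial (Fin m) (𝔬 ⧸ maximalIdeal 𝔬 ^ 1))) p :=
    charP_of_injective_ringHom (f := PowerSeries.C) PowerSeries.C_injective p
  have : PerfectRing (ResidueField 𝔬) p := PerfectField.toPerfectRing p
  have h : FrobeniusSpans (p ^ a) (ResidueField 𝔬) :=
    .of_surjective_pow (bijective_iterateFrobenius (ResidueField 𝔬) p a).surjective
  have h1 := ((h.of_surjective e.symm.toRingHom e.symm.surjective).mvPolynomial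
    (p := p) (σ := Fin m)).mvPowerSeries (p := p) (σ := Unit)
  exact (h1.mvPowerSeries (p := p) (σ := Fin n)).of_surjective
    (ReducedSeries.toLaurent (𝔬 ⧸ maximalIdeal 𝔬 ^ 1) m n).rangeRestrict
    (RingHom.rangeRestrict_surjective _)

theorem dvd_of_rangeRestrict_eq_zero (hϖ : Irreducible ϖ) (x : slopeSubring m n ω η hϖ 0)
    (hx : (reduction m n ω η hϖ).rangeRestrict x = 0) :
    (⟨algebraMap 𝔬 _ ϖ, algebraMap_mem_slopeSubring hϖ ϖ 0⟩ : slopeSubring m n ω η hϖ 0) ∣ x :=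
  dvd_of_reduction_eq_zero hϖ (congrArg Subtype.val hx)

theorem dagger.isOverconvergent (hϖ : Irreducible ϖ) :
    IsOverconvergent (algebraMap 𝔬 (dagger 𝔬 ω η m n) ϖ) (daggerParam 𝔬 ω η m n)
      (slopeSubring m n ω η hϖ) :=
  isOverconvergent_dagger hϖ fun _ hJ =>
    have := isNoetherianRing_range_reduction (m := m) (n := n) (ω := ω) (η := η) hϖ
    fg_of_surjective_of_mem (reduction m n ω η hϖ).rangeRestrict
      (RingHom.rangeRestrict_surjective _) (dvd_of_rangeRestrict_eq_zero hϖ) hJ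

omit [IsAdicComplete (maximalIdeal 𝔬) 𝔬] in
-- `ϖ ∣ p` gives `g(ϖ) ∣ g(p) = p`, and `p` is associated to a power of `ϖ`.
theorem exists_dvd_pow_of_charZero (hϖ : Irreducible ϖ) [CharZero 𝔬] (p : ℕ) [Fact p.Prime]
    (hp : ϖ ∣ (p : 𝔬)) {S : Type*} [CommRing S] [Algebra 𝔬 S] (g : S →+* S) :
    ∃ N : ℕ, g (algebraMap 𝔬 S ϖ) ∣ algebraMap 𝔬 S ϖ ^ N := by
  have hp0 : (p : 𝔬) ≠ 0 := Nat.cast_ne_zero.2 (Fact.out : p.Prime).ne_zero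
  obtain ⟨N, hN⟩ := IsDiscreteValuationRing.associated_pow_irreducible hp0 hϖ
  have h1 : (p : S) ∣ algebraMap 𝔬 S ϖ ^ N := by
    have := map_dvd (algebraMap 𝔬 S) hN.dvd
    rwa [map_natCast, map_pow] at this
  have h2 := map_dvd (g.comp (algebraMap 𝔬 S)) hp
  rw [map_natCast] at h2
  exact ⟨N, h2.trans h1⟩

end Main

end

end DaggerLift

theorem corollaryC {𝔬 : Type*} [CommRing 𝔬] [IsDomain 𝔬] [IsDiscreteValuationRing 𝔬]
    [IsAdicComplete (IsLocalRing.maximalIdeal 𝔬) 𝔬]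
    (p : ℕ) [Fact p.Prime] [CharP (IsLocalRing.ResidueField 𝔬) p]
    [PerfectField (IsLocalRing.ResidueField 𝔬)]
    (ω η : Set.Ioo (0 : ℝ) 1)
    {A : Type*} [CommRing A] [Algebra (LaurentSeries (IsLocalRing.ResidueField 𝔬)) A]
    (hA : DaggerLift.IsMixedAffinoid (IsLocalRing.ResidueField 𝔬) A) [IsRegularRing A]
    {S : Type*} [CommRing S] [Algebra 𝔬 S]
    (ρ : S →+* A) (hS : DaggerLift.IsDaggerLift (𝔬 := 𝔬) ω η ρ)
    (q : ℕ) (hq : ∃ a : ℕ, q = p ^ a)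
    (g : S →+* S) (hg : ∀ x : S, ρ (g x) = ρ x ^ q)
    (hm : CharZero 𝔬 ∨
      ∃ N : ℕ, ((IsLocalRing.maximalIdeal 𝔬).map (algebraMap 𝔬 S)) ^ N ≤
        ((IsLocalRing.maximalIdeal 𝔬).map (algebraMap 𝔬 S)).map g) :
    g.Finite ∧ g.Flat := by
  obtain ⟨a, rfl⟩ := hq
  obtain ⟨m, n, f, hf⟩ := hS.presentation
  obtain ⟨ϖ, hϖ⟩ := IsDiscreteValuationRing.exists_irreducible 𝔬
  have hD := DaggerLift.dagger.isOverconvergent (m := m) (n := n) (ω := ω) (η := η) hϖ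
  have hp : p.Prime := Fact.out
  have hmap : (IsLocalRing.maximalIdeal 𝔬).map (algebraMap 𝔬 S) =
      Ideal.span {algebraMap 𝔬 S ϖ} := by
    rw [hϖ.maximalIdeal_eq, Ideal.map_span, Set.image_singleton]
  have hfϖ : (f : DaggerLift.dagger 𝔬 ω η m n →+* S) (algebraMap 𝔬 _ ϖ) = algebraMap 𝔬 S ϖ := f.commutes ϖ
  have hker : RingHom.ker ρ = Ideal.span {algebraMap 𝔬 S ϖ} := hS.ker_eq.trans hmap
  have hpϖ : ϖ ∣ (p : 𝔬) := by
    rw [← Ideal.mem_span_singleton, ← hϖ.maximalIdeal_eq, ← IsLocalRing.residue_eq_zero_iff,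
      map_natCast, CharP.cast_eq_zero]
  have ht : algebraMap 𝔬 S ϖ ∈ nonZeroDivisors S := by
    have := hS.flat
    refine mem_nonZeroDivisors_iff_right.2 fun x hx => ?_
    have h := Module.Flat.isSMulRegular_of_nonZeroDivisors (M := S)
      (mem_nonZeroDivisors_of_ne_zero hϖ.ne_zero)
    refine h ?_
    simpa [Algebra.smul_def, mul_comm] using hx
  have hgx : ∀ x, algebraMap 𝔬 S ϖ ∣ g x - x ^ p ^ a := fun x => by
    rw [← Ideal.mem_span_singleton, ← hker, RingHom.mem_ker, map_sub, hg, map_pow, sub_self]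
  have hN : ∃ N : ℕ, g (algebraMap 𝔬 S ϖ) ∣ algebraMap 𝔬 S ϖ ^ N := by
    rcases hm with h0 | ⟨N, hN⟩
    · exact DaggerLift.exists_dvd_pow_of_charZero hϖ p hpϖ g
    · refine ⟨N, ?_⟩
      rw [hmap, Ideal.span_singleton_pow, Ideal.map_span, Set.image_singleton,
        Ideal.span_singleton_le_span_singleton] at hN
      exact hN
  obtain ⟨N, hN⟩ := hN
  have hfin : g.Finite := by
    refine hD.finite_of_dvd_sub_pow hp ?_ (fun a => ?_) (f : DaggerLift.dagger 𝔬 ω η m n →+* S) hf ?_ g a ?_ N ?_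
    · simpa using map_dvd (algebraMap 𝔬 (DaggerLift.dagger 𝔬 ω η m n)) hpϖ
    · exact (DaggerLift.frobeniusSpans_range_reduction hϖ p a).exists_eq_add_mul
        (DaggerLift.reduction m n ω η hϖ).rangeRestrict (RingHom.rangeRestrict_surjective _)
        (DaggerLift.dvd_of_rangeRestrict_eq_zero hϖ)
    · rwa [hfϖ]
    · rwa [hfϖ]
    · rwa [hfϖ]
  have := hD.isNoetherianRing
  have : IsNoetherianRing S := isNoetherianRing_of_surjective _ _ (f : DaggerLift.dagger 𝔬 ω η m n →+* S) hf
  -- The Jacobson radical property passes from `D` to its quotient `S`.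
  have hjac : algebraMap 𝔬 S ϖ ∈ (⊥ : Ideal S).jacobson := by
    rw [Ideal.mem_jacobson_bot]
    intro y
    obtain ⟨y, rfl⟩ := hf y
    have h := (Ideal.mem_jacobson_bot.1 hD.mem_jacobson y).map f
    rwa [map_add, map_mul, map_one, f.commutes] at h
  exact ⟨hfin, DaggerLift.flat_of_finite_of_isRegularRing_quotient ht hjac ρ hS.surjective hker g
    hfin (Nat.pow_pos hp.pos).ne' hgx hN⟩
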